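/- **Setting.** Let $[a_{ij}]_{i,j\in I}$ be a generalized Cartan matrix symmetrized by positive integers $d_i$ ($a_{ii}=2$; $a_{ij}\le 0$ for $i\neq j$; $a_{ij}=0\Leftrightarrow a_{ji}=0$; $d_ia_{ij}=d_ja_{ji}$). Let $Q^\vee$ be a free $\mathbb Z$-module, $P=\operatorname{Hom}(Q^\vee,\mathbb Z)$ with the canonical pairing $\langle\ ,\ \rangle$, and let $\alpha_i^\vee\in Q^\vee$ (linearly independent) and $\alpha_i\in P$ (distinct) satisfy $\langle\alpha_i^\vee,\alpha_j\rangle=a_{ij}$. Put $s_i(\beta)=\beta-\langle\beta,\alpha_i\rangle\alpha_i^\vee$ on $Q^\vee$ and $s_i(\lambda)=\lambda-\langle\alpha_i^\vee,\lambda\rangle\alpha_i$ on $P$. The Weyl group $W$ is the group generated by $s_i$ ($i\in I$) with the defining relations $$s_i^2=1;\quad s_is_j=s_js_i,\quad s_is_js_i=s_js_is_j,\quad (s_is_j)^2=(s_js_i)^2,\quad (s_is_j)^3=(s_js_i)^3\qquad(\ast)$$ the last four when $(a_{ij},a_{ji})=(0,0),(-1,-1),(-1,-2),(-1,-3)$ respectively.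 Two cases are considered. In the *Kac–Moody case* let $\Bbbk=\mathbb C$, let $\mathfrak g$ be the Kac–Moody Lie algebra over $\mathbb C$ defined by the Chevalley–Serre generators and relations, with Cartan part $Q^\vee\otimes\mathbb C$, and let $U_-=U(\mathfrak n_-)$, where $\mathfrak n_-\subset\mathfrak g$ is the Lie subalgebra generated by the $f_i$. In the *$q$-difference case* let $\Bbbk=\mathbb C(q)$, $q_i=q^{d_i}$, and let $U_-=U_q(\mathfrak n_-)$ be the subalgebra of $U_q(\mathfrak g)$ generated by the $f_i$. Let $A$ be a quotient algebra of $U_-$ which has no zero divisors and in which every $f_i\neq0$. Let $\widetilde A=A[f_i^{-1}\mid i\in I]$ be the Ore localization of $A$. For a $\Bbbk$-algebra $R$, let $R^P$ be the algebra of families $(a_\lambda)_{\lambda\in P}$, and let $D(R^P)=\bigoplus_{\mu\in P}R^P\tau^\mu$ with $\tau^\lambda\tau^\mu=\tau^{\lambda+\mu}$ and $\tau^\mu (a_\lambda)_\lambda=(a_{\lambda+\mu})_\lambda\tau^\mu$. Let $\widetilde A^{pa}$ be the polynomial algebra $\widetilde A[\beta\mid\beta\in Q^\vee]$ in a basis of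 $Q^\vee$ (Kac–Moody case), resp. the group algebra $\widetilde A[q^\beta\mid\beta\in Q^\vee]$ ($q$-difference case), with central parameters; it is mapped to $\widetilde A^P$ by $\phi=(\phi_\lambda)_{\lambda\in P}$, where $\phi_\lambda$ is the identity on $\widetilde A$ and $\phi_\lambda(\beta)=\langle\beta,\lambda\rangle$, resp. $\phi_\lambda(q^\beta)=q^{\langle\beta,\lambda\rangle}$. Put $f_i^\beta=(f_i^{\langle\beta,\lambda\rangle})_{\lambda\in P}$ for $\beta\in Q^\vee$, let $\mathcal A\subset\widetilde A^P$ be the subalgebra generated by $\phi(\widetilde A^{pa})$ and all $f_i^\beta$, and let $D(\mathcal A)=\mathcal A[\tau^\mu\mid\mu\in P]\subset D(\widetilde A^P)$. If $A$ is an Ore domain, put $K=Q(A)$, define $A^{pa}$ and $\phi_\lambda:A^{pa}\to A$ in the same way with $A$ in place of $\widetilde A$, let $A^{pa}_{(P)}=\bigcap_{\lambda\in P}A^{pa}[S_\lambda^{-1}]\subset Q(A^{pa})$ with $S_\lambda=\{s\mid\phi_\lambda(s)\neq0\}$, mapped to $K^P$ by $\phi_\lambda(as^{-1})=\phi_\lambda(a)\phi_\lambda(s)^{-1}$;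 let $\mathcal A_{(P)}\subset K^P$ be the subalgebra generated by the image of $A^{pa}_{(P)}$ and all $f_i^\beta$, and $D(\mathcal A_{(P)})=\mathcal A_{(P)}[\tau^\mu\mid\mu\in P]\subset D(K^P)$. Let $\tilde s_i$ be the automorphism $(a_\lambda)_\lambda\mapsto(a_{s_i(\lambda)})_\lambda$, $\tau^\mu\mapsto\tau^{s_i(\mu)}$ of $D(R^P)$ ($R=\widetilde A$ or $K$), and set $\mathbf s_i=\operatorname{Ad}(f_i^{\alpha_i^\vee})\circ\tilde s_i$, where $\operatorname{Ad}(a)(x)=axa^{-1}$. **Theorem.** In both cases, on $D(\mathcal A)$, and also on $D(\mathcal A_{(P)})$ when $A$ is an Ore domain, the following hold. 1. The $\mathbf s_i$ restrict to algebra automorphisms, and these satisfy the relations $(\ast)$ of the Weyl group. Hence there is a unique action of $W$ by algebra automorphisms in which $s_i$ acts as $\mathbf s_i$. 2. For $\mu\in P$, $\ \mathbf s_i(\tau^\mu)=f_i^{\langle\alpha_i^\vee,\mu\rangle}\tau^{s_i(\mu)}$. 3. On the parameter and dependent variables the action is the quantum birational one: $\mathbf s_i(\beta)=s_i(\beta)$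 (Kac–Moody case), $\mathbf s_i(q^\beta)=q^{s_i(\beta)}$ ($q$-difference case), $\mathbf s_i(f_i)=f_i$, and for $i\neq j$ $$\mathbf s_i(f_j)=\sum_{k=0}^{-a_{ij}}\binom{\alpha_i^\vee}{k}(\operatorname{ad}f_i)^k(f_j)f_i^{-k},\qquad\text{resp.}\qquad \mathbf s_i(f_j)=\sum_{k=0}^{-a_{ij}}q_i^{(k+a_{ij})(\alpha_i^\vee-k)}\genfrac{[}{]}{0pt}{}{\alpha_i^\vee}{k}_{q_i}(\operatorname{ad}f_i)^k(f_j)f_i^{-k},$$ where $(\operatorname{ad}f_i)(x)=f_ix-xf_i$ in the Kac–Moody case and $(\operatorname{ad}f_i)^{k+1}(f_j)=f_i(\operatorname{ad}f_i)^k(f_j)-q_i^{a_{ij}+2k}(\operatorname{ad}f_i)^k(f_j)f_i$ in the $q$-difference case. 4. The fractional powers satisfy the Verma identities: for $\beta,\gamma\in Q^\vee$, - $f_i^\beta f_j^\gamma=f_j^\gamma f_i^\beta$ if $(a_{ij},a_{ji})=(0,0)$; - $f_i^\beta f_j^{\beta+\gamma}f_i^\gamma=f_j^\gamma f_i^{\beta+\gamma}f_j^\beta$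 if $(a_{ij},a_{ji})=(-1,-1)$; - $f_i^\beta f_j^{2\beta+\gamma}f_i^{\beta+\gamma}f_j^\gamma=f_j^\gamma f_i^{\beta+\gamma}f_j^{2\beta+\gamma}f_i^\beta$ if $(a_{ij},a_{ji})=(-1,-2)$; - $f_i^\beta f_j^{3\beta+\gamma}f_i^{2\beta+\gamma}f_j^{3\beta+2\gamma}f_i^{\beta+\gamma}f_j^\gamma=f_j^\gamma f_i^{\beta+\gamma}f_j^{3\beta+2\gamma}f_i^{2\beta+\gamma}f_j^{3\beta+\gamma}f_i^\beta$ if $(a_{ij},a_{ji})=(-1,-3)$. -/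

import Mathlib

namespace QBW

/-! ### Ore domains, skew fields of fractions, localization at the dependent variables -/

/-- A domain satisfying the left Ore condition: any `a` and `b ≠ 0` have a common left multiple
`d * a = c * b` with `d ≠ 0`. -/
class LeftOreDomain (A : Type*) [Ring A] : Prop extends IsDomain A where
  left_ore : ∀ a b : A, b ≠ 0 → ∃ c d : A, d ≠ 0 ∧ d * a = c * b

/-- An Ore domain: a domain satisfying both the left and the right Ore condition. -/
class OreDomain (A : Type*) [Ring A] : Prop extends LeftOreDomain A where
  right_ore : ∀ a b : A, b ≠ 0 → ∃ c d : A, d ≠ 0 ∧ a * d = b * c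

theorem nonempty_oreSet_nonZeroDivisors (A : Type*) [Ring A] [LeftOreDomain A] :
    Nonempty (OreLocalization.OreSet (nonZeroDivisors A)) := by
  rw [OreLocalization.nonempty_oreSet_iff_of_noZeroDivisors]
  intro r s
  obtain ⟨c, d, hd, h⟩ := LeftOreDomain.left_ore r (s : A) (nonZeroDivisors.ne_zero s.2)
  exact ⟨c, ⟨d, mem_nonZeroDivisors_of_ne_zero hd⟩, h⟩

/-- The Ore set of all nonzero elements. -/
noncomputable instance oreSetNonZeroDivisors (A : Type*) [Ring A] [LeftOreDomain A] :
    OreLocalization.OreSet (nonZeroDivisors A) :=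
  (nonempty_oreSet_nonZeroDivisors A).some

/-- `Q(A)`, the skew field of fractions of an Ore domain. -/
abbrev SkewFrac (A : Type*) [Ring A] [LeftOreDomain A] : Type _ :=
  OreLocalization (nonZeroDivisors A) A

/-- The embedding `A → Q(A)`. -/
noncomputable abbrev toFrac {A : Type*} [Ring A] [LeftOreDomain A] : A →+* SkewFrac A :=
  OreLocalization.numeratorRingHom

theorem toFrac_injective {A : Type*} [Ring A] [LeftOreDomain A] :
    Function.Injective (toFrac : A → SkewFrac A) :=
  OreLocalization.numeratorHom_inj (fun _ hx => (mem_nonZeroDivisors_iff.mp hx).1)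

theorem exists_toFrac_mul_eq {A : Type*} [Ring A] [LeftOreDomain A] (x : SkewFrac A) :
    ∃ t b : A, t ≠ 0 ∧ toFrac t * x = toFrac b := by
  induction x using OreLocalization.ind with
  | _ r s =>
    exact ⟨s, r, nonZeroDivisors.ne_zero s.2,
      OreLocalization.mul_cancel (r := r) (s := s) (t := 1)⟩

/-- Finitely many elements of `Q(A)` have a common denominator. -/
theorem exists_common_denom {A : Type*} [Ring A] [LeftOreDomain A] {X : Type*} (c : X → SkewFrac A)
    (F : Finset X) : ∃ s : A, s ≠ 0 ∧ ∀ x ∈ F, ∃ a : A, toFrac s * c x = toFrac a := by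
  classical
  induction F using Finset.induction_on with
  | empty => exact ⟨1, one_ne_zero, by simp⟩
  | insert x F _ ih =>
    obtain ⟨s, hs, h⟩ := ih
    obtain ⟨t, b, ht, hb⟩ := exists_toFrac_mul_eq (c x)
    obtain ⟨v, u, hu, huv⟩ := LeftOreDomain.left_ore s t ht
    refine ⟨u * s, mul_ne_zero hu hs, fun y hy => ?_⟩
    rcases Finset.mem_insert.mp hy with rfl | hy
    · exact ⟨v * b, by rw [huv, map_mul, mul_assoc, hb, map_mul]⟩
    · obtain ⟨a, ha⟩ := h y hy
      exact ⟨u * a, by rw [map_mul, mul_assoc, ha, map_mul]⟩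

/-- Over a left Ore domain, a homogeneous linear system with more unknowns than equations has a
nonzero solution. -/
theorem exists_nonzero_solution {A : Type*} [Ring A] [LeftOreDomain A] {X Y : Type*} [Fintype X]
    [Fintype Y] (hXY : Fintype.card Y < Fintype.card X) (m : X → Y → A) :
    ∃ c : X → A, c ≠ 0 ∧ ∀ y, ∑ x, c x * m x y = 0 := by
  let L : (X → SkewFrac A) →ₗ[SkewFrac A] (Y → SkewFrac A) :=
    { toFun := fun c y => ∑ x, c x * toFrac (m x y)
      map_add' := fun c d => by ext y; simp [add_mul, Finset.sum_add_distrib]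
      map_smul' := fun r c => by ext y; simp [mul_assoc, Finset.mul_sum] }
  have hker : LinearMap.ker L ≠ ⊥ := LinearMap.ker_ne_bot_of_finrank_lt (by simpa using hXY)
  obtain ⟨c, hc, hc0⟩ := (Submodule.ne_bot_iff _).mp hker
  obtain ⟨s, hs, h⟩ := exists_common_denom c Finset.univ
  choose a ha using fun x => h x (Finset.mem_univ x)
  have hs' : (toFrac s : SkewFrac A) ≠ 0 := by
    simpa using toFrac_injective.ne hs
  refine ⟨a, ?_, fun y => ?_⟩
  · rintro rfl
    apply hc0
    ext x
    have := ha x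
    simp only [Pi.zero_apply, map_zero] at this
    exact (mul_eq_zero.mp this).resolve_left hs'
  · apply toFrac_injective
    have h2 : L c y = 0 := congrFun (LinearMap.mem_ker.mp hc) y
    have h3 : ∑ x, c x * toFrac (m x y) = 0 := h2
    rw [map_sum, map_zero]
    calc ∑ x, toFrac (a x * m x y) = toFrac s * ∑ x, c x * toFrac (m x y) := by
          rw [Finset.mul_sum]
          exact Finset.sum_congr rfl fun x _ => by rw [map_mul, ← ha x, mul_assoc]
      _ = 0 := by rw [h3, mul_zero]

/-- In a commutative monoid the sumsets `n • T` grow polynomially, so for some `n` the set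
`(n + 1) • T` has less than twice as many elements as `n • T`. -/
theorem exists_small_doubling {M : Type*} [AddCommMonoid M] [DecidableEq M] (T : Finset M)
    (hT : T.Nonempty) :
    ∃ F : Finset M, F.Nonempty ∧ (Finset.image₂ (· + ·) F T).card < 2 * F.card := by
  classical
  let S : ℕ → Finset M := fun n => Nat.rec {0} (fun _ F => Finset.image₂ (· + ·) F T) n
  have hS : ∀ n, S (n + 1) = Finset.image₂ (· + ·) (S n) T := fun n => rfl
  have hne : ∀ n, (S n).Nonempty := by
    intro n
    induction n with
    | zero => exact Finset.singleton_nonempty 0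
    | succ n ih => rw [hS]; exact ih.image₂ hT
  by_contra hcon
  push Not at hcon
  have hlow : ∀ n, 2 ^ n ≤ (S n).card := by
    intro n
    induction n with
    | zero => simp [S]
    | succ n ih =>
      rw [hS, pow_succ, mul_comm]
      exact (Nat.mul_le_mul_left 2 ih).trans (hcon _ (hne n))
  have hrep : ∀ n, ∀ x ∈ S n, ∃ e : T → ℕ, (∀ t, e t ≤ n) ∧ x = ∑ t, e t • (t : M) := by
    intro n
    induction n with
    | zero => intro x hx; exact ⟨0, by simp, by simpa [S] using hx⟩
    | succ n ih =>
      intro x hx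
      rw [hS] at hx
      obtain ⟨y, hy, t, ht, rfl⟩ := Finset.mem_image₂.mp hx
      obtain ⟨e, he, rfl⟩ := ih y hy
      refine ⟨e + Pi.single ⟨t, ht⟩ 1, fun u => ?_, ?_⟩
      · have := he u
        by_cases hu : u = ⟨t, ht⟩
        · subst hu; simp; omega
        · simp [Pi.single_eq_of_ne hu]; omega
      · simp only [Pi.add_apply, add_smul, Finset.sum_add_distrib]
        congr 1
        rw [Finset.sum_eq_single ⟨t, ht⟩]
        · simp
        · intro b _ hb; simp [Pi.single_eq_of_ne hb]
        · simp
  have hup : ∀ n, (S n).card ≤ (n + 1) ^ T.card := by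
    intro n
    have hsub : S n ⊆ Finset.image (fun e : T → Fin (n + 1) => ∑ t, (e t : ℕ) • (t : M))
        Finset.univ := by
      intro x hx
      obtain ⟨e, he, rfl⟩ := hrep n x hx
      exact Finset.mem_image.mpr
        ⟨fun t => ⟨e t, Nat.lt_succ_of_le (he t)⟩, Finset.mem_univ _, rfl⟩
    refine (Finset.card_le_card hsub).trans (Finset.card_image_le.trans ?_)
    simp
  have hlim : Filter.Tendsto (fun n : ℕ => ((n : ℝ) ^ T.card) / (2 : ℝ) ^ n) Filter.atTop
      (nhds 0) := tendsto_pow_const_div_const_pow_of_one_lt T.card one_lt_two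
  have h1 := (hlim.comp (Filter.tendsto_add_atTop_nat 1)).eventually
    (gt_mem_nhds (show (0 : ℝ) < 1 / 2 by norm_num))
  obtain ⟨n, hn⟩ := h1.exists
  have h2 : (2 : ℝ) ^ n ≤ ((n : ℝ) + 1) ^ T.card := by
    exact_mod_cast (hlow n).trans (hup n)
  simp only [Function.comp, Nat.cast_add, Nat.cast_one] at hn
  rw [div_lt_iff₀ (by positivity), pow_succ] at hn
  linarith

/-- The monoid algebra of a commutative monoid over a left Ore domain is left Ore. -/
instance {A M : Type*} [Ring A] [LeftOreDomain A] [AddCommMonoid M] [UniqueSums M] :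
    LeftOreDomain (AddMonoidAlgebra A M) where
  left_ore := by
    classical
    intro a b hb
    have hT : (a.coeff.support ∪ b.coeff.support).Nonempty := by
      refine Finset.Nonempty.inr (Finsupp.support_nonempty_iff.mpr fun h => hb ?_)
      exact AddMonoidAlgebra.coeff_injective h
    obtain ⟨F, hF, hcard⟩ := exists_small_doubling _ hT
    set T := a.coeff.support ∪ b.coeff.support with hTdef
    set E := Finset.image₂ (· + ·) F T with hE
    let g : F ⊕ F → AddMonoidAlgebra A M :=
      Sum.elim (fun x => AddMonoidAlgebra.single (x : M) 1 * a)
        (fun x => -(AddMonoidAlgebra.single (x : M) 1 * b))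
    have hsupp : ∀ (x : F) (w : AddMonoidAlgebra A M), w.coeff.support ⊆ T → ∀ y, y ∉ E →
        (AddMonoidAlgebra.single (x : M) 1 * w).coeff y = 0 := by
      intro x w hw y hy
      rw [AddMonoidAlgebra.coeff_mul]
      simp only [AddMonoidAlgebra.coeff_single]
      rw [Finsupp.sum_single_index (by simp), Finsupp.sum]
      refine Finset.sum_eq_zero fun z hz => if_neg ?_
      rintro rfl
      exact hy (Finset.mem_image₂_of_mem x.2 (hw hz))
    obtain ⟨c, hc, hsol⟩ := exists_nonzero_solution (A := A) (X := F ⊕ F) (Y := E)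
      (by simpa [two_mul] using hcard) (fun x y => (g x).coeff y)
    let comb : (F → A) → AddMonoidAlgebra A M := fun e =>
      ∑ x : F, AddMonoidAlgebra.single (x : M) (e x)
    have hcomb : ∀ (e : F → A) (x : F), (comb e).coeff x = e x := by
      intro e x
      simp only [comb, AddMonoidAlgebra.coeff_sum, AddMonoidAlgebra.coeff_single,
        Finsupp.finsetSum_apply]
      rw [Finset.sum_eq_single x]
      · simp
      · intro y _ hy
        exact Finsupp.single_eq_of_ne (fun h => hy (Subtype.ext h.symm))
      · simp
    have hmul : ∀ (e : F → A) (w : AddMonoidAlgebra A M) (y : M), (comb e * w).coeff y =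
        ∑ x : F, e x * (AddMonoidAlgebra.single (x : M) 1 * w).coeff y := by
      intro e w y
      simp only [comb, Finset.sum_mul, AddMonoidAlgebra.coeff_sum, Finsupp.finsetSum_apply]
      refine Finset.sum_congr rfl fun x _ => ?_
      have : (AddMonoidAlgebra.single (x : M) (e x) : AddMonoidAlgebra A M) =
          e x • AddMonoidAlgebra.single (x : M) 1 := by
        simp
      rw [this, smul_mul_assoc]
      rfl
    have heq : comb (fun x => c (Sum.inl x)) * a = comb (fun x => c (Sum.inr x)) * b := by
      apply AddMonoidAlgebra.coeff_injective
      ext y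
      by_cases hy : y ∈ E
      · have := hsol ⟨y, hy⟩
        rw [Fintype.sum_sum_type] at this
        simp only [g, Sum.elim_inl, Sum.elim_inr, AddMonoidAlgebra.coeff_neg, Finsupp.neg_apply,
          mul_neg, Finset.sum_neg_distrib] at this
        rw [hmul, hmul]
        exact add_neg_eq_zero.mp this
      · rw [hmul, hmul, Finset.sum_eq_zero, Finset.sum_eq_zero]
        · intro x _
          rw [hsupp x b Finset.subset_union_right y hy, mul_zero]
        · intro x _
          rw [hsupp x a Finset.subset_union_left y hy, mul_zero]
    refine ⟨comb (fun x => c (Sum.inr x)), comb (fun x => c (Sum.inl x)), fun h0 => hc ?_, heq⟩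
    rw [h0, zero_mul] at heq
    have h1 := (mul_eq_zero.mp heq.symm).resolve_right hb
    ext x
    rcases x with x | x
    · simpa using ((hcomb (fun x => c (Sum.inl x)) x).symm.trans (by rw [h0]; rfl))
    · simpa using ((hcomb (fun x => c (Sum.inr x)) x).symm.trans (by rw [h1]; rfl))

end QBW

namespace QBW

/-- Elements `f i` whose powers satisfy the left Ore condition with respect to all of `A`. -/
class OreGenerators {I A : Type*} [Ring A] (f : I → A) : Prop where
  ore : ∀ (i : I) (a : A), ∃ (N : ℕ) (r : A), f i ^ N * a = r * f i

theorem nonempty_oreSet_closure {I A : Type*} [Ring A] [NoZeroDivisors A] (f : I → A)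
    [OreGenerators f] :
    Nonempty (OreLocalization.OreSet (Submonoid.closure (Set.range f))) := by
  rw [OreLocalization.nonempty_oreSet_iff_of_noZeroDivisors]
  rintro r ⟨s, hs⟩
  induction hs using Submonoid.closure_induction generalizing r with
  | mem x hx =>
    obtain ⟨i, rfl⟩ := hx
    obtain ⟨N, r', h⟩ := OreGenerators.ore (f := f) i r
    exact ⟨r', ⟨f i ^ N, Submonoid.pow_mem _ (Submonoid.subset_closure (Set.mem_range_self i)) N⟩, h⟩
  | one => exact ⟨r, 1, by simp⟩
  | mul x y _ _ hx hy =>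
    obtain ⟨r1, s1, h1⟩ := hy r
    obtain ⟨r2, s2, h2⟩ := hx r1
    refine ⟨r2, s2 * s1, ?_⟩
    simp only at h1 h2 ⊢
    rw [Submonoid.coe_mul, mul_assoc, h1, ← mul_assoc, h2, mul_assoc]

noncomputable instance oreSetClosure {I A : Type*} [Ring A] [NoZeroDivisors A] (f : I → A)
    [OreGenerators f] : OreLocalization.OreSet (Submonoid.closure (Set.range f)) :=
  (nonempty_oreSet_closure f).some

/-- `A[f_i⁻¹ | i ∈ I]`, the Ore localization of `A` at the multiplicative set generated by the
`f_i`. -/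
abbrev Localized {I A : Type*} [Ring A] [NoZeroDivisors A] (f : I → A) [OreGenerators f] :
    Type _ :=
  OreLocalization (Submonoid.closure (Set.range f)) A

/-- The `f_i` as units of `A[f_i⁻¹ | i ∈ I]`. -/
noncomputable def Localized.unit {I A : Type*} [Ring A] [NoZeroDivisors A] (f : I → A)
    [OreGenerators f] (i : I) : (Localized f)ˣ :=
  OreLocalization.numeratorUnit (S := Submonoid.closure (Set.range f))
    ⟨f i, Submonoid.subset_closure ⟨i, rfl⟩⟩

/-- Relations of Serre type between generators `f_i` of an algebra imply the Ore condition. -/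
theorem oreGenerators_of_serre (k : Type*) {I A : Type*} [CommRing k] [Ring A] [Algebra k A]
    (f : I → A) (hgen : Algebra.adjoin k (Set.range f) = ⊤)
    (hs : ∀ i j, i ≠ j → ∃ (n : ℕ) (c : ℕ → k), f i ^ (n + 1) * f j =
      ∑ s ∈ Finset.range (n + 1), c s • (f i ^ s * f j * f i ^ (n + 1 - s))) :
    OreGenerators f := by
  have key : ∀ i j (m : ℕ), ∃ (N : ℕ) (r : A), f i ^ N * f j = r * f i ^ m := by
    intro i j m
    by_cases hij : i = j
    · subst hij
      exact ⟨m, f i, by rw [← pow_succ, ← pow_succ']⟩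
    obtain ⟨n, c, h⟩ := hs i j hij
    suffices H : ∀ m : ℕ, ∃ r : A, f i ^ (n + m) * f j = r * f i ^ m from ⟨n + m, H m⟩
    intro m
    induction m using Nat.strong_induction_on with
    | _ m ih =>
      rcases m with _ | m
      · exact ⟨f i ^ n * f j, by simp⟩
      have hterm : ∀ s ∈ Finset.range (n + 1), ∃ r : A,
          f i ^ m * (c s • (f i ^ s * f j * f i ^ (n + 1 - s))) = r * f i ^ (m + 1) := by
        intro s hs
        have hs' : s ≤ n := Nat.lt_succ_iff.mp (Finset.mem_range.mp hs)
        by_cases hsm : s + m ≤ n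
        · refine ⟨c s • (f i ^ m * (f i ^ s * f j * f i ^ (n - s - m))), ?_⟩
          rw [mul_smul_comm, smul_mul_assoc]
          congr 1
          simp only [mul_assoc]
          rw [← pow_add, show n - s - m + (m + 1) = n + 1 - s by omega]
        · obtain ⟨r, hr⟩ := ih (m + s - n) (by omega)
          refine ⟨c s • r, ?_⟩
          rw [mul_smul_comm, smul_mul_assoc]
          congr 1
          calc f i ^ m * (f i ^ s * f j * f i ^ (n + 1 - s))
              = f i ^ (n + (m + s - n)) * f j * f i ^ (n + 1 - s) := by
                rw [show n + (m + s - n) = m + s by omega, pow_add]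
                simp only [mul_assoc]
            _ = r * f i ^ (m + 1) := by
                rw [hr, mul_assoc, ← pow_add, show m + s - n + (n + 1 - s) = m + 1 by omega]
      choose! r hr using hterm
      refine ⟨∑ s ∈ Finset.range (n + 1), r s, ?_⟩
      rw [show n + (m + 1) = m + (n + 1) by omega, pow_add, mul_assoc, h, Finset.mul_sum,
        Finset.sum_mul]
      exact Finset.sum_congr rfl hr
  refine ⟨fun i a => ?_⟩
  suffices H : ∀ m : ℕ, ∃ (N : ℕ) (r : A), f i ^ N * a = r * f i ^ m by simpa using H 1
  have ha : a ∈ Algebra.adjoin k (Set.range f) := by rw [hgen]; trivial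
  induction ha using Algebra.adjoin_induction with
  | mem x hx =>
    obtain ⟨j, rfl⟩ := hx
    exact key i j
  | algebraMap r =>
    intro m
    exact ⟨m, algebraMap k A r, (Algebra.commutes r _).symm⟩
  | add x y _ _ hx hy =>
    intro m
    obtain ⟨N1, r1, h1⟩ := hx m
    obtain ⟨N2, r2, h2⟩ := hy m
    refine ⟨N1 + N2, f i ^ N2 * r1 + f i ^ N1 * r2, ?_⟩
    rw [mul_add, add_mul, mul_assoc, mul_assoc, ← h1, ← h2, ← mul_assoc, ← mul_assoc, ← pow_add,
      ← pow_add, add_comm N2 N1]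
  | mul x y _ _ hx hy =>
    intro m
    obtain ⟨N2, r2, h2⟩ := hy m
    obtain ⟨N1, r1, h1⟩ := hx N2
    exact ⟨N1, r1 * r2, by rw [← mul_assoc, h1, mul_assoc, h2, mul_assoc]⟩

/-! ### Generalized Cartan matrices, coroot and weight lattices, Weyl groups -/

/-- A generalized Cartan matrix `a` symmetrized by positive integers `d_i`, with simple coroots in
the lattice `Qv` and simple roots in the weight lattice `P = Hom(Qv, ℤ)`; the pairing
`⟨β, λ⟩` is `λ β`. -/
structure CartanDatum (I Qv : Type*) [AddCommGroup Qv] where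
  /-- the matrix `[a_ij]` -/
  a : I → I → ℤ
  /-- the symmetrizing integers -/
  d : I → ℕ
  a_diag : ∀ i, a i i = 2
  a_nonpos : ∀ i j, i ≠ j → a i j ≤ 0
  a_eq_zero_iff : ∀ i j, a i j = 0 ↔ a j i = 0
  d_pos : ∀ i, 0 < d i
  symm : ∀ i j, (d i : ℤ) * a i j = (d j : ℤ) * a j i
  /-- the simple coroots `α_i^∨` -/
  coroot : I → Qv
  /-- the simple roots `α_i` -/
  root : I → Module.Dual ℤ Qv
  pairing : ∀ i j, root j (coroot i) = a i j
  coroot_linearIndependent : LinearIndependent ℤ coroot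
  root_injective : Function.Injective root

variable {I Qv : Type*} [AddCommGroup Qv]

namespace CartanDatum

/-- `s_i` on the coroot lattice: `s_i(β) = β - ⟨β, α_i⟩ α_i^∨`. -/
def reflQ (D : CartanDatum I Qv) (i : I) (β : Qv) : Qv :=
  β - D.root i β • D.coroot i

/-- `s_i` on the weight lattice: `s_i(λ) = λ - ⟨α_i^∨, λ⟩ α_i`. -/
def reflP (D : CartanDatum I Qv) (i : I) : Module.Dual ℤ Qv ≃+ Module.Dual ℤ Qv where
  toFun l := l - l (D.coroot i) • D.root i
  invFun l := l - l (D.coroot i) • D.root i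
  left_inv l := by
    have h := (D.pairing i i).trans (D.a_diag i)
    ext x
    simp only [LinearMap.sub_apply, LinearMap.smul_apply, smul_eq_mul, h]
    ring
  right_inv l := by
    have h := (D.pairing i i).trans (D.a_diag i)
    ext x
    simp only [LinearMap.sub_apply, LinearMap.smul_apply, smul_eq_mul, h]
    ring
  map_add' l m := by
    ext x
    simp only [LinearMap.sub_apply, LinearMap.smul_apply, LinearMap.add_apply, smul_eq_mul]
    ring

/-- The defining relators of the Weyl group, as elements of the free group on the `s_i`. -/
inductive WeylRelator (D : CartanDatum I Qv) : FreeGroup I → Prop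
  | sq (i : I) : WeylRelator D (FreeGroup.of i ^ 2)
  | comm (i j : I) (h : (D.a i j, D.a j i) = (0, 0)) :
      WeylRelator D (FreeGroup.of i * FreeGroup.of j * (FreeGroup.of j * FreeGroup.of i)⁻¹)
  | braid3 (i j : I) (h : (D.a i j, D.a j i) = (-1, -1)) :
      WeylRelator D (FreeGroup.of i * FreeGroup.of j * FreeGroup.of i *
        (FreeGroup.of j * FreeGroup.of i * FreeGroup.of j)⁻¹)
  | braid4 (i j : I) (h : (D.a i j, D.a j i) = (-1, -2)) :
      WeylRelator D ((FreeGroup.of i * FreeGroup.of j) ^ 2 *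
        ((FreeGroup.of j * FreeGroup.of i) ^ 2)⁻¹)
  | braid6 (i j : I) (h : (D.a i j, D.a j i) = (-1, -3)) :
      WeylRelator D ((FreeGroup.of i * FreeGroup.of j) ^ 3 *
        ((FreeGroup.of j * FreeGroup.of i) ^ 3)⁻¹)

/-- The Weyl group `W` of the generalized Cartan matrix. -/
abbrev WeylGroup (D : CartanDatum I Qv) : Type _ :=
  PresentedGroup {r : FreeGroup I | D.WeylRelator r}

/-- The generator `s_i` of the Weyl group. -/
def simple (D : CartanDatum I Qv) (i : I) : D.WeylGroup :=
  PresentedGroup.of i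

end CartanDatum

/-! ### Families over the weight lattice and difference operators -/

/-- `R^P`, the algebra of families `(a_λ)` indexed by the weight lattice `P = Hom(Qv, ℤ)`. -/
def Fam (Qv R : Type*) [AddCommGroup Qv] : Type _ := Module.Dual ℤ Qv → R

section Fam

variable {k R : Type*} [CommRing k] [Ring R] [Algebra k R]

instance : Ring (Fam Qv R) := inferInstanceAs (Ring (Module.Dual ℤ Qv → R))

instance : Algebra k (Fam Qv R) := inferInstanceAs (Algebra k (Module.Dual ℤ Qv → R))

/-- `μ ∈ P` acts on `R^P` by the translation `(a_λ) ↦ (a_{λ + μ})`. -/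
instance : MulSemiringAction (Multiplicative (Module.Dual ℤ Qv)) (Fam Qv R) where
  smul m a := fun l => a (l + m.toAdd)
  one_smul a := by funext l; exact congrArg a (add_zero l)
  mul_smul m n a := by
    funext l
    exact congrArg a (by rw [toAdd_mul, add_assoc])
  smul_zero _ := rfl
  smul_add _ _ _ := rfl
  smul_one _ := rfl
  smul_mul _ _ _ := rfl

instance : SMulCommClass (Multiplicative (Module.Dual ℤ Qv)) k (Fam Qv R) where
  smul_comm _ _ _ := rfl

/-- The constant family with value `r`. -/
def Fam.const (Qv : Type*) [AddCommGroup Qv] (r : R) : Fam Qv R := fun _ => r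

/-- The family `(a_λ)_λ` as an element of `R^P`. -/
def Fam.of (a : Module.Dual ℤ Qv → R) : Fam Qv R := a

variable (Qv R) in
/-- `D(R^P) = R^P[τ^μ | μ ∈ P]`, the algebra of finite sums `∑ a_μ τ^μ` with `a_μ ∈ R^P` and
`τ^μ a = μ(a) τ^μ`, where `μ(a)` is the translate of `a` by `μ`. -/
abbrev DiffAlg : Type _ := SkewMonoidAlgebra (Fam Qv R) (Multiplicative (Module.Dual ℤ Qv))

/-- The inclusion `R^P → D(R^P)`. -/
noncomputable def incl : Fam Qv R →+* DiffAlg Qv R := SkewMonoidAlgebra.singleOneRingHom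

/-- The `τ`-monomial `τ^μ`. -/
noncomputable def tau (R : Type*) [Ring R] (m : Module.Dual ℤ Qv) : DiffAlg Qv R :=
  SkewMonoidAlgebra.single (Multiplicative.ofAdd m) 1

/-- The inner automorphism `x ↦ a x a⁻¹`. -/
def innerAut (k : Type*) {X : Type*} [CommRing k] [Ring X] [Algebra k X] (a : Xˣ) : X ≃ₐ[k] X where
  toFun x := a * x * ↑a⁻¹
  invFun x := ↑a⁻¹ * x * a
  left_inv x := by simp [mul_assoc]
  right_inv x := by simp [mul_assoc]
  map_mul' x y := by simp [mul_assoc]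
  map_add' x y := by simp [mul_add, add_mul]
  commutes' r := by rw [← Algebra.commutes, mul_assoc, Units.mul_inv, mul_one]

/-- The substitution `(a_λ) ↦ (a_{w⁻¹(λ)})` on `R^P`. -/
def famMap (k R : Type*) [CommRing k] [Ring R] [Algebra k R]
    (w : Module.Dual ℤ Qv ≃+ Module.Dual ℤ Qv) : Fam Qv R →ₐ[k] Fam Qv R where
  toFun a := fun l => a (w.symm l)
  map_one' := rfl
  map_mul' _ _ := rfl
  map_zero' := rfl
  map_add' _ _ := rfl
  commutes' _ := rfl

variable (Qv R) in
/-- `μ ↦ τ^μ` as a monoid homomorphism. -/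
noncomputable def tauHom : Multiplicative (Module.Dual ℤ Qv) →* DiffAlg Qv R :=
  SkewMonoidAlgebra.of (Fam Qv R) (Multiplicative (Module.Dual ℤ Qv))

/-- The inclusion `R^P → D(R^P)` as a `k`-algebra homomorphism. -/
noncomputable def inclAlg (k Qv R : Type*) [AddCommGroup Qv] [CommRing k] [Ring R] [Algebra k R] :
    Fam Qv R →ₐ[k] DiffAlg Qv R :=
  { (incl : Fam Qv R →+* DiffAlg Qv R) with commutes' := fun _ => rfl }

/-- The endomorphism of `D(R^P)` induced by an additive automorphism `w` of `P`:
`(a_λ) ↦ (a_{w⁻¹(λ)})` and `τ^μ ↦ τ^{w(μ)}`. -/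
noncomputable def tildeHom (k R : Type*) [CommRing k] [Ring R] [Algebra k R]
    (w : Module.Dual ℤ Qv ≃+ Module.Dual ℤ Qv) : DiffAlg Qv R →ₐ[k] DiffAlg Qv R :=
  SkewMonoidAlgebra.liftNCAlgHom
    ((inclAlg k Qv R).comp (famMap k R w))
    ((tauHom Qv R).comp (AddMonoidHom.toMultiplicative (w : Module.Dual ℤ Qv →+ _)))
    (by
      intro a m
      change SkewMonoidAlgebra.single 1 _ * SkewMonoidAlgebra.single _ 1 =
        SkewMonoidAlgebra.single _ 1 * SkewMonoidAlgebra.single 1 _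
      rw [SkewMonoidAlgebra.single_mul_single, SkewMonoidAlgebra.single_mul_single, one_mul,
        mul_one, one_mul, smul_one, mul_one]
      congr 1
      funext l
      change a (w.symm l + m.toAdd) = a (w.symm (l + w m.toAdd))
      rw [map_add, AddEquiv.symm_apply_apply])

theorem tildeHom_single (k R : Type*) [CommRing k] [Ring R] [Algebra k R]
    (w : Module.Dual ℤ Qv ≃+ Module.Dual ℤ Qv) (m : Multiplicative (Module.Dual ℤ Qv))
    (a : Fam Qv R) : tildeHom k R w (SkewMonoidAlgebra.single m a) =
      SkewMonoidAlgebra.single (Multiplicative.ofAdd (w m.toAdd)) (famMap k R w a) := by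
  refine (SkewMonoidAlgebra.liftNC_single _ _ _ _).trans ?_
  change SkewMonoidAlgebra.single 1 (famMap k R w a) * SkewMonoidAlgebra.single _ 1 = _
  rw [SkewMonoidAlgebra.single_mul_single, one_mul, smul_one, mul_one]
  rfl

theorem tildeHom_tildeHom (k R : Type*) [CommRing k] [Ring R] [Algebra k R]
    (v w : Module.Dual ℤ Qv ≃+ Module.Dual ℤ Qv) (h : ∀ l, v (w l) = l) (x : DiffAlg Qv R) :
    tildeHom k R v (tildeHom k R w x) = x := by
  induction x using SkewMonoidAlgebra.induction_on with
  | zero => simp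
  | single m a =>
    rw [tildeHom_single, tildeHom_single, toAdd_ofAdd, h]
    congr 1
    funext l
    change a (w.symm (v.symm l)) = a l
    congr 1
    apply w.injective
    apply v.injective
    simp [h]
  | add x y hx hy => rw [map_add, map_add, hx, hy]

/-- The tilde action of an automorphism `w` of `P` on `D(R^P)`. -/
noncomputable def tilde (k R : Type*) [CommRing k] [Ring R] [Algebra k R]
    (w : Module.Dual ℤ Qv ≃+ Module.Dual ℤ Qv) : DiffAlg Qv R ≃ₐ[k] DiffAlg Qv R :=
  AlgEquiv.ofAlgHom (tildeHom k R w) (tildeHom k R w.symm)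
    (AlgHom.ext fun x => tildeHom_tildeHom k R w w.symm (fun l => w.apply_symm_apply l) x)
    (AlgHom.ext fun x => tildeHom_tildeHom k R w.symm w (fun l => w.symm_apply_apply l) x)

/-! ### Fractional powers and the quantum birational action -/

/-- The fractional power `f_i^β = (f_i^{⟨β, λ⟩})_λ`, for units `u i = f_i` of `R`. -/
def fpow {I : Type*} (u : I → Rˣ) (i : I) (b : Qv) : (Fam Qv R)ˣ where
  val := Fam.of fun l => ((u i ^ (l b) : Rˣ) : R)
  inv := Fam.of fun l => ((u i ^ (-(l b)) : Rˣ) : R)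
  val_inv := by
    funext l
    change ((u i ^ (l b) : Rˣ) : R) * ((u i ^ (-(l b)) : Rˣ) : R) = 1
    rw [← Units.val_mul, ← zpow_add, add_neg_cancel, zpow_zero, Units.val_one]
  inv_val := by
    funext l
    change ((u i ^ (-(l b)) : Rˣ) : R) * ((u i ^ (l b) : Rˣ) : R) = 1
    rw [← Units.val_mul, ← zpow_add, neg_add_cancel, zpow_zero, Units.val_one]

/-- `B[f_i^β | i ∈ I, β ∈ Qv] ⊆ R^P`. -/
def fracAlg (k : Type*) {R : Type*} [CommRing k] [Ring R] [Algebra k R] {I : Type*} (u : I → Rˣ)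
    (B : Set (Fam Qv R)) : Subalgebra k (Fam Qv R) :=
  Algebra.adjoin k (B ∪ {x | ∃ i b, x = ↑(fpow u i b : (Fam Qv R)ˣ)})

/-- `C[τ^μ | μ ∈ P] ⊆ D(R^P)` for a subalgebra `C ⊆ R^P`. -/
noncomputable def diffSubalg {k : Type*} {R : Type*} [CommRing k] [Ring R] [Algebra k R]
    (C : Subalgebra k (Fam Qv R)) : Subalgebra k (DiffAlg Qv R) :=
  Algebra.adjoin k (incl '' (C : Set (Fam Qv R)) ∪ Set.range (tau R))

/-- `𝐬_i = Ad(f_i^{α_i^∨}) ∘ s̃_i`, on all of `D(R^P)`. -/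
noncomputable def birat (k : Type*) {R : Type*} [CommRing k] [Ring R] [Algebra k R]
    {I : Type*} (D : CartanDatum I Qv) (u : I → Rˣ) (i : I) : DiffAlg Qv R ≃ₐ[k] DiffAlg Qv R :=
  (tilde k R (D.reflP i)).trans
    (innerAut k (Units.map (incl : Fam Qv R →+* DiffAlg Qv R) (fpow u i (D.coroot i))))

end Fam
end QBW

namespace QBW

variable {I Qv : Type*} [AddCommGroup Qv]

/-! ### Parameter variables -/

section Param

variable {k : Type*} [CommRing k] {M : Type*} [AddCommMonoid M]

/-- The substitution homomorphism `φ_λ : R[M] → R`, where the parameter monomial `x^m` takes the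
value `ev λ m` at `λ`. -/
noncomputable def subst (ev : Module.Dual ℤ Qv → Multiplicative M →* k) (R : Type*) [Ring R]
    [Algebra k R] (l : Module.Dual ℤ Qv) : AddMonoidAlgebra R M →ₐ[k] R :=
  AddMonoidAlgebra.liftNCAlgHom (AlgHom.id k R)
    (((algebraMap k R : k →+* R) : k →* R).comp (ev l))
    (fun x y => (Algebra.commutes (ev l y) x).symm)

/-- The image of the algebra `R[M]` with parameter variables under `φ = (φ_λ)_λ`. -/
def paramImage (ev : Module.Dual ℤ Qv → Multiplicative M →* k) (R : Type*) [Ring R]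
    [Algebra k R] : Set (Fam Qv R) :=
  Set.range fun a : AddMonoidAlgebra R M => Fam.of fun l => subst ev R l a

variable [UniqueSums M]

/-- `x = a s⁻¹ ∈ A^pa[S_λ⁻¹]`, where `A^pa = A[M]` and `S_λ = {s | φ_λ(s) ≠ 0}`, and
`φ_λ(x) = φ_λ(a) φ_λ(s)⁻¹ = c`. -/
def HasValueAt (ev : Module.Dual ℤ Qv → Multiplicative M →* k) (A : Type*) [Ring A]
    [Algebra k A] [LeftOreDomain A] (l : Module.Dual ℤ Qv)
    (x : SkewFrac (AddMonoidAlgebra A M)) (c : SkewFrac A) : Prop :=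
  ∃ a s : AddMonoidAlgebra A M, subst ev A l s ≠ 0 ∧ x = toFrac a * (toFrac s)⁻¹ ∧
    c = toFrac (subst ev A l a) * (toFrac (subst ev A l s))⁻¹

/-- The image in `K^P`, `K = Q(A)`, of `A^pa_(P) = ⋂_λ A^pa[S_λ⁻¹] ⊆ Q(A^pa)` under
`φ = (φ_λ)_λ`. -/
def paramLocImage (ev : Module.Dual ℤ Qv → Multiplicative M →* k) (A : Type*) [Ring A]
    [Algebra k A] [LeftOreDomain A] : Set (Fam Qv (SkewFrac A)) :=
  {c | ∃ x : SkewFrac (AddMonoidAlgebra A M), ∀ l, HasValueAt ev A l x (c l)}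

end Param

/-- The `f_i` as units of the skew field `Q(A)`. -/
noncomputable def fracUnit {A : Type*} [Ring A] [LeftOreDomain A] (f : I → A)
    (hf : ∀ i, f i ≠ 0) (i : I) : (SkewFrac A)ˣ :=
  Units.mk0 (toFrac (f i)) ((map_ne_zero_iff toFrac toFrac_injective).mpr (hf i))

/-! ### Statements about the action -/

section Statements

variable {R : Type*} [Ring R]

/-- The Verma identities for the fractional powers. -/
structure VermaIdentities (D : CartanDatum I Qv) (u : I → Rˣ) : Prop where
  verma2 : ∀ i j (b c : Qv), (D.a i j, D.a j i) = (0, 0) →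
    fpow u i b * fpow u j c = fpow u j c * fpow u i b
  verma3 : ∀ i j (b c : Qv), (D.a i j, D.a j i) = (-1, -1) →
    fpow u i b * fpow u j (b + c) * fpow u i c = fpow u j c * fpow u i (b + c) * fpow u j b
  verma4 : ∀ i j (b c : Qv), (D.a i j, D.a j i) = (-1, -2) →
    fpow u i b * fpow u j (2 • b + c) * fpow u i (b + c) * fpow u j c =
      fpow u j c * fpow u i (b + c) * fpow u j (2 • b + c) * fpow u i b
  verma6 : ∀ i j (b c : Qv), (D.a i j, D.a j i) = (-1, -3) →
    fpow u i b * fpow u j (3 • b + c) * fpow u i (2 • b + c) * fpow u j (3 • b + 2 • c) *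
        fpow u i (b + c) * fpow u j c =
      fpow u j c * fpow u i (b + c) * fpow u j (3 • b + 2 • c) * fpow u i (2 • b + c) *
        fpow u j (3 • b + c) * fpow u i b

/-- The `𝐬_i` restrict to automorphisms of the subalgebra `X`, satisfy there the defining relations
of the Weyl group, and `s_i ↦ 𝐬_i` extends uniquely to an action of the Weyl group on `X` by
algebra automorphisms. -/
structure IsWeylAction (k : Type*) [CommRing k] [Algebra k R] (D : CartanDatum I Qv) (u : I → Rˣ)
    (X : Subalgebra k (DiffAlg Qv R)) : Prop where
  map_eq : ∀ i, X.map (birat k D u i : DiffAlg Qv R →ₐ[k] DiffAlg Qv R) = X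
  sq : ∀ i, ∀ x ∈ X, birat k D u i (birat k D u i x) = x
  comm : ∀ i j, (D.a i j, D.a j i) = (0, 0) → ∀ x ∈ X,
    birat k D u i (birat k D u j x) = birat k D u j (birat k D u i x)
  braid3 : ∀ i j, (D.a i j, D.a j i) = (-1, -1) → ∀ x ∈ X,
    birat k D u i (birat k D u j (birat k D u i x)) =
      birat k D u j (birat k D u i (birat k D u j x))
  braid4 : ∀ i j, (D.a i j, D.a j i) = (-1, -2) → ∀ x ∈ X,
    ((birat k D u i * birat k D u j) ^ 2) x = ((birat k D u j * birat k D u i) ^ 2) x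
  braid6 : ∀ i j, (D.a i j, D.a j i) = (-1, -3) → ∀ x ∈ X,
    ((birat k D u i * birat k D u j) ^ 3) x = ((birat k D u j * birat k D u i) ^ 3) x
  action : ∃! r : D.WeylGroup →* (X ≃ₐ[k] X), ∀ (i : I) (x : X),
    (r (D.simple i) x : DiffAlg Qv R) = birat k D u i x

/-- The values common to both cases: `𝐬_i(τ^μ) = f_i^{⟨α_i^∨, μ⟩} τ^{s_i(μ)}` and
`𝐬_i(f_i) = f_i`. -/
structure TauFormulas (k : Type*) [CommRing k] [Algebra k R] (D : CartanDatum I Qv)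
    (u : I → Rˣ) : Prop where
  tau : ∀ i (m : Module.Dual ℤ Qv), birat k D u i (tau R m) =
    incl (Fam.const Qv ((u i ^ (m (D.coroot i)) : Rˣ) : R)) * tau R (D.reflP i m)
  self : ∀ i, birat k D u i (incl (Fam.const Qv (u i : R))) = incl (Fam.const Qv (u i : R))

end Statements

/-! ### The Kac-Moody case -/

/-- Generators `e_i`, `f_i`, `h ∈ 𝔥` of the Kac-Moody algebra, where `𝔥 = Qv ⊗ ℂ`. -/
inductive KMGen (I Qv : Type*) [AddCommGroup Qv]
  | e (i : I)
  | f (i : I)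
  | h (x : TensorProduct ℤ ℂ Qv)

/-- The `ℂ`-linear extension of `λ ∈ P` to `Qv ⊗ ℂ`. -/
noncomputable def pairC (l : Module.Dual ℤ Qv) : TensorProduct ℤ ℂ Qv →ₗ[ℂ] ℂ :=
  (TensorProduct.AlgebraTensorModule.rid ℤ ℂ ℂ).toLinearMap ∘ₗ LinearMap.baseChange ℂ l

namespace KM

/-- The free Lie algebra on the generators. -/
abbrev Free (I Qv : Type*) [AddCommGroup Qv] : Type _ := FreeLieAlgebra ℂ (KMGen I Qv)

/-- The generator `e_i` of the free Lie algebra. -/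
noncomputable def e (Qv : Type*) [AddCommGroup Qv] (i : I) : Free I Qv := FreeLieAlgebra.of ℂ (KMGen.e i)

/-- The generator `f_i` of the free Lie algebra. -/
noncomputable def f (Qv : Type*) [AddCommGroup Qv] (i : I) : Free I Qv := FreeLieAlgebra.of ℂ (KMGen.f i)

/-- The generator `h_x`, `x ∈ Qv ⊗ ℂ`, of the free Lie algebra. -/
noncomputable def h (I : Type*) (x : TensorProduct ℤ ℂ Qv) : Free I Qv := FreeLieAlgebra.of ℂ (KMGen.h x)

/-- The defining relators of the Kac-Moody Lie algebra. -/
inductive Relator (D : CartanDatum I Qv) : Free I Qv → Prop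
  | h_add (x y : TensorProduct ℤ ℂ Qv) : Relator D (h I x + h I y - h I (x + y))
  | h_smul (c : ℂ) (x : TensorProduct ℤ ℂ Qv) : Relator D (c • h I x - h I (c • x))
  | h_h (x y : TensorProduct ℤ ℂ Qv) : Relator D ⁅h I x, h I y⁆
  | h_e (x : TensorProduct ℤ ℂ Qv) (j : I) :
      Relator D (⁅h I x, e Qv j⁆ - pairC (D.root j) x • e Qv j)
  | h_f (x : TensorProduct ℤ ℂ Qv) (j : I) :
      Relator D (⁅h I x, f Qv j⁆ + pairC (D.root j) x • f Qv j)
  | e_f_same (i : I) : Relator D (⁅e Qv i, f Qv i⁆ - h I (1 ⊗ₜ[ℤ] D.coroot i))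
  | e_f (i j : I) (hij : i ≠ j) : Relator D ⁅e Qv i, f Qv j⁆
  | serre_e (i j : I) (hij : i ≠ j) :
      Relator D (((LieAlgebra.ad ℂ (Free I Qv) (e Qv i)) ^ (1 - D.a i j).toNat) (e Qv j))
  | serre_f (i j : I) (hij : i ≠ j) :
      Relator D (((LieAlgebra.ad ℂ (Free I Qv) (f Qv i)) ^ (1 - D.a i j).toNat) (f Qv j))

/-- The Kac-Moody Lie algebra `𝔤`. -/
abbrev LieAlg (D : CartanDatum I Qv) : Type _ :=
  Free I Qv ⧸ (LieSubmodule.lieSpan ℂ (Free I Qv) {x | Relator D x} : LieIdeal ℂ (Free I Qv))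

/-- The element `f_i` of `𝔤`. -/
noncomputable def lieF (D : CartanDatum I Qv) (i : I) : LieAlg D :=
  LieSubmodule.Quotient.mk (f Qv i)

/-- `𝔫_-`, the Lie subalgebra of `𝔤` generated by the `f_i`. -/
noncomputable abbrev nMinus (D : CartanDatum I Qv) : LieSubalgebra ℂ (LieAlg D) :=
  LieSubalgebra.lieSpan ℂ (LieAlg D) (Set.range (lieF D))

/-- `U(𝔫_-)`. -/
abbrev UMinus (D : CartanDatum I Qv) : Type _ := UniversalEnvelopingAlgebra ℂ (nMinus D)

/-- The element `f_i` of `𝔫_-`. -/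
noncomputable def negF (D : CartanDatum I Qv) (i : I) : nMinus D :=
  ⟨lieF D i, LieSubalgebra.subset_lieSpan (Set.mem_range_self i)⟩

/-- A presentation of `A` as a residue class algebra of `U(𝔫_-)`. -/
structure Residue (D : CartanDatum I Qv) (A : Type*) [Ring A] [Algebra ℂ A] where
  /-- the quotient map -/
  proj : UMinus D →ₐ[ℂ] A
  surjective : Function.Surjective proj

/-- The dependent variable `f_i ∈ A`. -/
noncomputable def Residue.f {D : CartanDatum I Qv} {A : Type*} [Ring A] [Algebra ℂ A] (Q : Residue D A)
    (i : I) : A :=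
  Q.proj (UniversalEnvelopingAlgebra.ι ℂ (negF D i))

theorem serre_negF (D : CartanDatum I Qv) (i j : I) (hij : i ≠ j) :
    ((LieAlgebra.ad ℂ (nMinus D) (negF D i)) ^ (1 - D.a i j).toNat) (negF D j) = 0 := by
  have h1 : ∀ n : ℕ, ((((LieAlgebra.ad ℂ (nMinus D) (negF D i)) ^ n) (negF D j) : nMinus D) :
      LieAlg D) =
      LieSubmodule.Quotient.mk (((LieAlgebra.ad ℂ (Free I Qv) (f Qv i)) ^ n) (f Qv j)) := by
    intro n
    induction n with
    | zero => rfl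
    | succ n ih =>
      rw [pow_succ', pow_succ', Module.End.mul_apply, Module.End.mul_apply, LieAlgebra.ad_apply,
        LieAlgebra.ad_apply, LieSubalgebra.coe_bracket, ih]
      rfl
  apply Subtype.ext
  rw [h1]
  exact (LieSubmodule.Quotient.mk_eq_zero').mpr
    (LieSubmodule.subset_lieSpan (Relator.serre_f i j hij))

section Associative

attribute [local instance] LieRing.ofAssociativeRing

theorem Residue.serre {D : CartanDatum I Qv} {A : Type*} [Ring A] [Algebra ℂ A] (Q : Residue D A)
    (i j : I) (hij : i ≠ j) :
    ((LieAlgebra.ad ℂ A (Q.f i)) ^ (1 - D.a i j).toNat) (Q.f j) = 0 := by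
  let g : nMinus D →ₗ⁅ℂ⁆ A := (Q.proj : UMinus D →ₗ⁅ℂ⁆ A).comp (UniversalEnvelopingAlgebra.ι ℂ)
  have h1 : ∀ n : ℕ, g (((LieAlgebra.ad ℂ (nMinus D) (negF D i)) ^ n) (negF D j)) =
      ((LieAlgebra.ad ℂ A (Q.f i)) ^ n) (Q.f j) := by
    intro n
    induction n with
    | zero => rfl
    | succ n ih =>
      rw [pow_succ', pow_succ', Module.End.mul_apply, Module.End.mul_apply, LieAlgebra.ad_apply,
        LieAlgebra.ad_apply, LieHom.map_lie, ih]
      rfl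
  rw [← h1, serre_negF D i j hij, map_zero]

theorem Residue.adjoin {D : CartanDatum I Qv} {A : Type*} [Ring A] [Algebra ℂ A] (Q : Residue D A) :
    Algebra.adjoin ℂ (Set.range Q.f) = ⊤ := by
  set B := Algebra.adjoin ℂ (Set.range Q.f) with hB
  have h1 : ∀ x : nMinus D, Q.proj (UniversalEnvelopingAlgebra.ι ℂ x) ∈ B := by
    rintro ⟨x, hx⟩
    induction hx using LieSubalgebra.lieSpan_induction with
    | mem x hx =>
      obtain ⟨i, rfl⟩ := hx
      exact Algebra.subset_adjoin ⟨i, rfl⟩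
    | zero =>
      have : Q.proj (UniversalEnvelopingAlgebra.ι ℂ (0 : nMinus D)) ∈ B := by simp
      exact this
    | add x y hx hy h1 h2 =>
      have : Q.proj (UniversalEnvelopingAlgebra.ι ℂ ((⟨x, hx⟩ : nMinus D) + ⟨y, hy⟩)) ∈ B := by
        rw [map_add, map_add]; exact add_mem h1 h2
      exact this
    | smul c x hx h1 =>
      have : Q.proj (UniversalEnvelopingAlgebra.ι ℂ (c • (⟨x, hx⟩ : nMinus D))) ∈ B := by
        rw [map_smul, map_smul]; exact B.smul_mem h1 c
      exact this
    | lie x y hx hy h1 h2 =>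
      have : Q.proj (UniversalEnvelopingAlgebra.ι ℂ ⁅(⟨x, hx⟩ : nMinus D), ⟨y, hy⟩⁆) ∈ B := by
        rw [LieHom.map_lie, LieRing.of_associative_ring_bracket, map_sub, map_mul, map_mul]
        exact sub_mem (mul_mem h1 h2) (mul_mem h2 h1)
      exact this
  let g : nMinus D →ₗ⁅ℂ⁆ B :=
    { toFun := fun x => ⟨_, h1 x⟩
      map_add' := fun x y => by ext; simp
      map_smul' := fun c x => by ext; simp
      map_lie' := fun {x y} => by
        apply Subtype.ext
        simp [LieRing.of_associative_ring_bracket] }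
  have h2 : B.val.comp (UniversalEnvelopingAlgebra.lift ℂ g) = Q.proj := by
    apply UniversalEnvelopingAlgebra.hom_ext
    ext x
    simp [g]
  rw [eq_top_iff]
  intro a _
  obtain ⟨y, rfl⟩ := Q.surjective a
  rw [← h2]
  exact (UniversalEnvelopingAlgebra.lift ℂ g y).2

instance {D : CartanDatum I Qv} {A : Type*} [Ring A] [Algebra ℂ A] (Q : Residue D A) :
    OreGenerators Q.f := by
  refine oreGenerators_of_serre ℂ Q.f Q.adjoin fun i j hij => ?_
  have hs := Q.serre i j hij
  have hn : (1 - D.a i j).toNat = (-D.a i j).toNat + 1 := by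
    have := D.a_nonpos i j hij
    omega
  rw [hn] at hs
  set n := (-D.a i j).toNat
  refine ⟨n, fun s => -((-1) ^ (n + 1 - s) * ((n + 1).choose s : ℂ)), ?_⟩
  have hpow : ∀ m : ℕ, ∀ x : A, (LinearMap.mulLeft ℂ (Q.f i) ^ m) x = Q.f i ^ m * x := by
    intro m x
    rw [LinearMap.pow_mulLeft, LinearMap.mulLeft_apply]
  have hpow' : ∀ m : ℕ, ∀ x : A, ((-LinearMap.mulRight ℂ (Q.f i)) ^ m) x =
      (-1 : ℂ) ^ m • (x * Q.f i ^ m) := by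
    intro m x
    rw [neg_pow, LinearMap.pow_mulRight, Module.End.mul_apply, LinearMap.mulRight_apply]
    rcases neg_one_pow_eq_or (Module.End ℂ A) m with h | h <;>
      rcases Nat.even_or_odd m with hm | hm <;> simp [hm.neg_one_pow]
  rw [LieAlgebra.ad_eq_lmul_left_sub_lmul_right, Pi.sub_apply, sub_eq_add_neg,
    Commute.add_pow (LinearMap.commute_mulLeft_right (R := ℂ) (Q.f i) (Q.f i)).neg_right,
    Finset.sum_range_succ, LinearMap.add_apply, LinearMap.sum_apply] at hs
  have hterm : ∀ s, (LinearMap.mulLeft ℂ (Q.f i) ^ s * (-LinearMap.mulRight ℂ (Q.f i)) ^ (n + 1 - s)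
      * (((n + 1).choose s : ℕ) : Module.End ℂ A)) (Q.f j) =
      ((-1) ^ (n + 1 - s) * ((n + 1).choose s : ℂ)) • (Q.f i ^ s * Q.f j * Q.f i ^ (n + 1 - s)) := by
    intro s
    rw [Module.End.mul_apply, Module.End.mul_apply, Module.End.natCast_apply, map_nsmul,
      map_nsmul, hpow', map_smul, hpow, mul_smul, smul_comm, Nat.cast_smul_eq_nsmul, mul_assoc]
  rw [hterm, Finset.sum_congr rfl fun s _ => hterm s] at hs
  simp only [Nat.sub_self, pow_zero, Nat.choose_self, Nat.cast_one, mul_one, one_smul] at hs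
  rw [eq_neg_of_add_eq_zero_right hs, ← Finset.sum_neg_distrib]
  exact Finset.sum_congr rfl fun s _ => (neg_smul _ _).symm

end Associative

/-- The value at `λ` of a monomial in the parameter variables attached to a basis of `Qv`. -/
noncomputable def ev (Qv : Type*) [AddCommGroup Qv] [Module.Free ℤ Qv] (l : Module.Dual ℤ Qv) :
    Multiplicative (Module.Free.ChooseBasisIndex ℤ Qv →₀ ℕ) →* ℂ where
  toFun m := m.toAdd.prod fun i n => ((l (Module.Free.chooseBasis ℤ Qv i) : ℤ) : ℂ) ^ n
  map_one' := by simp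
  map_mul' m n := by
    rw [toAdd_mul, Finsupp.prod_add_index' (by simp) (fun _ _ _ => pow_add _ _ _)]

end KM
end QBW

namespace QBW

variable {I Qv : Type*} [AddCommGroup Qv]

/-! ### The `q`-difference case -/

section QNumbers

variable {k : Type*} [Field k]

/-- The `q`-number `[n]_t = (t^n - t^{-n}) / (t - t^{-1})`. -/
def qNum (t : k) (n : ℤ) : k := (t ^ n - t ^ (-n)) / (t - t⁻¹)

/-- The `q`-factorial `[n]_t! = [1]_t [2]_t ⋯ [n]_t`. -/
def qFact (t : k) (n : ℕ) : k := ∏ s ∈ Finset.range n, qNum t ((s : ℤ) + 1)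

/-- The `q`-binomial coefficient `[n]_t [n-1]_t ⋯ [n-r+1]_t / [r]_t!`. -/
def qBinom (t : k) (n : ℤ) (r : ℕ) : k :=
  (∏ s ∈ Finset.range r, qNum t (n - (s : ℤ))) / qFact t r

end QNumbers

namespace QD

/-- The base field `ℂ(q)`. -/
abbrev Cq : Type := RatFunc ℂ

/-- The indeterminate `q`. -/
noncomputable def q : Cq := RatFunc.X

/-- `q_i = q^{d_i}`. -/
noncomputable def qi (D : CartanDatum I Qv) (i : I) : Cq := q ^ D.d i

theorem q_ne_zero : q ≠ 0 := RatFunc.X_ne_zero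

theorem q_pow_ne_one (m : ℕ) (hm : 0 < m) : q ^ m ≠ 1 := by
  intro h
  rw [q, ← RatFunc.algebraMap_X, ← map_pow, ← map_one (algebraMap (Polynomial ℂ) Cq)] at h
  have h1 := RatFunc.algebraMap_injective ℂ h
  have h2 := congrArg Polynomial.natDegree h1
  simp at h2
  omega

theorem qNum_ne_zero (D : CartanDatum I Qv) (i : I) (s : ℕ) : qNum (qi D i) ((s : ℤ) + 1) ≠ 0 := by
  have key : ∀ n : ℕ, 0 < n → qi D i ^ (n : ℤ) - qi D i ^ (-(n : ℤ)) ≠ 0 := by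
    intro n hn h
    have h0 : qi D i ≠ 0 := pow_ne_zero _ q_ne_zero
    rw [sub_eq_zero, zpow_neg,
      ← mul_eq_one_iff_eq_inv₀ (zpow_ne_zero _ h0), zpow_natCast, ← pow_add,
      qi, ← pow_mul] at h
    exact q_pow_ne_one _ (Nat.mul_pos (D.d_pos i) (by omega)) h
  refine div_ne_zero (by exact_mod_cast key (s + 1) (Nat.succ_pos s)) ?_
  have := key 1 one_pos
  simpa using this

theorem qFact_ne_zero (D : CartanDatum I Qv) (i : I) (n : ℕ) : qFact (qi D i) n ≠ 0 :=
  Finset.prod_ne_zero_iff.mpr fun s _ => qNum_ne_zero D i s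

/-- Generators `e_i`, `f_i`, `q^β` of `U_q(𝔤)`. -/
inductive Gen (I Qv : Type*)
  | e (i : I)
  | f (i : I)
  | qpow (b : Qv)

/-- The free algebra on the generators. -/
abbrev Free (I Qv : Type*) : Type _ := FreeAlgebra Cq (Gen I Qv)

/-- The generator `e_i` of the free algebra. -/
noncomputable def e (Qv : Type*) (i : I) : Free I Qv := FreeAlgebra.ι Cq (Gen.e i)

/-- The generator `f_i` of the free algebra. -/
noncomputable def f (Qv : Type*) (i : I) : Free I Qv := FreeAlgebra.ι Cq (Gen.f i)

/-- The generator `q^β` of the free algebra. -/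
noncomputable def qpow (I : Type*) (b : Qv) : Free I Qv := FreeAlgebra.ι Cq (Gen.qpow b)

/-- The `q`-Serre expression `∑_r (-1)^r x^{(N-r)} y x^{(r)}` with `x^{(r)} = x^r / [r]_t!`. -/
noncomputable def serreSum {X : Type*} [Semiring X] [Algebra Cq X] (t : Cq) (N : ℕ) (x y : X) : X :=
  ∑ r ∈ Finset.range (N + 1), ((-1) ^ r * (qFact t (N - r))⁻¹ * (qFact t r)⁻¹) •
    (x ^ (N - r) * y * x ^ r)

/-- The defining relations of `U_q(𝔤)`. -/
inductive Rel (D : CartanDatum I Qv) : Free I Qv → Free I Qv → Prop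
  | q_add (b c : Qv) : Rel D (qpow I b * qpow I c) (qpow I (b + c))
  | q_zero : Rel D (qpow I 0) 1
  | q_e (b : Qv) (j : I) :
      Rel D (qpow I b * e Qv j * qpow I (-b)) (q ^ (D.root j b) • e Qv j)
  | q_f (b : Qv) (j : I) :
      Rel D (qpow I b * f Qv j * qpow I (-b)) (q ^ (-(D.root j b)) • f Qv j)
  | e_f_same (i : I) : Rel D (e Qv i * f Qv i - f Qv i * e Qv i)
      ((qi D i - (qi D i)⁻¹)⁻¹ •
        (qpow I (D.d i • D.coroot i) - qpow I (-(D.d i • D.coroot i))))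
  | e_f (i j : I) (hij : i ≠ j) : Rel D (e Qv i * f Qv j - f Qv j * e Qv i) 0
  | serre_e (i j : I) (hij : i ≠ j) :
      Rel D (serreSum (qi D i) (1 - D.a i j).toNat (e Qv i) (e Qv j)) 0
  | serre_f (i j : I) (hij : i ≠ j) :
      Rel D (serreSum (qi D i) (1 - D.a i j).toNat (f Qv i) (f Qv j)) 0

/-- The algebra `U_q(𝔤)`. -/
abbrev Uq (D : CartanDatum I Qv) : Type _ := RingQuot (Rel D)

/-- The element `f_i` of `U_q(𝔤)`. -/
noncomputable def uF (D : CartanDatum I Qv) (i : I) : Uq D := RingQuot.mkAlgHom Cq (Rel D) (f Qv i)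

/-- `U_q(𝔫_-)`, the subalgebra of `U_q(𝔤)` generated by the `f_i`. -/
noncomputable abbrev UMinus (D : CartanDatum I Qv) : Subalgebra Cq (Uq D) :=
  Algebra.adjoin Cq (Set.range (uF D))

/-- The element `f_i` of `U_q(𝔫_-)`. -/
noncomputable def negF (D : CartanDatum I Qv) (i : I) : UMinus D :=
  ⟨uF D i, Algebra.subset_adjoin (Set.mem_range_self i)⟩

/-- A presentation of `A` as a residue class algebra of `U_q(𝔫_-)`. -/
structure Residue (D : CartanDatum I Qv) (A : Type*) [Ring A] [Algebra Cq A] where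
  /-- the quotient map -/
  proj : UMinus D →ₐ[Cq] A
  surjective : Function.Surjective proj

/-- The dependent variable `f_i ∈ A`. -/
noncomputable def Residue.f {D : CartanDatum I Qv} {A : Type*} [Ring A] [Algebra Cq A] (Q : Residue D A)
    (i : I) : A :=
  Q.proj (negF D i)

theorem map_serreSum {X Y : Type*} [Semiring X] [Algebra Cq X] [Semiring Y] [Algebra Cq Y]
    (g : X →ₐ[Cq] Y) (t : Cq) (N : ℕ) (x y : X) :
    g (serreSum t N x y) = serreSum t N (g x) (g y) := by
  simp [serreSum]

theorem Residue.serre {D : CartanDatum I Qv} {A : Type*} [Ring A] [Algebra Cq A] (Q : Residue D A)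
    (i j : I) (hij : i ≠ j) : serreSum (qi D i) (1 - D.a i j).toNat (Q.f i) (Q.f j) = 0 := by
  have h1 : serreSum (qi D i) (1 - D.a i j).toNat (negF D i) (negF D j) = 0 := by
    apply Subtype.ext
    refine (map_serreSum (UMinus D).val (qi D i) (1 - D.a i j).toNat (negF D i) (negF D j)).trans ?_
    have h3 := map_serreSum (RingQuot.mkAlgHom Cq (Rel D)) (qi D i) (1 - D.a i j).toNat
      (QD.f Qv i) (QD.f Qv j)
    rw [RingQuot.mkAlgHom_rel Cq (Rel.serre_f i j hij), map_zero] at h3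
    exact h3.symm
  have h2 := map_serreSum Q.proj (qi D i) (1 - D.a i j).toNat (negF D i) (negF D j)
  rw [h1, map_zero] at h2
  exact h2.symm

theorem Residue.adjoin {D : CartanDatum I Qv} {A : Type*} [Ring A] [Algebra Cq A] (Q : Residue D A) :
    Algebra.adjoin Cq (Set.range Q.f) = ⊤ := by
  rw [eq_top_iff]
  intro a _
  obtain ⟨⟨x, hx⟩, rfl⟩ := Q.surjective a
  induction hx using Algebra.adjoin_induction with
  | mem x hx =>
    obtain ⟨i, rfl⟩ := hx
    exact Algebra.subset_adjoin ⟨i, rfl⟩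
  | algebraMap r =>
    have : Q.proj (algebraMap Cq (UMinus D) r) ∈ Algebra.adjoin Cq (Set.range Q.f) := by
      rw [AlgHom.commutes]; exact Subalgebra.algebraMap_mem _ r
    exact this
  | add x y hx hy h1 h2 =>
    have : Q.proj ((⟨x, hx⟩ : UMinus D) + ⟨y, hy⟩) ∈ Algebra.adjoin Cq (Set.range Q.f) := by
      rw [map_add]; exact add_mem (h1 trivial) (h2 trivial)
    exact this
  | mul x y hx hy h1 h2 =>
    have : Q.proj ((⟨x, hx⟩ : UMinus D) * ⟨y, hy⟩) ∈ Algebra.adjoin Cq (Set.range Q.f) := by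
      rw [map_mul]; exact mul_mem (h1 trivial) (h2 trivial)
    exact this

instance {D : CartanDatum I Qv} {A : Type*} [Ring A] [Algebra Cq A] (Q : Residue D A) :
    OreGenerators Q.f := by
  refine oreGenerators_of_serre Cq Q.f Q.adjoin fun i j hij => ?_
  have hs := Q.serre i j hij
  have hn : (1 - D.a i j).toNat = (-D.a i j).toNat + 1 := by
    have := D.a_nonpos i j hij
    omega
  rw [hn] at hs
  set n := (-D.a i j).toNat
  refine ⟨n, fun s => -(qFact (qi D i) (n + 1)) *
    ((-1) ^ (n + 1 - s) * (qFact (qi D i) s)⁻¹ * (qFact (qi D i) (n + 1 - s))⁻¹), ?_⟩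
  rw [serreSum, ← Finset.sum_range_reflect, Finset.sum_range_succ] at hs
  have h0 := qFact_ne_zero D i (n + 1)
  have h1 : qFact (qi D i) 0 = 1 := by simp [qFact]
  have hlast : n + 1 - (n + 1 + 1 - 1 - (n + 1)) = n + 1 := by omega
  have hlast' : n + 1 + 1 - 1 - (n + 1) = 0 := by omega
  rw [hlast, hlast', h1, pow_zero, pow_zero, mul_one, inv_one, mul_one, one_mul] at hs
  have h2 := congrArg (fun x => qFact (qi D i) (n + 1) • x) hs
  simp only [smul_add, smul_smul, mul_inv_cancel₀ h0, one_smul, smul_zero] at h2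
  rw [eq_neg_of_add_eq_zero_right h2, Finset.smul_sum, ← Finset.sum_neg_distrib]
  refine Finset.sum_congr rfl fun s hs => ?_
  have hs' := Finset.mem_range.mp hs
  rw [show n + 1 + 1 - 1 - s = n + 1 - s by omega, show n + 1 - (n + 1 - s) = s by omega,
    smul_smul, ← neg_smul, ← neg_mul]

/-- The value `q^{⟨β, λ⟩}` at `λ` of the parameter variable `q^β`. -/
noncomputable def ev (Qv : Type*) [AddCommGroup Qv] (l : Module.Dual ℤ Qv) :
    Multiplicative Qv →* Cq where
  toFun b := q ^ (l b.toAdd)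
  map_one' := by simp
  map_mul' b c := by rw [toAdd_mul, map_add, zpow_add₀ q_ne_zero]

end QD

theorem uniqueSums_of_free (Qv : Type*) [AddCommGroup Qv] [Module.Free ℤ Qv] : UniqueSums Qv :=
  (Module.Free.chooseBasis ℤ Qv).repr.toAddEquiv.uniqueSums_iff.mpr inferInstance

/-! ### Explicit values on the parameter variables and the dependent variables -/

section Explicit

variable {R : Type*} [Ring R]

/-- The Kac-Moody case: `𝐬_i(β) = s_i(β)` and
`𝐬_i(f_j) = ∑_r binom(α_i^∨, r) (ad f_i)^r(f_j) f_i^{-r}`. -/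
structure KM.Formulas [Algebra ℂ R] (D : CartanDatum I Qv) (u : I → Rˣ) : Prop where
  param : ∀ i (b : Qv),
    birat ℂ D u i (incl (Fam.of fun l => ((l b : ℤ) : R))) =
      incl (Fam.of fun l => ((l (D.reflQ i b) : ℤ) : R))
  dep : ∀ i j, i ≠ j →
    birat ℂ D u i (incl (Fam.const Qv (u j : R))) =
      incl (Fam.of fun l => ∑ r ∈ Finset.range ((-D.a i j).toNat + 1),
        ((Ring.choose (l (D.coroot i)) r : ℤ) : R) *
          (fun x : R => (u i : R) * x - x * (u i : R))^[r] (u j : R) * ((u i ^ (-(r : ℤ)) : Rˣ) : R))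

/-- The iterated `q`-adjoint action: `(ad f)^0(g) = g` and
`(ad f)^{r+1}(g) = f (ad f)^r(g) - t^{a + 2r} (ad f)^r(g) f`. -/
noncomputable def qAd {k : Type*} [Field k] [Algebra k R] (t : k) (a : ℤ) (f g : R) : ℕ → R
  | 0 => g
  | r + 1 => f * qAd t a f g r - t ^ (a + 2 * (r : ℤ)) • (qAd t a f g r * f)

/-- The `q`-difference case: `𝐬_i(q^β) = q^{s_i(β)}` and
`𝐬_i(f_j) = ∑_r q_i^{(r + a_ij)(α_i^∨ - r)} [α_i^∨ choose r]_{q_i} (ad f_i)^r(f_j) f_i^{-r}`. -/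
structure QD.Formulas [Algebra QD.Cq R] (D : CartanDatum I Qv) (u : I → Rˣ) : Prop where
  param : ∀ i (b : Qv),
    birat QD.Cq D u i (incl (Fam.of fun l => algebraMap QD.Cq R (QD.q ^ (l b)))) =
      incl (Fam.of fun l => algebraMap QD.Cq R (QD.q ^ (l (D.reflQ i b))))
  dep : ∀ i j, i ≠ j →
    birat QD.Cq D u i (incl (Fam.const Qv (u j : R))) =
      incl (Fam.of fun l => ∑ r ∈ Finset.range ((-D.a i j).toNat + 1),
        (QD.qi D i ^ (((r : ℤ) + D.a i j) * (l (D.coroot i) - r)) *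
          qBinom (QD.qi D i) (l (D.coroot i)) r) •
            (qAd (QD.qi D i) (D.a i j) (u i : R) (u j : R) r * ((u i ^ (-(r : ℤ)) : Rˣ) : R)))

end Explicit

/-! ### The quantum difference operator algebras with fractional powers -/

namespace KM

variable [Module.Free ℤ Qv] {D : CartanDatum I Qv} {A : Type*} [Ring A] [Algebra ℂ A]

/-- The dependent variables as units of `Ã = A[f_i⁻¹ | i ∈ I]`. -/
noncomputable abbrev Residue.unit [IsDomain A] (Q : Residue D A) : I → (Localized Q.f)ˣ :=
  Localized.unit Q.f

/-- `D(𝒜)`, where `𝒜 = Ã^pa[f_i^β] ⊆ Ã^P`. -/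
noncomputable def Residue.diffAlg [IsDomain A] (Q : Residue D A) :
    Subalgebra ℂ (DiffAlg Qv (Localized Q.f)) :=
  diffSubalg (fracAlg ℂ Q.unit (paramImage (ev Qv) (Localized Q.f)))

/-- The dependent variables as units of `K = Q(A)`. -/
noncomputable abbrev Residue.fracUnit [LeftOreDomain A] (Q : Residue D A) (hf : ∀ i, Q.f i ≠ 0) :
    I → (SkewFrac A)ˣ :=
  QBW.fracUnit Q.f hf

/-- `D(𝒜_(P))`, where `𝒜_(P) = A^pa_(P)[f_i^β] ⊆ K^P`. -/
noncomputable def Residue.diffAlgP [LeftOreDomain A] (Q : Residue D A) (hf : ∀ i, Q.f i ≠ 0) :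
    Subalgebra ℂ (DiffAlg Qv (SkewFrac A)) :=
  diffSubalg (fracAlg ℂ (Q.fracUnit hf) (paramLocImage (ev Qv) A))

end KM

namespace QD

variable [Module.Free ℤ Qv] {D : CartanDatum I Qv} {A : Type*} [Ring A] [Algebra Cq A]

/-- The dependent variables as units of `Ã = A[f_i⁻¹ | i ∈ I]`. -/
noncomputable abbrev Residue.unit [IsDomain A] (Q : Residue D A) : I → (Localized Q.f)ˣ :=
  Localized.unit Q.f

/-- `D(𝒜)`, where `𝒜 = Ã^pa[f_i^β] ⊆ Ã^P`. -/
noncomputable def Residue.diffAlg [IsDomain A] (Q : Residue D A) :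
    Subalgebra Cq (DiffAlg Qv (Localized Q.f)) :=
  diffSubalg (fracAlg Cq Q.unit (paramImage (ev Qv) (Localized Q.f)))

/-- The dependent variables as units of `K = Q(A)`. -/
noncomputable abbrev Residue.fracUnit [LeftOreDomain A] (Q : Residue D A) (hf : ∀ i, Q.f i ≠ 0) :
    I → (SkewFrac A)ˣ :=
  QBW.fracUnit Q.f hf

/-- `D(𝒜_(P))`, where `𝒜_(P) = A^pa_(P)[f_i^β] ⊆ K^P`. -/
noncomputable def Residue.diffAlgP [LeftOreDomain A] (Q : Residue D A) (hf : ∀ i, Q.f i ≠ 0) :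
    Subalgebra Cq (DiffAlg Qv (SkewFrac A)) :=
  haveI : UniqueSums Qv := uniqueSums_of_free Qv
  diffSubalg (fracAlg Cq (Q.fracUnit hf) (paramLocImage (ev Qv) A))

end QD

end QBW

set_option linter.unusedSimpArgs false
set_option linter.unnecessarySeqFocus false
set_option linter.unusedTactic false
set_option linter.unreachableTactic false
set_option linter.unusedVariables false

namespace QBW

/-! ### Normal forms in the `q`-deformed algebras of rank two -/

/-! ### Cancellation of scalars and induction on integer exponents of units. -/

section Tools

variable {k R : Type*} [Field k] [Ring R] [Algebra k R]

/-! The Weyl group relations reduce to the Verma identities. In a word in the operators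
Ad(f_i^{α_i^∨}) ∘ s̃_i all the substitutions can be moved to the right, since s̃_j ∘ Ad(f_i^β) =
Ad(f_i^{s_j(β)}) ∘ s̃_j (`tilde_mul_adPow`). Each side of a braid relation then becomes Ad of a
product of fractional powers followed by one and the same automorphism of P, and the two products
are the two sides of the Verma identity with β = α_i^∨, γ = α_j^∨.

A Verma identity is tested at each λ, where it compares two words F(s), G(s) in integer powers of
the units X = f_i, Y = f_j, with r = ⟨β, λ⟩ fixed and s = ⟨γ, λ⟩ varying. Passing from s to s + 1
inserts a few factors X and Y. Pulling them to the left through the integer powers gives F(s + 1) =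
w(s) F(s) and G(s + 1) = w(s) G(s) with the same multiplier w(s), a polynomial in root vectors
without inverses. As F(0) = G(0), the words agree for all integers s (`units_eq_of_succ_eq_mul`).

The multipliers are found by rewriting in the rank two algebras of types A₂, B₂, G₂, deformed and
undeformed. The Serre relations yield root vectors with explicit commutation rules (`exists_qRelG2`,
`exists_relG2` and their analogues). Conjugation by X^n or Y^n depends on n only through v^n,
respectively through n itself, so it is verified by one step in n. Reduction to normal form and
comparison of scalar coefficients suffice; linear independence of the normal monomials is never
needed.

The formula for the image of f_j is the expansion of f_i^n f_j f_i^{-n} in iterated adjoints, proved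
by Pascal's rule in n and cut off by the Serre relation (`units_zpow_mul_eq_sum_qAd`,
`units_zpow_mul_eq_sum_ad`). The coefficient algebras are stable because s_i induces an involution σ
of the parameter algebra with φ_λ ∘ σ = φ_{s_i(λ)}; it extends to the skew field of fractions. -/

theorem smul_left_cancel_of_ne_zero {d : k} (hd : d ≠ 0) {a b : R} (h : d • a = d • b) : a = b := by
  simpa [smul_smul, hd] using congrArg (fun t => d⁻¹ • t) h

theorem mul_mul_eq_of_mul_eq {x y z : R} (h : x * y = z) (t : R) : x * (y * t) = z * t := by
  rw [← mul_assoc, h]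

theorem smul_inv_smul_eq {d : k} (hd : d ≠ 0) (a : R) : d • (d⁻¹ • a) = a := by
  rw [smul_smul, mul_inv_cancel₀ hd, one_smul]

/-- The one-step rule can be run in both directions because X is invertible. A closed formula for
conjugation by all integer powers thus needs only a candidate `f` and a single check. -/
theorem units_zpow_mul_eq (X : Rˣ) (f : ℤ → R) (h : ∀ n, (X : R) * f n = f (n + 1) * X) (n : ℤ) :
    ((X ^ n : Rˣ) : R) * f 0 = f n * ((X ^ n : Rˣ) : R) := by
  induction n with
  | zero => simp
  | succ n ih =>
    rw [add_comm, zpow_add, zpow_one, Units.val_mul, mul_assoc, ih, ← mul_assoc, h, mul_assoc,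
      add_comm (1 : ℤ)]
  | pred n ih =>
    have h2 := h (-(n : ℤ) - 1)
    rw [sub_add_cancel] at h2
    apply X.isUnit.mul_left_cancel
    rw [← mul_assoc, ← Units.val_mul, ← mul_assoc, h2, mul_assoc, ← Units.val_mul,
      ← zpow_one_add, add_sub_cancel]
    exact ih

/-- The downward step works because w(n) = f(n + 1) f(n)⁻¹ is itself a unit and can be cancelled.
Applied to the two sides of a Verma identity, it leaves only the equality of their left multipliers.
-/
theorem units_eq_of_succ_eq_mul {R : Type*} [Ring R] {f g : ℤ → Rˣ} (w : ℤ → R)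
    (hf : ∀ n, (f (n + 1) : R) = w n * f n) (hg : ∀ n, (g (n + 1) : R) = w n * g n)
    (h0 : f 0 = g 0) (n : ℤ) : f n = g n := by
  induction n with
  | zero => exact h0
  | succ n ih => exact Units.ext (by rw [hf, hg, ih])
  | pred n ih =>
    have h1 := hf (-(n : ℤ) - 1)
    have h2 := hg (-(n : ℤ) - 1)
    rw [sub_add_cancel] at h1 h2
    have hw : w (-(n : ℤ) - 1) = ((f (-n) * (f (-n - 1))⁻¹ : Rˣ) : R) := by
      rw [Units.val_mul, h1, Units.mul_inv_cancel_right]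
    rw [← ih, h1, hw] at h2
    exact Units.ext ((Units.isUnit _).mul_left_cancel h2)

end Tools

/-! ### The `q`-deformed algebra of type G₂ and its Verma identity. -/

section G2

variable {k R : Type*} [Field k] [Ring R] [Algebra k R]

/-- Commutation relations between scaled root vectors of the `q`-deformed nilpotent algebra of
type `G₂`, with `x` the long and `y` the short simple root vector. -/
structure QRelG2 (v : k) (x y a₁ a₂ a₃ b : R) : Prop where
  xy : x * y = v⁻¹ ^ 3 • (y * x) + (v ^ 3 - v⁻¹ ^ 3) • a₁
  xa₁ : x * a₁ = v ^ 3 • (a₁ * x)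
  a₁y : a₁ * y = v⁻¹ • (y * a₁) + (v ^ 2 - v⁻¹ ^ 2) • a₂
  a₂y : a₂ * y = v • (y * a₂) + (v - v⁻¹) • a₃
  a₃y : a₃ * y = v ^ 3 • (y * a₃)
  xa₂ : x * a₂ = a₂ * x + (v * (v ^ 3 - v⁻¹ ^ 3)) • (a₁ * a₁)
  a₁a₂ : a₁ * a₂ = v • (a₂ * a₁) + (v - v⁻¹) • b
  xa₃ : x * a₃ = v⁻¹ ^ 3 • (a₃ * x) +
    (v * (v ^ 3 - v⁻¹ ^ 3) * (v ^ 2 + 1 + v⁻¹ ^ 2)) • (a₂ * a₁) +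
    ((v ^ 3 - v⁻¹ ^ 3) * (v ^ 3 - v - v⁻¹)) • b
  xb : x * b = v ^ 3 • (b * x) + (v ^ 3 * (v ^ 3 - v⁻¹ ^ 3)) • (a₁ * (a₁ * a₁))
  a₁a₃ : a₁ * a₃ = a₃ * a₁ + (v * (v ^ 3 - v⁻¹ ^ 3)) • (a₂ * a₂)
  yb : b * y = y * b + (v * (v ^ 3 - v⁻¹ ^ 3)) • (a₂ * a₂)
  a₁b : a₁ * b = v ^ 3 • (b * a₁)
  a₂a₃ : a₂ * a₃ = v ^ 3 • (a₃ * a₂)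

/-- The root vectors are rescaled successive `q`-commutators. The two Serre relations give `xa₁` and
`a₃y`; every other rule comes from associativity, by rewriting a triple product in two ways towards
the order y, a₃, {a₂, b}, a₁, x and dividing by a nonzero scalar. The factors v⁴ - v² + 1 and v⁴ + 1
are what must be divided out in the rules for a₁b and a₂a₃. -/
theorem exists_qRelG2 {v : k} (hv : v ≠ 0) (h1 : v - v⁻¹ ≠ 0) (h2 : v ^ 2 - v⁻¹ ^ 2 ≠ 0)
    (h3 : v ^ 3 - v⁻¹ ^ 3 ≠ 0) (h6 : v ^ 4 - v ^ 2 + 1 ≠ 0) (h8 : v ^ 4 + 1 ≠ 0)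
    {x y : R}
    (hx : qAd (v ^ 3) (-1) x y 2 = 0) (hy : qAd v (-3) y x 4 = 0) :
    ∃ a₁ a₂ a₃ b : R, QRelG2 v x y a₁ a₂ a₃ b := by
  obtain ⟨a₁, w1⟩ : ∃ a₁ : R, (v ^ 3 - v⁻¹ ^ 3) • a₁ = x * y - v⁻¹ ^ 3 • (y * x) :=
    ⟨_, smul_inv_smul_eq h3 _⟩
  obtain ⟨a₂, w2⟩ : ∃ a₂ : R, (v ^ 2 - v⁻¹ ^ 2) • a₂ = a₁ * y - v⁻¹ • (y * a₁) :=
    ⟨_, smul_inv_smul_eq h2 _⟩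
  obtain ⟨a₃, w3⟩ : ∃ a₃ : R, (v - v⁻¹) • a₃ = a₂ * y - v • (y * a₂) :=
    ⟨_, smul_inv_smul_eq h1 _⟩
  obtain ⟨b, w4⟩ : ∃ b : R, (v - v⁻¹) • b = a₁ * a₂ - v • (a₂ * a₁) :=
    ⟨_, smul_inv_smul_eq h1 _⟩
  have xy : x * y = v⁻¹ ^ 3 • (y * x) + (v ^ 3 - v⁻¹ ^ 3) • a₁ := by rw [w1]; abel
  have a₁y : a₁ * y = v⁻¹ • (y * a₁) + (v ^ 2 - v⁻¹ ^ 2) • a₂ := by rw [w2]; abel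
  have a₂y : a₂ * y = v • (y * a₂) + (v - v⁻¹) • a₃ := by rw [w3]; abel
  have a₁a₂ : a₁ * a₂ = v • (a₂ * a₁) + (v - v⁻¹) • b := by rw [w4]; abel
  have xa₁ : x * a₁ = v ^ 3 • (a₁ * x) := by
    refine smul_left_cancel_of_ne_zero h3 ?_
    rw [← mul_smul_comm, smul_comm, ← smul_mul_assoc, w1]
    simp only [qAd] at hx
    norm_num [zpow_neg] at hx
    simp only [mul_add, add_mul, mul_sub, sub_mul, smul_mul_assoc, mul_smul_comm, mul_assoc,
      smul_add, smul_sub, smul_smul] at hx ⊢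
    linear_combination (norm := skip) hx
    match_scalars <;> field_simp <;> ring
  -- Left and right multiplication by y commute, and the exponents -3, -1, 1, 3 are symmetric under
  -- sign change. The iterated commutator taken on the other side is therefore the same element as
  -- the Serre expression.
  have a₃y : a₃ * y = v ^ 3 • (y * a₃) := by
    have e2 : ((v ^ 3 - v⁻¹ ^ 3) * (v ^ 2 - v⁻¹ ^ 2)) • a₂ =
        (x * y - v⁻¹ ^ 3 • (y * x)) * y - v⁻¹ • (y * (x * y - v⁻¹ ^ 3 • (y * x))) := by
      rw [mul_smul, w2, ← w1, smul_sub, smul_mul_assoc, mul_smul_comm, smul_comm v⁻¹]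
    have e3 : ((v ^ 3 - v⁻¹ ^ 3) * (v ^ 2 - v⁻¹ ^ 2) * (v - v⁻¹)) • a₃ =
        ((v ^ 3 - v⁻¹ ^ 3) * (v ^ 2 - v⁻¹ ^ 2)) • a₂ * y -
          v • (y * ((v ^ 3 - v⁻¹ ^ 3) * (v ^ 2 - v⁻¹ ^ 2)) • a₂) := by
      rw [mul_smul, w3, smul_sub, smul_mul_assoc, mul_smul_comm, smul_comm v]
    refine smul_left_cancel_of_ne_zero (mul_ne_zero (mul_ne_zero h3 h2) h1) ?_
    rw [← smul_mul_assoc, smul_comm, ← mul_smul_comm, e3, e2]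
    simp only [qAd] at hy
    norm_num [zpow_neg] at hy
    simp only [mul_add, add_mul, mul_sub, sub_mul, smul_mul_assoc, mul_smul_comm, mul_assoc,
      smul_add, smul_sub, smul_smul] at hy ⊢
    linear_combination (norm := skip) hy
    match_scalars <;> field_simp <;> ring
  have xa₂ : x * a₂ = a₂ * x + (v * (v ^ 3 - v⁻¹ ^ 3)) • (a₁ * a₁) := by
    have e := mul_assoc x a₁ y
    rw [a₁y, xa₁] at e
    simp only [mul_add, add_mul, smul_mul_assoc, mul_smul_comm, mul_assoc, smul_add, smul_smul,
      xy, a₁y, xa₁, mul_mul_eq_of_mul_eq xy, mul_mul_eq_of_mul_eq a₁y] at e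
    refine smul_left_cancel_of_ne_zero h2 ?_
    linear_combination (norm := skip) -e
    match_scalars <;> field_simp <;> ring
  have xa₃ : x * a₃ = v⁻¹ ^ 3 • (a₃ * x) +
      (v * (v ^ 3 - v⁻¹ ^ 3) * (v ^ 2 + 1 + v⁻¹ ^ 2)) • (a₂ * a₁) +
      ((v ^ 3 - v⁻¹ ^ 3) * (v ^ 3 - v - v⁻¹)) • b := by
    have e := mul_assoc x a₂ y
    rw [a₂y, xa₂] at e
    simp only [mul_add, add_mul, smul_mul_assoc, mul_smul_comm, mul_assoc, smul_add, smul_smul,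
      xy, a₁y, a₂y, xa₂, a₁a₂, mul_mul_eq_of_mul_eq xy, mul_mul_eq_of_mul_eq a₁y,
      mul_mul_eq_of_mul_eq a₂y] at e
    refine smul_left_cancel_of_ne_zero h1 ?_
    linear_combination (norm := skip) -e
    match_scalars <;> field_simp <;> ring
  -- This overlap contains two unknown products, a₁a₃ and by. The overlap x a₃ y is a second
  -- equation between them: eliminating by gives `a₁a₃`, and substituting back gives `yb`.
  have e1 := mul_assoc a₁ a₂ y
  rw [a₂y, a₁a₂] at e1
  simp only [mul_add, add_mul, smul_mul_assoc, mul_smul_comm, mul_assoc, smul_add, smul_smul,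
      xy, a₁y, a₂y, a₁a₂, mul_mul_eq_of_mul_eq xy, mul_mul_eq_of_mul_eq a₁y,
      mul_mul_eq_of_mul_eq a₂y] at e1
  have a₁a₃ : a₁ * a₃ = a₃ * a₁ + (v * (v ^ 3 - v⁻¹ ^ 3)) • (a₂ * a₂) := by
    have e := mul_assoc x a₃ y
    rw [a₃y, xa₃] at e
    simp only [mul_add, add_mul, smul_mul_assoc, mul_smul_comm, mul_assoc, smul_add, smul_smul,
      xy, a₁y, a₂y, a₃y, xa₃, a₁a₂, mul_mul_eq_of_mul_eq xy, mul_mul_eq_of_mul_eq a₁y,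
      mul_mul_eq_of_mul_eq a₂y, mul_mul_eq_of_mul_eq a₃y] at e
    refine smul_left_cancel_of_ne_zero (mul_ne_zero h3 h2) ?_
    linear_combination (norm := skip) ((v ^ 3 - v⁻¹ ^ 3) * (v ^ 3 - v - v⁻¹)) • e1 - (v - v⁻¹) • e
    match_scalars <;> field_simp <;> ring
  have yb : b * y = y * b + (v * (v ^ 3 - v⁻¹ ^ 3)) • (a₂ * a₂) := by
    refine smul_left_cancel_of_ne_zero h1 ?_
    rw [a₁a₃] at e1
    linear_combination (norm := skip) e1
    match_scalars <;> field_simp <;> ring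
  have xb : x * b = v ^ 3 • (b * x) + (v ^ 3 * (v ^ 3 - v⁻¹ ^ 3)) • (a₁ * (a₁ * a₁)) := by
    have e := mul_assoc x a₁ a₂
    rw [a₁a₂, xa₁] at e
    simp only [mul_add, add_mul, smul_mul_assoc, mul_smul_comm, mul_assoc, smul_add, smul_smul,
      xa₁, xa₂, a₁a₂, mul_mul_eq_of_mul_eq xa₁, mul_mul_eq_of_mul_eq xa₂,
      mul_mul_eq_of_mul_eq a₁a₂] at e
    refine smul_left_cancel_of_ne_zero h1 ?_
    linear_combination (norm := skip) -e
    match_scalars <;> field_simp <;> ring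
  have a₁b : a₁ * b = v ^ 3 • (b * a₁) := by
    have e := mul_assoc x a₁ a₃
    rw [a₁a₃, xa₁] at e
    simp only [mul_add, add_mul, smul_mul_assoc, mul_smul_comm, mul_assoc, smul_add, smul_smul,
      xa₁, xa₂, xa₃, a₁a₂, a₁a₃, mul_mul_eq_of_mul_eq xa₁, mul_mul_eq_of_mul_eq xa₂,
      mul_mul_eq_of_mul_eq xa₃, mul_mul_eq_of_mul_eq a₁a₂, mul_mul_eq_of_mul_eq a₁a₃] at e
    refine smul_left_cancel_of_ne_zero (mul_ne_zero h3 h6) ?_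
    linear_combination (norm := skip) -(v ^ 2) • e
    match_scalars <;> field_simp <;> ring
  have a₂a₃ : a₂ * a₃ = v ^ 3 • (a₃ * a₂) := by
    have e := mul_assoc a₁ a₃ y
    rw [a₃y, a₁a₃] at e
    simp only [mul_add, add_mul, smul_mul_assoc, mul_smul_comm, mul_assoc, smul_add, smul_smul,
      a₁y, a₂y, a₃y, a₁a₃, mul_mul_eq_of_mul_eq a₁y,
      mul_mul_eq_of_mul_eq a₂y, mul_mul_eq_of_mul_eq a₃y] at e
    refine smul_left_cancel_of_ne_zero (mul_ne_zero h1 h8) ?_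
    linear_combination (norm := skip) -(v ^ 2) • e
    match_scalars <;> field_simp <;> ring
  exact ⟨a₁, a₂, a₃, b, ⟨xy, xa₁, a₁y, a₂y, a₃y, xa₂, a₁a₂, xa₃, xb, a₁a₃, yb, a₁b, a₂a₃⟩⟩

/-- Once n enters only through T = v^n, raising n by one is the substitution T ↦ vT, so a
conjugation formula is an identity rational in T. The trailing factor t lets the result act as a
rewrite rule inside right-associated products. -/
theorem units_zpow_mul_mul_eq {k R : Type*} [Field k] [Ring R] {v : k} (hv : v ≠ 0)
    (X : Rˣ) {f : k → R} {a : R} (ha : f 1 = a)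
    (h : ∀ T, T ≠ 0 → ∀ t, (X : R) * (f T * t) = f (v * T) * (X * t)) {n : ℤ} (T : k)
    (hT : v ^ n = T) (t : R) :
    ((X ^ n : Rˣ) : R) * (a * t) = f T * (((X ^ n : Rˣ) : R) * t) := by
  have h' : ∀ n : ℤ, (X : R) * f (v ^ n) = f (v ^ (n + 1)) * X := fun n => by
    have := h _ (zpow_ne_zero n hv) 1
    rwa [mul_one, mul_one, ← zpow_one_add₀ hv, add_comm] at this
  have := units_zpow_mul_eq X (fun n => f (v ^ n)) h' n
  simp only [zpow_zero, ha, hT] at this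
  rw [← mul_assoc, this, mul_assoc]

theorem zpow_mul_self_mul {R : Type*} [Ring R] (X : Rˣ) (n : ℤ) (t : R) :
    ((X ^ n : Rˣ) : R) * (X * t) = X * (((X ^ n : Rˣ) : R) * t) := by
  rw [← mul_assoc, ← mul_assoc, ← Units.val_mul, ← Units.val_mul, ← zpow_add_one, ← zpow_one_add,
    add_comm]

theorem QRelG2.mul_left {v : k} {x y a₁ a₂ a₃ b : R}
    (h : QRelG2 v x y a₁ a₂ a₃ b) (t : R) :
    x * (y * t) = (v⁻¹ ^ 3 • (y * x) + (v ^ 3 - v⁻¹ ^ 3) • a₁) * t ∧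
    x * (a₁ * t) = (v ^ 3 • (a₁ * x)) * t ∧
    a₁ * (y * t) = (v⁻¹ • (y * a₁) + (v ^ 2 - v⁻¹ ^ 2) • a₂) * t ∧
    a₂ * (y * t) = (v • (y * a₂) + (v - v⁻¹) • a₃) * t ∧
    a₃ * (y * t) = (v ^ 3 • (y * a₃)) * t ∧
    x * (a₂ * t) = (a₂ * x + (v * (v ^ 3 - v⁻¹ ^ 3)) • (a₁ * a₁)) * t ∧
    a₁ * (a₂ * t) = (v • (a₂ * a₁) + (v - v⁻¹) • b) * t ∧
    x * (a₃ * t) = (v⁻¹ ^ 3 • (a₃ * x) + (v * (v ^ 3 - v⁻¹ ^ 3) * (v ^ 2 + 1 +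
      v⁻¹ ^ 2)) • (a₂ * a₁) + ((v ^ 3 - v⁻¹ ^ 3) * (v ^ 3 - v - v⁻¹)) • b) * t ∧
    x * (b * t) = (v ^ 3 • (b * x) + (v ^ 3 * (v ^ 3 - v⁻¹ ^ 3)) • (a₁ * (a₁ * a₁))) * t ∧
    a₁ * (a₃ * t) = (a₃ * a₁ + (v * (v ^ 3 - v⁻¹ ^ 3)) • (a₂ * a₂)) * t ∧
    b * (y * t) = (y * b + (v * (v ^ 3 - v⁻¹ ^ 3)) • (a₂ * a₂)) * t ∧
    a₁ * (b * t) = (v ^ 3 • (b * a₁)) * t ∧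
    a₂ * (a₃ * t) = (v ^ 3 • (a₃ * a₂)) * t := by
  simp only [← mul_assoc, h.xy, h.xa₁, h.a₁y, h.a₂y, h.a₃y, h.xa₂, h.a₁a₂, h.xa₃, h.xb, h.a₁a₃,
    h.yb, h.a₁b, h.a₂a₃, and_self]

/-- Left multiplication by X clears the leading inverse; what remains follows from the commutation
rules. These rules push X⁻¹ to the right, the side on which X stands in normal order. -/
theorem QRelG2.inv_x {v : k} {X Y : Rˣ} {a₁ a₂ a₃ b : R}
    (h : QRelG2 v (X : R) Y a₁ a₂ a₃ b) (hv : v ≠ 0) (t : R) :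
    ↑X⁻¹ * (↑Y * t) = ((1 - v ^ 6) / (v ^ 3)) • (a₁ * (↑X⁻¹ * (↑X⁻¹ * t))) +
      (v ^ 3) • (↑Y * (↑X⁻¹ * t)) ∧
    ↑X⁻¹ * (a₁ * t) = (1 / (v ^ 3)) • (a₁ * (↑X⁻¹ * t)) ∧
    ↑X⁻¹ * (a₂ * t) = ((1 - v ^ 6) / (v ^ 8)) • (a₁ * (a₁ * (↑X⁻¹ * (↑X⁻¹ * t)))) +
        a₂ * (↑X⁻¹ * t) ∧
    ↑X⁻¹ * (a₃ * t) = ((1 - v ^ 6 - v ^ 12 +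
      v ^ 18) / (v ^ 15)) • (a₁ * (a₁ * (a₁ * (↑X⁻¹ * (↑X⁻¹ * (↑X⁻¹ * t)))))) + ((1 + v ^ 2 +
      v ^ 4 - v ^ 6 - v ^ 8 - v ^ 10) / (v ^ 4)) • (a₂ * (a₁ * (↑X⁻¹ * (↑X⁻¹ * t)))) + ((-1 -
      v ^ 2 + v ^ 4 + v ^ 6 + v ^ 8 - v ^ 10) / (v ^ 4)) • (b * (↑X⁻¹ * (↑X⁻¹ * t))) +
      (v ^ 3) • (a₃ * (↑X⁻¹ * t)) ∧
    ↑X⁻¹ * (b * t) = ((1 - v ^ 6) / (v ^ 12)) • (a₁ * (a₁ * (a₁ * (↑X⁻¹ * (↑X⁻¹ * t))))) +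
      (1 / (v ^ 3)) • (b * (↑X⁻¹ * t)) := by
  refine ⟨?_, ?_, ?_, ?_, ?_⟩ <;> apply X.isUnit.mul_left_cancel <;>
  rw [Units.mul_inv_cancel_left] <;>
  simp only [mul_add (R := R), add_mul (R := R), smul_mul_assoc, mul_smul_comm, mul_assoc,
    smul_add, smul_smul, Units.mul_inv_cancel_left, Units.inv_mul_cancel_left, h.mul_left] <;>
  match_scalars <;> field_simp <;> ring

theorem QRelG2.inv_y {v : k} {X Y : Rˣ} {a₁ a₂ a₃ b : R}
    (h : QRelG2 v (X : R) Y a₁ a₂ a₃ b) (hv : v ≠ 0) (t : R) :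
    ↑X * (↑Y⁻¹ * t) = ((1 - v ^ 2 - v ^ 4 + v ^ 8 + v ^ 10 -
      v ^ 12) / (v ^ 6)) • (↑Y⁻¹ * (↑Y⁻¹ * (↑Y⁻¹ * (↑Y⁻¹ * (a₃ * t))))) + ((1 - v ^ 4 - v ^ 6 +
      v ^ 10) / (v ^ 2)) • (↑Y⁻¹ * (↑Y⁻¹ * (↑Y⁻¹ * (a₂ * t)))) + (v -
      v ^ 7) • (↑Y⁻¹ * (↑Y⁻¹ * (a₁ * t))) + (v ^ 3) • (↑Y⁻¹ * (↑X * t)) ∧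
    a₁ * (↑Y⁻¹ * t) = ((1 - v ^ 2 - v ^ 4 + v ^ 6) / (v ^ 6)) • (↑Y⁻¹ * (↑Y⁻¹ * (↑Y⁻¹ *
        (a₃ * t)))) +
      ((1 - v ^ 4) / (v ^ 2)) • (↑Y⁻¹ * (↑Y⁻¹ * (a₂ * t))) + v • (↑Y⁻¹ * (a₁ * t)) ∧
    a₂ * (↑Y⁻¹ * t) = ((1 - v ^ 2) / (v ^ 5)) • (↑Y⁻¹ * (↑Y⁻¹ * (a₃ * t))) +
      (1 / v) • (↑Y⁻¹ * (a₂ * t)) ∧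
    a₃ * (↑Y⁻¹ * t) = (1 / (v ^ 3)) • (↑Y⁻¹ * (a₃ * t)) ∧
    b * (↑Y⁻¹ * t) = ((1 - v ^ 2 - v ^ 4 + v ^ 8 + v ^ 10 -
      v ^ 12) / (v ^ 15)) • (↑Y⁻¹ * (↑Y⁻¹ * (↑Y⁻¹ * (↑Y⁻¹ * (a₃ * (a₃ * t)))))) + ((1 - v ^ 4 -
      v ^ 6 + v ^ 10) / (v ^ 8)) • (↑Y⁻¹ * (↑Y⁻¹ * (↑Y⁻¹ * (a₃ * (a₂ * t))))) + ((1 -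
      v ^ 6) / (v ^ 4)) • (↑Y⁻¹ * (↑Y⁻¹ * (a₂ * (a₂ * t)))) + ↑Y⁻¹ * (b * t) := by
  -- The trailing Y cancels the inverse on the left-hand side; on the right-hand side it moves left
  -- until it meets the powers of Y⁻¹.
  obtain ⟨t, rfl⟩ : ∃ s, t = Y * s := ⟨↑Y⁻¹ * t, by simp⟩
  refine ⟨?_, ?_, ?_, ?_, ?_⟩ <;>
  simp only [mul_add (R := R), add_mul (R := R), smul_mul_assoc, mul_smul_comm, mul_assoc,
    smul_add, smul_smul, Units.mul_inv_cancel_left, Units.inv_mul_cancel_left, h.mul_left] <;>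
  match_scalars <;> field_simp <;> ring

/-- Negative powers of X are unavoidable for single generators. They cancel in the particular
products conjugated in the Verma argument. -/
theorem QRelG2.zpow_x {v : k} {X Y : Rˣ} {a₁ a₂ a₃ b : R}
    (h : QRelG2 v (X : R) Y a₁ a₂ a₃ b) (hv : v ≠ 0) {n : ℤ} (T : k)
    (hT : v ^ n = T) (t : R) :
    ((X ^ n : Rˣ) : R) * (↑Y * t) = (((-1 + T ^ 6) / (T ^ 3)) • (a₁ * ↑X⁻¹) +
      (1 / (T ^ 3)) • ↑Y) * (↑(X ^ n) * t) ∧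
    ((X ^ n : Rˣ) : R) * (a₁ * t) = ((T ^ 3) • a₁) * (↑(X ^ n) * t) ∧
    ((X ^ n : Rˣ) : R) * (a₂ * t) = (((-1 + T ^ 6) / (v ^ 2)) • (a₁ * (a₁ * ↑X⁻¹)) +
      a₂) * (↑(X ^ n) * t) ∧
    ((X ^ n : Rˣ) : R) * (a₃ * t) = (((-T ^ 6 + T ^ 12 + v ^ 6 -
      v ^ 6 * T ^ 6) / (v ^ 6 * T ^ 3)) • (a₁ * (a₁ * (a₁ * (↑X⁻¹ * ↑X⁻¹)))) + ((-1 + T ^ 6 -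
      v ^ 2 + v ^ 2 * T ^ 6 - v ^ 4 + v ^ 4 * T ^ 6) / (v * T ^ 3)) • (a₂ * (a₁ * ↑X⁻¹)) + ((1 -
      T ^ 6 + v ^ 2 - v ^ 2 * T ^ 6 - v ^ 4 + v ^ 4 * T ^ 6) / (v * T ^ 3)) • (b * ↑X⁻¹) +
      (1 / (T ^ 3)) • a₃) * (↑(X ^ n) * t) ∧
    ((X ^ n : Rˣ) : R) * (b * t) = (((-T ^ 3 + T ^ 9) / (v ^ 3)) • (a₁ * (a₁ * (a₁ * ↑X⁻¹))) +
      (T ^ 3) • b) * (↑(X ^ n) * t) := by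
  refine ⟨?_, ?_, ?_, ?_, ?_⟩ <;>
  revert T t <;> refine units_zpow_mul_mul_eq hv X ?_ (fun T hT t => ?_) <;>
  simp only [mul_add (R := R), add_mul (R := R), smul_mul_assoc, mul_smul_comm, mul_assoc,
    smul_add, smul_smul, Units.mul_inv_cancel_left, Units.inv_mul_cancel_left, one_pow, mul_one,
      h.mul_left] <;>
  match_scalars <;> field_simp <;> ring

theorem QRelG2.zpow_y {v : k} {X Y : Rˣ} {a₁ a₂ a₃ b : R}
    (h : QRelG2 v (X : R) Y a₁ a₂ a₃ b) (hv : v ≠ 0) {n : ℤ} (T : k)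
    (hT : v ^ n = T) (t : R) :
    ((Y ^ n : Rˣ) : R) * (↑X * t) = (((1 - T ^ 2 - v ^ 2 * T ^ 2 + v ^ 2 * T ^ 4 - v ^ 4 * T ^ 2 +
      v ^ 4 * T ^ 4 + v ^ 6 * T ^ 4 -
      v ^ 6 * T ^ 6) / (v ^ 3 * T ^ 3)) • (↑Y⁻¹ * (↑Y⁻¹ * (↑Y⁻¹ * a₃))) + ((1 - T ^ 2 + v ^ 2 -
      2 * v ^ 2 * T ^ 2 + v ^ 2 * T ^ 4 + v ^ 4 - 2 * v ^ 4 * T ^ 2 + v ^ 4 * T ^ 4 -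
      v ^ 6 * T ^ 2 + v ^ 6 * T ^ 4) / (v * T)) • (↑Y⁻¹ * (↑Y⁻¹ * a₂)) + (T - T ^ 3 + v ^ 2 * T -
      v ^ 2 * T ^ 3 + v ^ 4 * T - v ^ 4 * T ^ 3) • (↑Y⁻¹ * a₁) + (T ^ 3) • ↑X) * (↑(Y ^ n) * t) ∧
    ((Y ^ n : Rˣ) : R) * (a₁ * t) = (((1 - T ^ 2 - v ^ 2 * T ^ 2 +
      v ^ 2 * T ^ 4) / (v ^ 3 * T ^ 3)) • (↑Y⁻¹ * (↑Y⁻¹ * a₃)) + ((1 - T ^ 2 + v ^ 2 -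
      v ^ 2 * T ^ 2) / (v * T)) • (↑Y⁻¹ * a₂) + T • a₁) * (↑(Y ^ n) * t) ∧
    ((Y ^ n : Rˣ) : R) * (a₂ * t) = (((1 - T ^ 2) / (v ^ 2 * T ^ 3)) • (↑Y⁻¹ * a₃) +
      (1 / T) • a₂) * (↑(Y ^ n) * t) ∧
    ((Y ^ n : Rˣ) : R) * (a₃ * t) = ((1 / (T ^ 3)) • a₃) * (↑(Y ^ n) * t) ∧
    ((Y ^ n : Rˣ) : R) * (b * t) = (((1 - T ^ 2 - v ^ 2 * T ^ 2 + v ^ 2 * T ^ 4 - v ^ 4 * T ^ 2 +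
      v ^ 4 * T ^ 4 + v ^ 6 * T ^ 4 -
      v ^ 6 * T ^ 6) / (v ^ 9 * T ^ 6)) • (↑Y⁻¹ * (↑Y⁻¹ * (↑Y⁻¹ * (a₃ * a₃)))) + ((1 - T ^ 2 +
      v ^ 2 - 2 * v ^ 2 * T ^ 2 + v ^ 2 * T ^ 4 + v ^ 4 - 2 * v ^ 4 * T ^ 2 + v ^ 4 * T ^ 4 -
      v ^ 6 * T ^ 2 + v ^ 6 * T ^ 4) / (v ^ 4 * T ^ 4)) • (↑Y⁻¹ * (↑Y⁻¹ * (a₃ * a₂))) + ((1 -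
      T ^ 2 + v ^ 2 - v ^ 2 * T ^ 2 + v ^ 4 -
      v ^ 4 * T ^ 2) / (v ^ 2 * T ^ 2)) • (↑Y⁻¹ * (a₂ * a₂)) + b) * (↑(Y ^ n) * t) := by
  refine ⟨?_, ?_, ?_, ?_, ?_⟩ <;>
  revert T t <;> refine units_zpow_mul_mul_eq hv Y ?_ (fun T hT t => ?_) <;>
  simp only [mul_add (R := R), add_mul (R := R), smul_mul_assoc, mul_smul_comm, mul_assoc,
    smul_add, smul_smul, Units.mul_inv_cancel_left, Units.inv_mul_cancel_left, one_pow, mul_one,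
      h.mul_left, h.inv_y hv] <;>
  match_scalars <;> field_simp <;> ring

/-- `∑ c v ^ a m ^ b p ^ d` over the listed `(c, a, b, d)`. -/
def laurentPoly (v m p : k) : List (ℤ × ℕ × ℕ × ℕ) → k
  | [] => 0
  | (c, a, b, d) :: l => c * (v ^ a * m ^ b * p ^ d) + laurentPoly v m p l

/-- Normal form of X^n (XY) X^{-n} with p = v^n; `m` is carried along only for uniformity with the
later coefficients. -/
def qG2Coeff1 (v m p : k) (x y a₁ : R) : R :=
  (laurentPoly v m p [(1, 0, 0, 0)] / (v ^ 3 * p ^ 3)) • (y * x) +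
  (laurentPoly v m p [(-1, 0, 0, 0), (1, 6, 0, 6)] / (v ^ 3 * p ^ 3)) • a₁

/-- In the suffixes of these scalars the letters a, c, d stand for a₁, a₂, a₃; the suffix names the
monomial whose coefficient is given. -/
def qG2Coeff2_yc (v m p : k) : k :=
  laurentPoly v m p [(-1, 0, 2, 2), (1, 0, 4, 4), (1, 2, 0, 0), (-2, 2, 2, 2), (1, 2, 4, 4), (1, 4,
    0, 6), (-1, 4, 2, 2), (-1, 4, 2, 8), (1, 4, 4, 4), (1, 6, 0, 6), (-1, 6, 2,
    8)] / (v ^ 2 * m * p ^ 4)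

/-- Conjugate of Y² · `qG2Coeff1` by Y^n with v^n = mp. No inverse survives. -/
def qG2Coeff2 (v m p : k) (x y a₁ a₂ a₃ : R) : R :=
  (laurentPoly v m p [(1, 0, 3, 0)] / (v ^ 3)) • (y * (y * (y * x))) +
  (laurentPoly v m p [(-1, 0, 3, 2), (1, 2, 1, 0), (-1, 2, 3, 2), (1, 4, 1, 0), (-1, 4, 3, 2),
    (1, 6, 1, 6)] / (v ^ 3 * p ^ 2)) • (y * (y * a₁)) +
  qG2Coeff2_yc v m p • (y * a₂) +
  (laurentPoly v m p [(-1, 0, 2, 0), (1, 0, 4, 2), (1, 2, 0, 4), (-1, 2, 2, 6), (1, 2, 4, 2),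
    (-1, 2, 6, 4), (-1, 4, 2, 6), (1, 4, 4, 8)] / (v ^ 2 * m ^ 3 * p ^ 4)) • a₃

def qG2Coeff3_yaa (v m p : k) : k :=
  laurentPoly v m p [(1, 0, 0, 4), (1, 2, 0, 4), (1, 4, 0, 4), (-1, 4, 2, 0), (-1, 6, 2, 6), (-1,
    6, 6, 4), (-1, 8, 2, 6), (-1, 8, 6, 4), (-1, 10, 6, 4), (1, 10, 8, 0), (1, 12, 8, 6), (1, 14,
    8, 6)] / (v ^ 9 * m ^ 6 * p ^ 4)

def qG2Coeff3_ycx (v m p : k) : k :=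
  laurentPoly v m p [(1, 0, 0, 4), (1, 2, 0, 4), (-1, 6, 0, 4), (-1, 6, 4, 2), (-1, 8, 0, 4), (1,
    8, 2, 0), (-2, 8, 4, 2), (1, 10, 2, 6), (-1, 10, 4, 2), (-1, 10, 4, 8), (1, 10, 6, 4), (1,
    12, 2, 6), (-1, 12, 4, 8), (1, 12, 6, 4), (1, 14, 6, 4)] / (v ^ 11 * m ^ 6 * p ^ 4)

def qG2Coeff3_ca (v m p : k) : k :=
  laurentPoly v m p [(-1, 0, 0, 4), (-1, 2, 0, 4), (1, 2, 2, 0), (-1, 4, 0, 4), (1, 4, 2, 0), (1,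
    4, 2, 6), (2, 6, 2, 6), (-1, 6, 4, 2), (1, 6, 6, 4), (1, 8, 2, 6), (-1, 8, 4, 2), (1, 8, 6,
    4), (-1, 8, 8, 0), (-1, 10, 4, 8), (1, 10, 6, 4), (-1, 10, 8, 0), (-1, 10, 8, 6), (-2, 12, 8,
    6), (1, 12, 10, 2), (-1, 14, 8, 6), (1, 14, 10, 2), (1, 16, 10, 8)] / (v ^ 8 * m ^ 6 * p ^ 4)

def qG2Coeff3_dx (v m p : k) : k :=
  laurentPoly v m p [(-1, 0, 0, 4), (1, 2, 0, 4), (1, 4, 0, 4), (-1, 4, 2, 0), (1, 4, 4, 2), (-1,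
    6, 2, 6), (1, 6, 4, 2), (-1, 8, 2, 6), (1, 8, 4, 8), (-1, 8, 6, 4), (-1, 10, 6, 4), (1, 12,
    6, 4)] / (v ^ 9 * m ^ 6 * p ^ 4)

def qG2Coeff3_b (v m p : k) : k :=
  laurentPoly v m p [(1, 0, 0, 4), (-1, 0, 2, 0), (-1, 2, 2, 6), (1, 2, 4, 2), (-1, 4, 2, 6), (1,
    4, 4, 2), (1, 6, 4, 8), (-2, 6, 6, 4), (1, 6, 8, 0), (1, 8, 8, 6), (-1, 8, 10, 2), (1, 10, 8,
    6), (-1, 10, 10, 2), (-1, 12, 10, 8), (1, 12, 12, 4)] / (v ^ 6 * m ^ 6 * p ^ 4)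

/-- Conjugate of X · `qG2Coeff2` by X^n with v^n = m. -/
def qG2Coeff3 (v m p : k) (x y a₁ a₂ a₃ b : R) : R :=
  (laurentPoly v m p [(1, 0, 0, 0)] / (v ^ 12 * m ^ 6)) • (y * (y * (y * (x * x)))) +
  (laurentPoly v m p [(-1, 0, 0, 2), (-1, 2, 0, 2), (-1, 4, 0, 2), (1, 8, 4, 0), (1, 10, 4, 0),
    (1, 12, 4, 6)] / (v ^ 12 * m ^ 6 * p ^ 2)) • (y * (y * (a₁ * x))) +
  qG2Coeff3_yaa v m p • (y * (a₁ * a₁)) +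
  qG2Coeff3_ycx v m p • (y * (a₂ * x)) +
  qG2Coeff3_ca v m p • (a₂ * a₁) +
  qG2Coeff3_dx v m p • (a₃ * x) +
  qG2Coeff3_b v m p • b

def qG2Coeff4_yyaa (v m p : k) : k :=
  laurentPoly v m p [(1, 0, 8, 0), (1, 2, 8, 0), (-1, 4, 2, 0), (-1, 4, 4, 2), (2, 4, 8, 0), (1, 6,
    0, 4), (-1, 6, 2, 6), (-1, 6, 4, 2), (-1, 6, 6, 4), (1, 8, 0, 4), (-1, 8, 2, 6), (-1, 8, 4,
    2), (-1, 8, 6, 4), (1, 10, 0, 4), (1, 10, 4, 8), (-1, 10, 6, 4), (-1, 10, 8, 6), (1, 12, 4,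
    8), (1, 14, 4, 8)] / (v ^ 9 * m ^ 2 * p ^ 6)

def qG2Coeff4_yycx (v m p : k) : k :=
  laurentPoly v m p [(1, 0, 6, 0), (1, 2, 6, 0), (-1, 4, 2, 2), (1, 4, 6, 0), (-2, 6, 2, 2), (1, 8,
    0, 0), (-2, 8, 2, 2), (-1, 8, 6, 0), (1, 10, 0, 6), (-1, 10, 2, 2), (1, 10, 4, 4), (-1, 10,
    6, 6), (1, 12, 0, 6), (1, 12, 4, 4), (-1, 12, 6, 6), (1, 14, 4, 4)] / (v ^ 11 * p ^ 6)

def qG2Coeff4_yca (v m p : k) : k :=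
  laurentPoly v m p [(-1, 0, 10, 0), (1, 2, 4, 0), (1, 2, 6, 2), (-2, 2, 10, 0), (-1, 4, 2, 4), (1,
    4, 4, 0), (2, 4, 6, 2), (1, 4, 8, 4), (-2, 4, 10, 0), (-3, 6, 2, 4), (1, 6, 4, 6), (2, 6, 6,
    2), (2, 6, 8, 4), (1, 8, 0, 2), (-3, 8, 2, 4), (-1, 8, 4, 0), (-1, 8, 6, 8), (2, 8, 8, 4),
    (1, 8, 10, 0), (1, 8, 10, 6), (1, 10, 0, 8), (-1, 10, 2, 4), (-3, 10, 6, 8), (1, 10, 10, 6),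
    (1, 12, 0, 8), (1, 12, 2, 10), (-3, 12, 6, 8), (1, 14, 2, 10), (1, 14, 4, 6), (-1, 14, 6, 8),
    (-1, 14, 10, 6), (1, 16, 8, 10)] / (v ^ 8 * m ^ 4 * p ^ 6)

def qG2Coeff4_ydx (v m p : k) : k :=
  laurentPoly v m p [(-1, 0, 6, 0), (1, 2, 2, 2), (-1, 4, 0, 0), (1, 4, 2, 2), (1, 4, 6, 0), (1, 6,
    2, 2), (-1, 6, 4, 4), (-1, 8, 0, 6), (-1, 8, 4, 4), (1, 8, 6, 6), (-1, 10, 4, 4), (1, 12, 0,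
    6)] / (v ^ 9 * p ^ 6)

def qG2Coeff4_cc (v m p : k) : k :=
  laurentPoly v m p [(1, 0, 2, 2), (-1, 0, 6, 0), (-1, 0, 8, 2), (1, 0, 12, 0), (-1, 2, 0, 6), (1,
    2, 4, 4), (1, 2, 6, 6), (-1, 2, 10, 4), (-1, 6, 2, 8), (1, 6, 6, 6), (1, 6, 8, 8), (-1, 6,
    12, 6), (1, 8, 0, 12), (-1, 8, 4, 10), (-1, 8, 6, 12), (1, 8, 10,
    10)] / (v ^ 4 * m ^ 6 * p ^ 6)

def qG2Coeff4_da (v m p : k) : k :=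
  laurentPoly v m p [(-1, 0, 6, 2), (1, 0, 10, 0), (1, 2, 2, 4), (-1, 2, 6, 2), (-1, 4, 0, 2), (1,
    4, 2, 4), (1, 4, 4, 0), (-1, 4, 10, 0), (-1, 6, 4, 6), (1, 6, 6, 8), (1, 6, 8, 4), (-1, 6,
    10, 6), (-1, 8, 2, 10), (1, 8, 6, 8), (1, 10, 0, 8), (-1, 10, 2, 10), (-1, 10, 4, 6), (1, 10,
    10, 6), (1, 12, 4, 12), (-1, 12, 8, 10)] / (v ^ 6 * m ^ 4 * p ^ 6)

def qG2Coeff4_yb (v m p : k) : k :=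
  laurentPoly v m p [(-1, 0, 6, 0), (1, 0, 12, 0), (1, 2, 4, 4), (-1, 2, 10, 4), (-1, 4, 2, 2), (1,
    4, 4, 4), (1, 4, 6, 0), (1, 4, 8, 2), (-1, 4, 10, 4), (-1, 4, 12, 0), (1, 6, 0, 6), (-1, 6,
    2, 8), (-1, 6, 6, 6), (1, 6, 8, 8), (-1, 8, 2, 8), (1, 8, 8, 8), (-1, 10, 6, 6), (1, 10, 12,
    6), (1, 12, 4, 10), (-1, 12, 10, 10)] / (v ^ 6 * m ^ 6 * p ^ 6)

/-- Conjugate of Y · `qG2Coeff3` by Y^n with v^n = m²p⁻¹. This is the left multiplier in the Verma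
recursion, up to the outer power X^r on one of the two sides. -/
def qG2Coeff4 (v m p : k) (x y a₁ a₂ a₃ b : R) : R :=
  (laurentPoly v m p [(1, 0, 6, 0)] / (v ^ 12 * p ^ 6)) • (y * (y * (y * (y * (x * x))))) +
  (laurentPoly v m p [(-1, 0, 6, 0), (-1, 2, 6, 0), (-1, 4, 6, 0), (1, 6, 2, 2), (-1, 6, 6, 0),
    (1, 8, 2, 2), (1, 10, 2, 2), (1, 12, 6, 6)] / (v ^ 12 * p ^ 6)) • (y * (y * (y * (a₁ * x)))) +
  qG2Coeff4_yyaa v m p • (y * (y * (a₁ * a₁))) +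
  qG2Coeff4_yycx v m p • (y * (y * (a₂ * x))) +
  qG2Coeff4_yca v m p • (y * (a₂ * a₁)) +
  qG2Coeff4_ydx v m p • (y * (a₃ * x)) +
  qG2Coeff4_cc v m p • (a₂ * a₂) +
  qG2Coeff4_da v m p • (a₃ * a₁) +
  qG2Coeff4_yb v m p • (y * b)

-- The four `coeff` lemmas are to be applied from the right end of a Verma word to its left: each
-- absorbs the letters newly inserted next to one power and passes the result through that power.
set_option maxHeartbeats 4000000 in
theorem QRelG2.coeff1_spec {v : k} {X Y : Rˣ} {a₁ a₂ a₃ b : R}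
    (h : QRelG2 v (X : R) Y a₁ a₂ a₃ b) (hv : v ≠ 0) {n : ℤ}
    {m p : k} (hm : m ≠ 0) (hp : p ≠ 0) (hn : v ^ n = p) (t : R) :
    ((X ^ n : Rˣ) : R) * (X * (Y * t)) =
      qG2Coeff1 v m p (X : R) Y a₁ * (↑(X ^ n) * t) := by
  simp only [mul_add (R := R), add_mul (R := R), smul_mul_assoc, mul_smul_comm, mul_assoc,
    smul_add, smul_smul, qG2Coeff1, zpow_mul_self_mul, Units.mul_inv_cancel_left,
      Units.inv_mul_cancel_left, h.mul_left, h.inv_x hv, h.zpow_x hv _ hn]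
  match_scalars <;>
    simp only [laurentPoly] <;>
    field_simp <;> ring

set_option maxHeartbeats 4000000 in
theorem QRelG2.coeff2_spec {v : k} {X Y : Rˣ} {a₁ a₂ a₃ b : R}
    (h : QRelG2 v (X : R) Y a₁ a₂ a₃ b) (hv : v ≠ 0) {n : ℤ}
    {m p : k} (hm : m ≠ 0) (hp : p ≠ 0) (hn : v ^ n = m * p) (t : R) :
    ((Y ^ n : Rˣ) : R) * (Y * (Y * (qG2Coeff1 v m p (X : R) Y a₁ * t))) =
      qG2Coeff2 v m p (X : R) Y a₁ a₂ a₃ * (↑(Y ^ n) * t) := by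
  simp only [mul_add (R := R), add_mul (R := R), smul_mul_assoc, mul_smul_comm, mul_assoc,
    smul_add, smul_smul, qG2Coeff1, qG2Coeff2, zpow_mul_self_mul, Units.mul_inv_cancel_left,
      Units.inv_mul_cancel_left, h.mul_left, h.inv_y hv, h.zpow_y hv _ hn]
  match_scalars <;>
    simp only [laurentPoly, qG2Coeff2_yc] <;>
    field_simp <;> ring

set_option maxHeartbeats 4000000 in
theorem QRelG2.coeff3_spec {v : k} {X Y : Rˣ} {a₁ a₂ a₃ b : R}
    (h : QRelG2 v (X : R) Y a₁ a₂ a₃ b) (hv : v ≠ 0) {n : ℤ}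
    {m p : k} (hm : m ≠ 0) (hp : p ≠ 0) (hn : v ^ n = m) (t : R) :
    ((X ^ n : Rˣ) : R) * (X * (qG2Coeff2 v m p (X : R) Y a₁ a₂ a₃ * t)) =
      qG2Coeff3 v m p (X : R) Y a₁ a₂ a₃ b * (↑(X ^ n) * t) := by
  simp only [mul_add (R := R), add_mul (R := R), smul_mul_assoc, mul_smul_comm, mul_assoc,
    smul_add, smul_smul, qG2Coeff2, qG2Coeff3, zpow_mul_self_mul, Units.mul_inv_cancel_left,
      Units.inv_mul_cancel_left, h.mul_left, h.inv_x hv, h.zpow_x hv _ hn]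
  match_scalars <;>
    simp only [laurentPoly, qG2Coeff2_yc, qG2Coeff3_yaa, qG2Coeff3_ycx, qG2Coeff3_ca,
      qG2Coeff3_dx, qG2Coeff3_b] <;>
    field_simp <;> ring

set_option maxHeartbeats 4000000 in
theorem QRelG2.coeff4_spec {v : k} {X Y : Rˣ} {a₁ a₂ a₃ b : R}
    (h : QRelG2 v (X : R) Y a₁ a₂ a₃ b) (hv : v ≠ 0) {n : ℤ}
    {m p : k} (hm : m ≠ 0) (hp : p ≠ 0) (hn : v ^ n = m ^ 2 * p⁻¹) (t : R) :
    ((Y ^ n : Rˣ) : R) * (Y * (qG2Coeff3 v m p (X : R) Y a₁ a₂ a₃ b * t)) =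
      qG2Coeff4 v m p (X : R) Y a₁ a₂ a₃ b * (↑(Y ^ n) * t) := by
  simp only [mul_add (R := R), add_mul (R := R), smul_mul_assoc, mul_smul_comm, mul_assoc,
    smul_add, smul_smul, qG2Coeff3, qG2Coeff4, zpow_mul_self_mul, Units.mul_inv_cancel_left,
      Units.inv_mul_cancel_left, h.mul_left, h.inv_y hv, h.zpow_y hv _ hn]
  match_scalars <;>
    simp only [laurentPoly, qG2Coeff3_yaa, qG2Coeff3_ycx, qG2Coeff3_ca, qG2Coeff3_dx, qG2Coeff3_b,
      qG2Coeff4_yyaa, qG2Coeff4_yycx, qG2Coeff4_yca, qG2Coeff4_ydx, qG2Coeff4_cc, qG2Coeff4_da,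
        qG2Coeff4_yb] <;>
    field_simp <;> ring

-- This is where the two sides of the Verma identity meet. They run through the same intermediate
-- exponents in opposite order, so their multipliers differ by exchanging m and p, and conjugation
-- by the outer X^r performs exactly that exchange.
set_option maxHeartbeats 4000000 in
theorem QRelG2.coeff4_symm {v : k} {X Y : Rˣ} {a₁ a₂ a₃ b : R}
    (h : QRelG2 v (X : R) Y a₁ a₂ a₃ b) (hv : v ≠ 0) {n : ℤ}
    {r s : k} (hr : r ≠ 0) (hs : s ≠ 0) (hn : v ^ n = r) (t : R) :
    ((X ^ n : Rˣ) : R) * (qG2Coeff4 v (r ^ 2 * s) (r * s) (X : R) Y a₁ a₂ a₃ b * t) =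
      qG2Coeff4 v (r * s) (r ^ 2 * s) (X : R) Y a₁ a₂ a₃ b * (↑(X ^ n) * t) := by
  simp only [mul_add (R := R), add_mul (R := R), smul_mul_assoc, mul_smul_comm, mul_assoc,
    smul_add, smul_smul, qG2Coeff4, zpow_mul_self_mul, Units.mul_inv_cancel_left,
      Units.inv_mul_cancel_left, h.mul_left, h.inv_x hv, h.zpow_x hv _ hn]
  match_scalars <;>
    simp only [laurentPoly, qG2Coeff4_yyaa, qG2Coeff4_yycx, qG2Coeff4_yca, qG2Coeff4_ydx,
      qG2Coeff4_cc, qG2Coeff4_da, qG2Coeff4_yb] <;>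
    field_simp <;> ring

/-- The Verma identity of type `G₂` over a `q`-deformed algebra. -/
theorem QRelG2.verma {v : k} {X Y : Rˣ} {a₁ a₂ a₃ b : R}
    (h : QRelG2 v (X : R) Y a₁ a₂ a₃ b) (hv : v ≠ 0) (r s : ℤ) :
    X ^ r * Y ^ (3 * r + s) * X ^ (2 * r + s) * Y ^ (3 * r + 2 * s) * X ^ (r + s) * Y ^ s =
      Y ^ s * X ^ (r + s) * Y ^ (3 * r + 2 * s) * X ^ (2 * r + s) * Y ^ (3 * r + s) * X ^ r := by
  refine units_eq_of_succ_eq_mul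
    (f := fun s => X ^ r * Y ^ (3 * r + s) * X ^ (2 * r + s) * Y ^ (3 * r + 2 * s) * X ^ (r + s) *
      Y ^ s)
    (g := fun s => Y ^ s * X ^ (r + s) * Y ^ (3 * r + 2 * s) * X ^ (2 * r + s) * Y ^ (3 * r + s) *
      X ^ r)
    -- The multiplier as it arises from the right-hand word: m = v^{r+s} and p = v^{2r+s}.
    (fun s => qG2Coeff4 v (v ^ r * v ^ s) ((v ^ r) ^ 2 * v ^ s) (X : R) Y a₁ a₂ a₃ b)
    (fun s => ?_) (fun s => ?_) ?_ s
  all_goals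
    have hr : v ^ r ≠ 0 := zpow_ne_zero _ hv
    have hs : v ^ s ≠ 0 := zpow_ne_zero _ hv
    have hm := mul_ne_zero (pow_ne_zero 2 hr) hs
    have hp := mul_ne_zero hr hs
    have e1 : v ^ (r + s) = v ^ r * v ^ s := zpow_add₀ hv _ _
    have e2 : v ^ (2 * r + s) = (v ^ r) ^ 2 * v ^ s := by
      rw [zpow_add₀ hv, mul_comm 2 r, zpow_mul, zpow_ofNat]
    have e3 : v ^ (3 * r + 2 * s) = (v ^ r) ^ 2 * v ^ s * (v ^ r * v ^ s) := by
      rw [← e1, ← e2, ← zpow_add₀ hv]; congr 1; ring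
    -- 3r + s = 2(2r + s) - (r + s); the next exponent, s = 2(r + s) - (2r + s), is its mirror image
    -- for the other word.
    have e4 : v ^ (3 * r + s) = ((v ^ r) ^ 2 * v ^ s) ^ 2 * (v ^ r * v ^ s)⁻¹ := by
      rw [← e1, ← e2, ← zpow_natCast, ← zpow_mul, ← zpow_neg, ← zpow_add₀ hv]; congr 1
      push_cast; ring
    have e5 : v ^ s = (v ^ r * v ^ s) ^ 2 * ((v ^ r) ^ 2 * v ^ s)⁻¹ := by field_simp
    have hY : ∀ n : ℤ, Y ^ (n + 1) = Y * Y ^ n := fun n => by rw [add_comm, zpow_one_add]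
    have f1 : 3 * r + 2 * (s + 1) = 3 * r + 2 * s + 1 + 1 := by ring
  -- Raising s by one adds one letter to every power depending on s, except Y^{3r+2s}, which gains
  -- two. New letters go to the right of their power, but the last power takes its letter on the
  -- left, so that the inserted letters become adjacent.
  · simp only [f1, ← add_assoc, zpow_add_one _ (3 * r + s), zpow_add_one _ (2 * r + s),
      zpow_add_one _ (3 * r + 2 * s + 1), zpow_add_one _ (3 * r + 2 * s), zpow_add_one _ (r + s),
      hY s, Units.val_mul, mul_assoc]
    rw [h.coeff1_spec hv hm hp e1, h.coeff2_spec hv hm hp e3, h.coeff3_spec hv hm hp e2,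
      h.coeff4_spec hv hm hp e4, h.coeff4_symm hv hr hs rfl]
  · simp only [f1, ← add_assoc, hY (3 * r + s),
      zpow_add_one _ (2 * r + s),
      zpow_add_one _ (3 * r + 2 * s + 1), zpow_add_one _ (3 * r + 2 * s), zpow_add_one _ (r + s),
      zpow_add_one Y s, Units.val_mul, mul_assoc]
    rw [h.coeff1_spec hv hp hm e2, h.coeff2_spec hv hp hm (by rw [e3, mul_comm]),
      h.coeff3_spec hv hp hm e1, h.coeff4_spec hv hp hm e5]
  -- At s = 0 both words are X^r Y^{3r} X^{2r} Y^{3r} X^r.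
  · simp [mul_assoc]

end G2

/-! ### The `q`-deformed algebra of type A₂ and its Verma identity. -/

section A2

variable {k R : Type*} [Field k] [Ring R] [Algebra k R]

/-- Commutation relations between scaled root vectors of the `q`-deformed nilpotent algebra of
type `A₂`. -/
structure QRelA2 (v : k) (x y a₁ : R) : Prop where
  xy : x * y = (1 / v) • (y * x) + ((-1 + v ^ 2) / v) • a₁
  xa₁ : x * a₁ = v • (a₁ * x)
  a₁y : a₁ * y = v • (y * a₁)

/-- With a₁ the rescaled `q`-commutator of x and y, the two Serre relations say precisely that a₁
`q`-commutes with x and with y. -/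
theorem exists_qRelA2 {v : k} (hv : v ≠ 0) (h1 : v - v⁻¹ ≠ 0) {x y : R}
    (hx : qAd v (-1) x y 2 = 0) (hy : qAd v (-1) y x 2 = 0) :
    ∃ a₁ : R, QRelA2 v x y a₁ := by
  obtain ⟨a₁, w1⟩ : ∃ a₁ : R, (v - v⁻¹) • a₁ = x * y - v⁻¹ • (y * x) :=
    ⟨_, smul_inv_smul_eq h1 _⟩
  simp only [qAd] at hx hy
  norm_num [zpow_neg] at hx hy
  refine ⟨a₁, ?_, ?_, ?_⟩
  · rw [← sub_eq_iff_eq_add', one_div, ← w1]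
    match_scalars
    field_simp
    ring
  · refine smul_left_cancel_of_ne_zero h1 ?_
    rw [← mul_smul_comm, smul_comm, ← smul_mul_assoc, w1]
    simp only [mul_sub, sub_mul, smul_mul_assoc, mul_smul_comm, mul_assoc, smul_sub,
      smul_smul] at hx ⊢
    linear_combination (norm := skip) hx
    match_scalars <;> field_simp <;> ring
  · refine smul_left_cancel_of_ne_zero h1 ?_
    rw [← smul_mul_assoc, smul_comm, ← mul_smul_comm, w1]
    simp only [mul_sub, sub_mul, smul_mul_assoc, mul_smul_comm, mul_assoc, smul_sub,
      smul_smul] at hy ⊢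
    linear_combination (norm := skip) hy
    match_scalars <;> field_simp <;> ring

theorem QRelA2.mul_left {v : k} {x y a₁ : R} (h : QRelA2 v x y a₁) (t : R) :
    x * (y * t) = ((1 / v) • (y * x) + ((-1 + v ^ 2) / v) • a₁) * t ∧
    x * (a₁ * t) = (v • (a₁ * x)) * t ∧
    a₁ * (y * t) = (v • (y * a₁)) * t := by
  simp only [← mul_assoc, h.xy, h.xa₁, h.a₁y, and_self]

theorem QRelA2.zpow_x {v : k} {X Y : Rˣ} {a₁ : R} (h : QRelA2 v (X : R) Y a₁)
    (hv : v ≠ 0) {n : ℤ} (T : k)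
    (hT : v ^ n = T) (t : R) :
    ((X ^ n : Rˣ) : R) * (↑Y * t) = (((-1 + T ^ 2) / T) • (a₁ * ↑X⁻¹) +
        (1 / T) • ↑Y) * (↑(X ^ n) * t) ∧
    ((X ^ n : Rˣ) : R) * (a₁ * t) = (T • a₁) * (↑(X ^ n) * t) := by
  refine ⟨?_, ?_⟩ <;>
  revert T t <;> refine units_zpow_mul_mul_eq hv X ?_ (fun T hT t => ?_) <;>
  (try simp only [mul_add (R := R), add_mul (R := R), smul_mul_assoc, mul_smul_comm, mul_assoc,
    smul_add, smul_smul, Units.mul_inv_cancel_left, Units.inv_mul_cancel_left, one_pow, mul_one,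
      h.mul_left]) <;>
  match_scalars <;> field_simp <;> ring

theorem QRelA2.zpow_y {v : k} {X Y : Rˣ} {a₁ : R} (h : QRelA2 v (X : R) Y a₁)
    (hv : v ≠ 0) {n : ℤ} (T : k)
    (hT : v ^ n = T) (t : R) :
    ((Y ^ n : Rˣ) : R) * (↑X * t) = (((1 - T ^ 2) / T) • (↑Y⁻¹ * a₁) + T • ↑X) * (↑(Y ^ n) * t) ∧
    ((Y ^ n : Rˣ) : R) * (a₁ * t) = ((1 / T) • a₁) * (↑(Y ^ n) * t) := by
  refine ⟨?_, ?_⟩ <;>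
  revert T t <;> refine units_zpow_mul_mul_eq hv Y ?_ (fun T hT t => ?_) <;>
  (try simp only [mul_add (R := R), add_mul (R := R), smul_mul_assoc, mul_smul_comm, mul_assoc,
    smul_add, smul_smul, Units.mul_inv_cancel_left, Units.inv_mul_cancel_left, one_pow, mul_one,
      h.mul_left]) <;>
  match_scalars <;> field_simp <;> ring

/-- Normal form of Y^n (YX) Y^{-n} with m = v^n. -/
def qA2Coeff (m : k) (x y a₁ : R) : R :=
  m • (y * x) + ((1 - m ^ 2) / m) • a₁

theorem QRelA2.coeff_spec {v : k} {X Y : Rˣ} {a₁ : R} (h : QRelA2 v (X : R) Y a₁)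
    (hv : v ≠ 0) {n : ℤ}
    {m : k} (hm : m ≠ 0) (hn : v ^ n = m) (t : R) :
    ((Y ^ n : Rˣ) : R) * (Y * (X * t)) =
      qA2Coeff m (X : R) Y a₁ * (↑(Y ^ n) * t) := by
  simp only [mul_add (R := R), add_mul (R := R), smul_mul_assoc, mul_smul_comm, mul_assoc,
    smul_add, smul_smul, qA2Coeff, zpow_mul_self_mul, Units.mul_inv_cancel_left,
      Units.inv_mul_cancel_left, h.mul_left, h.zpow_y hv _ hn]
  match_scalars <;> field_simp <;> ring

theorem QRelA2.coeff_symm {v : k} {X Y : Rˣ} {a₁ : R} (h : QRelA2 v (X : R) Y a₁)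
    (hv : v ≠ 0) {n : ℤ}
    {r s : k} (hr : r ≠ 0) (hs : s ≠ 0) (hn : v ^ n = r) (t : R) :
    ((X ^ n : Rˣ) : R) * (qA2Coeff (r * s) (X : R) Y a₁ * t) =
      qA2Coeff s (X : R) Y a₁ * (↑(X ^ n) * t) := by
  simp only [mul_add (R := R), add_mul (R := R), smul_mul_assoc, mul_smul_comm, mul_assoc,
    smul_add, smul_smul, qA2Coeff, zpow_mul_self_mul, Units.mul_inv_cancel_left,
      Units.inv_mul_cancel_left, h.mul_left, h.zpow_x hv _ hn]
  match_scalars <;> field_simp <;> ring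

/-- On either side one step in s inserts YX just after the leftmost power of Y. The multiplier is
`qA2Coeff` at v^s on the right and at v^{r+s} on the left; passing the latter through X^r turns it
into the former. -/
theorem QRelA2.verma {v : k} {X Y : Rˣ} {a₁ : R} (h : QRelA2 v (X : R) Y a₁) (hv : v ≠ 0)
    (r s : ℤ) : X ^ r * Y ^ (r + s) * X ^ s = Y ^ s * X ^ (r + s) * Y ^ r := by
  refine units_eq_of_succ_eq_mul
    (f := fun s => X ^ r * Y ^ (r + s) * X ^ s) (g := fun s => Y ^ s * X ^ (r + s) * Y ^ r)
    (fun s => qA2Coeff (v ^ s) (X : R) Y a₁) (fun s => ?_) (fun s => ?_) ?_ s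
  all_goals
    have hr : v ^ r ≠ 0 := zpow_ne_zero _ hv
    have hs : v ^ s ≠ 0 := zpow_ne_zero _ hv
    have hX : ∀ n : ℤ, X ^ (n + 1) = X * X ^ n := fun n => by rw [add_comm, zpow_one_add]
  · simp only [← add_assoc, zpow_add_one _ (r + s), hX s, Units.val_mul, mul_assoc]
    rw [h.coeff_spec hv (mul_ne_zero hr hs) (zpow_add₀ hv _ _), h.coeff_symm hv hr hs rfl]
  · simp only [← add_assoc, zpow_add_one Y s, hX (r + s), Units.val_mul, mul_assoc]
    rw [h.coeff_spec hv hs rfl]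
  · simp

end A2

/-! ### The `q`-deformed algebra of type B₂ and its Verma identity. -/

section B2

variable {k R : Type*} [Field k] [Ring R] [Algebra k R]

/-- Commutation relations between scaled root vectors of the `q`-deformed nilpotent algebra of
type `B₂`, with `x` the long and `y` the short simple root vector. -/
structure QRelB2 (v : k) (x y a₁ a₂ : R) : Prop where
  xy : x * y = (1 / (v ^ 2)) • (y * x) + ((-1 + v ^ 4) / (v ^ 2)) • a₁
  xa₁ : x * a₁ = (v ^ 2) • (a₁ * x)
  xa₂ : x * a₂ = ((-1 + v ^ 4) / v) • (a₁ * a₁) + a₂ * x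
  a₁y : a₁ * y = y * a₁ + ((-1 + v ^ 2) / v) • a₂
  a₁a₂ : a₁ * a₂ = (v ^ 2) • (a₂ * a₁)
  a₂y : a₂ * y = (v ^ 2) • (y * a₂)

/-- The Serre relations supply the rules for xa₁ and a₂y. Associativity of x a₁ y and then of x a₂ y
forces the rules for xa₂ and a₁a₂. -/
theorem exists_qRelB2 {v : k} (hv : v ≠ 0) (h1 : v - v⁻¹ ≠ 0) (h2 : v ^ 2 - v⁻¹ ^ 2 ≠ 0) {x y : R}
    (hx : qAd (v ^ 2) (-1) x y 2 = 0) (hy : qAd v (-2) y x 3 = 0) :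
    ∃ a₁ a₂ : R, QRelB2 v x y a₁ a₂ := by
  obtain ⟨a₁, w1⟩ : ∃ a₁ : R, (v ^ 2 - v⁻¹ ^ 2) • a₁ = x * y - v⁻¹ ^ 2 • (y * x) :=
    ⟨_, smul_inv_smul_eq h2 _⟩
  obtain ⟨a₂, w2⟩ : ∃ a₂ : R, (v - v⁻¹) • a₂ = a₁ * y - y * a₁ := ⟨_, smul_inv_smul_eq h1 _⟩
  simp only [qAd] at hx hy
  norm_num [zpow_neg] at hx hy
  have xy : x * y = v⁻¹ ^ 2 • (y * x) + (v ^ 2 - v⁻¹ ^ 2) • a₁ := by rw [w1]; abel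
  have a₁y : a₁ * y = y * a₁ + (v - v⁻¹) • a₂ := by rw [w2]; abel
  have xa₁ : x * a₁ = v ^ 2 • (a₁ * x) := by
    refine smul_left_cancel_of_ne_zero h2 ?_
    rw [← mul_smul_comm, smul_comm, ← smul_mul_assoc, w1]
    simp only [mul_sub, sub_mul, smul_mul_assoc, mul_smul_comm, mul_assoc, smul_sub,
      smul_smul] at hx ⊢
    linear_combination (norm := skip) hx
    match_scalars <;> field_simp <;> ring
  have a₂y : a₂ * y = v ^ 2 • (y * a₂) := by
    have e2 : ((v ^ 2 - v⁻¹ ^ 2) * (v - v⁻¹)) • a₂ =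
        (x * y - v⁻¹ ^ 2 • (y * x)) * y - y * (x * y - v⁻¹ ^ 2 • (y * x)) := by
      rw [mul_smul, w2, ← w1, smul_sub, smul_mul_assoc, mul_smul_comm]
    refine smul_left_cancel_of_ne_zero (mul_ne_zero h2 h1) ?_
    rw [← smul_mul_assoc, smul_comm, ← mul_smul_comm, e2]
    -- The Serre expression has order three here, so changing the side of the commutators costs a
    -- sign; hence `-hy` below.
    simp only [mul_sub, sub_mul, smul_mul_assoc, mul_smul_comm, mul_assoc, smul_sub,
      smul_smul] at hy ⊢
    linear_combination (norm := skip) -hy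
    match_scalars <;> field_simp <;> ring
  have xa₂ : x * a₂ = a₂ * x + (v * (v ^ 2 - v⁻¹ ^ 2)) • (a₁ * a₁) := by
    have e := mul_assoc x a₁ y
    rw [a₁y, xa₁] at e
    simp only [mul_add, add_mul, smul_mul_assoc, mul_smul_comm, mul_assoc, smul_add, smul_smul,
      xy, a₁y, xa₁, mul_mul_eq_of_mul_eq xy, mul_mul_eq_of_mul_eq a₁y] at e
    refine smul_left_cancel_of_ne_zero h1 ?_
    linear_combination (norm := skip) -e
    match_scalars <;> field_simp <;> ring
  have a₁a₂ : a₁ * a₂ = v ^ 2 • (a₂ * a₁) := by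
    have e := mul_assoc x a₂ y
    rw [a₂y, xa₂] at e
    simp only [mul_add, add_mul, smul_mul_assoc, mul_smul_comm, mul_assoc, smul_add, smul_smul,
      xy, a₁y, a₂y, xa₂, mul_mul_eq_of_mul_eq xy, mul_mul_eq_of_mul_eq a₁y,
      mul_mul_eq_of_mul_eq a₂y] at e
    refine smul_left_cancel_of_ne_zero h2 ?_
    linear_combination (norm := skip) -e
    match_scalars <;> field_simp <;> ring
  exact ⟨a₁, a₂, by rw [xy]; match_scalars <;> field_simp <;> ring, xa₁,
    by rw [xa₂]; match_scalars <;> field_simp <;> ring,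
    by rw [a₁y]; match_scalars <;> field_simp <;> ring, a₁a₂, a₂y⟩

theorem QRelB2.mul_left {v : k} {x y a₁ a₂ : R} (h : QRelB2 v x y a₁ a₂) (t : R) :
    x * (y * t) = ((1 / (v ^ 2)) • (y * x) + ((-1 + v ^ 4) / (v ^ 2)) • a₁) * t ∧
    x * (a₁ * t) = ((v ^ 2) • (a₁ * x)) * t ∧
    x * (a₂ * t) = (((-1 + v ^ 4) / v) • (a₁ * a₁) + a₂ * x) * t ∧
    a₁ * (y * t) = (y * a₁ + ((-1 + v ^ 2) / v) • a₂) * t ∧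
    a₁ * (a₂ * t) = ((v ^ 2) • (a₂ * a₁)) * t ∧
    a₂ * (y * t) = ((v ^ 2) • (y * a₂)) * t := by
  simp only [← mul_assoc, h.xy, h.xa₁, h.xa₂, h.a₁y, h.a₁a₂, h.a₂y, and_self]

theorem QRelB2.inv_x {v : k} {X Y : Rˣ} {a₁ a₂ : R} (h : QRelB2 v (X : R) Y a₁ a₂)
    (hv : v ≠ 0) (t : R) :
    ↑X⁻¹ * (↑Y * t) = ((1 - v ^ 4) / (v ^ 2)) • (a₁ * (↑X⁻¹ * (↑X⁻¹ * t))) +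
      (v ^ 2) • (↑Y * (↑X⁻¹ * t)) ∧
    ↑X⁻¹ * (a₁ * t) = (1 / (v ^ 2)) • (a₁ * (↑X⁻¹ * t)) ∧
    ↑X⁻¹ * (a₂ * t) = ((1 - v ^ 4) / (v ^ 5)) • (a₁ * (a₁ * (↑X⁻¹ * (↑X⁻¹ * t)))) +
        a₂ * (↑X⁻¹ * t) := by
  refine ⟨?_, ?_, ?_⟩ <;> apply X.isUnit.mul_left_cancel <;> rw [Units.mul_inv_cancel_left] <;>
  simp only [mul_add (R := R), add_mul (R := R), smul_mul_assoc, mul_smul_comm, mul_assoc,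
    smul_add, smul_smul, Units.mul_inv_cancel_left, Units.inv_mul_cancel_left, h.mul_left] <;>
  match_scalars <;> field_simp <;> ring

theorem QRelB2.zpow_x {v : k} {X Y : Rˣ} {a₁ a₂ : R} (h : QRelB2 v (X : R) Y a₁ a₂)
    (hv : v ≠ 0) {n : ℤ} (T : k)
    (hT : v ^ n = T) (t : R) :
    ((X ^ n : Rˣ) : R) * (↑Y * t) = (((-1 + T ^ 4) / (T ^ 2)) • (a₁ * ↑X⁻¹) +
      (1 / (T ^ 2)) • ↑Y) * (↑(X ^ n) * t) ∧
    ((X ^ n : Rˣ) : R) * (a₁ * t) = ((T ^ 2) • a₁) * (↑(X ^ n) * t) ∧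
    ((X ^ n : Rˣ) : R) * (a₂ * t) = (((-1 + T ^ 4) / v) • (a₁ * (a₁ * ↑X⁻¹)) +
        a₂) * (↑(X ^ n) * t) := by
  refine ⟨?_, ?_, ?_⟩ <;>
  revert T t <;> refine units_zpow_mul_mul_eq hv X ?_ (fun T hT t => ?_) <;>
  (try simp only [mul_add (R := R), add_mul (R := R), smul_mul_assoc, mul_smul_comm, mul_assoc,
    smul_add, smul_smul, Units.mul_inv_cancel_left, Units.inv_mul_cancel_left, one_pow, mul_one,
      h.mul_left]) <;>
  match_scalars <;> field_simp <;> ring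

theorem QRelB2.zpow_y {v : k} {X Y : Rˣ} {a₁ a₂ : R} (h : QRelB2 v (X : R) Y a₁ a₂)
    (hv : v ≠ 0) {n : ℤ} (T : k)
    (hT : v ^ n = T) (t : R) :
    ((Y ^ n : Rˣ) : R) * (↑X * t) = (((1 - T ^ 2 - v ^ 2 * T ^ 2 +
      v ^ 2 * T ^ 4) / (v * T ^ 2)) • (↑Y⁻¹ * (↑Y⁻¹ * a₂)) + (1 - T ^ 2 + v ^ 2 -
      v ^ 2 * T ^ 2) • (↑Y⁻¹ * a₁) + (T ^ 2) • ↑X) * (↑(Y ^ n) * t) ∧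
    ((Y ^ n : Rˣ) : R) * (a₁ * t) = (((1 - T ^ 2) / (v * T ^ 2)) • (↑Y⁻¹ * a₂) +
        a₁) * (↑(Y ^ n) * t) ∧
    ((Y ^ n : Rˣ) : R) * (a₂ * t) = ((1 / (T ^ 2)) • a₂) * (↑(Y ^ n) * t) := by
  refine ⟨?_, ?_, ?_⟩ <;>
  revert T t <;> refine units_zpow_mul_mul_eq hv Y ?_ (fun T hT t => ?_) <;>
  (try simp only [mul_add (R := R), add_mul (R := R), smul_mul_assoc, mul_smul_comm, mul_assoc,
    smul_add, smul_smul, Units.mul_inv_cancel_left, Units.inv_mul_cancel_left, one_pow, mul_one,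
      h.mul_left]) <;>
  match_scalars <;> field_simp <;> ring

def qB2Coeff1 (v p : k) (x y a₁ : R) : R :=
  (1 / (v ^ 2 * p ^ 2)) • (y * x) + ((-1 + v ^ 4 * p ^ 4) / (v ^ 2 * p ^ 2)) • a₁

/-- Conjugate of Y · `qB2Coeff1` by Y^n, with m = v^n and p the parameter of the previous
conjugation by a power of X. -/
def qB2Coeff2 (v m p : k) (x y a₁ a₂ : R) : R :=
  ((m ^ 2) / (v ^ 2 * p ^ 2)) • (y * (y * x)) + ((-m ^ 2 + v ^ 2 - v ^ 2 * m ^ 2 +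
      v ^ 4 * p ^ 4) / (v ^ 2 * p ^ 2)) • (y * a₁) + ((-m ^ 2 + m ^ 4 + v ^ 2 * p ^ 4 -
      v ^ 2 * m ^ 2 * p ^ 4) / (v * m ^ 2 * p ^ 2)) • a₂

theorem QRelB2.coeff1_spec {v : k} {X Y : Rˣ} {a₁ a₂ : R} (h : QRelB2 v (X : R) Y a₁ a₂)
    (hv : v ≠ 0) {n : ℤ}
    {p : k} (hp : p ≠ 0) (hn : v ^ n = p) (t : R) :
    ((X ^ n : Rˣ) : R) * (X * (Y * t)) =
      qB2Coeff1 v p (X : R) Y a₁ * (↑(X ^ n) * t) := by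
  simp only [mul_add (R := R), add_mul (R := R), smul_mul_assoc, mul_smul_comm, mul_assoc,
    smul_add, smul_smul, qB2Coeff1, zpow_mul_self_mul, Units.mul_inv_cancel_left,
      Units.inv_mul_cancel_left, h.mul_left, h.inv_x hv, h.zpow_x hv _ hn]
  match_scalars <;> field_simp <;> ring

theorem QRelB2.coeff2_spec {v : k} {X Y : Rˣ} {a₁ a₂ : R} (h : QRelB2 v (X : R) Y a₁ a₂)
    (hv : v ≠ 0) {n : ℤ}
    {m p : k} (hm : m ≠ 0) (hp : p ≠ 0) (hn : v ^ n = m) (t : R) :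
    ((Y ^ n : Rˣ) : R) * (Y * (qB2Coeff1 v p (X : R) Y a₁ * t)) =
      qB2Coeff2 v m p (X : R) Y a₁ a₂ * (↑(Y ^ n) * t) := by
  simp only [mul_add (R := R), add_mul (R := R), smul_mul_assoc, mul_smul_comm, mul_assoc,
    smul_add, smul_smul, qB2Coeff1, qB2Coeff2, zpow_mul_self_mul, Units.mul_inv_cancel_left,
      Units.inv_mul_cancel_left, h.mul_left, h.zpow_y hv _ hn]
  match_scalars <;> field_simp <;> ring

/-- The exponent r + s of X occurs in both words, so p stays fixed. Conjugation by X^r only has to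
trade v^{2r+s} for v^s, the exponents of Y met last in the two words. -/
theorem QRelB2.coeff2_symm {v : k} {X Y : Rˣ} {a₁ a₂ : R} (h : QRelB2 v (X : R) Y a₁ a₂)
    (hv : v ≠ 0) {n : ℤ}
    {r s : k} (hr : r ≠ 0) (hs : s ≠ 0) (hn : v ^ n = r) (t : R) :
    ((X ^ n : Rˣ) : R) * (qB2Coeff2 v (r ^ 2 * s) (r * s) (X : R) Y a₁ a₂ * t) =
      qB2Coeff2 v s (r * s) (X : R) Y a₁ a₂ * (↑(X ^ n) * t) := by
  simp only [mul_add (R := R), add_mul (R := R), smul_mul_assoc, mul_smul_comm, mul_assoc,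
    smul_add, smul_smul, qB2Coeff2, zpow_mul_self_mul, Units.mul_inv_cancel_left,
      Units.inv_mul_cancel_left, h.mul_left, h.inv_x hv, h.zpow_x hv _ hn]
  match_scalars <;> field_simp <;> ring

theorem QRelB2.verma {v : k} {X Y : Rˣ} {a₁ a₂ : R} (h : QRelB2 v (X : R) Y a₁ a₂) (hv : v ≠ 0)
    (r s : ℤ) : X ^ r * Y ^ (2 * r + s) * X ^ (r + s) * Y ^ s =
      Y ^ s * X ^ (r + s) * Y ^ (2 * r + s) * X ^ r := by
  refine units_eq_of_succ_eq_mul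
    (f := fun s => X ^ r * Y ^ (2 * r + s) * X ^ (r + s) * Y ^ s)
    (g := fun s => Y ^ s * X ^ (r + s) * Y ^ (2 * r + s) * X ^ r)
    (fun s => qB2Coeff2 v (v ^ s) (v ^ r * v ^ s) (X : R) Y a₁ a₂) (fun s => ?_) (fun s => ?_) ?_ s
  all_goals
    have hr : v ^ r ≠ 0 := zpow_ne_zero _ hv
    have hs : v ^ s ≠ 0 := zpow_ne_zero _ hv
    have hm := mul_ne_zero (pow_ne_zero 2 hr) hs
    have hp := mul_ne_zero hr hs
    have e1 : v ^ (r + s) = v ^ r * v ^ s := zpow_add₀ hv _ _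
    have e2 : v ^ (2 * r + s) = (v ^ r) ^ 2 * v ^ s := by
      rw [zpow_add₀ hv, mul_comm 2 r, zpow_mul, zpow_ofNat]
    have hY : ∀ n : ℤ, Y ^ (n + 1) = Y * Y ^ n := fun n => by rw [add_comm, zpow_one_add]
  · simp only [← add_assoc, zpow_add_one _ (r + s), zpow_add_one _ (2 * r + s), hY s,
      Units.val_mul, mul_assoc]
    rw [h.coeff1_spec hv hp e1, h.coeff2_spec hv hm hp e2, h.coeff2_symm hv hr hs rfl]
  · simp only [← add_assoc, zpow_add_one Y s, zpow_add_one _ (r + s), hY (2 * r + s),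
      Units.val_mul, mul_assoc]
    rw [h.coeff1_spec hv hp e1, h.coeff2_spec hv hs hp rfl]
  · simp [mul_assoc]

end B2

/-! ### Undeformed analogues, where exponents enter additively. -/

/-- `∑ c m ^ a p ^ b` over the listed `(c, a, b)`. -/
def intPoly {k : Type*} [Field k] (m p : k) : List (ℤ × ℕ × ℕ) → k
  | [] => 0
  | (c, a, b) :: l => c * (m ^ a * p ^ b) + intPoly m p l

/-- Undeformed conjugation formulas are polynomial in n, so the step is T ↦ T + 1 instead of T ↦ vT.
-/
theorem units_zpow_mul_mul_eq_of_add {k R : Type*} [Field k] [Ring R] (X : Rˣ) {f : k → R} {a : R}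
    (ha : f 0 = a) (h : ∀ T t, (X : R) * (f T * t) = f (T + 1) * (X * t)) {n : ℤ} (T : k)
    (hT : (n : k) = T) (t : R) :
    ((X ^ n : Rˣ) : R) * (a * t) = f T * (((X ^ n : Rˣ) : R) * t) := by
  have h' : ∀ n : ℤ, (X : R) * f n = f (n + 1 : ℤ) * X := fun n => by
    simpa using h n 1
  have := units_zpow_mul_eq X (fun n => f n) h' n
  simp only [Int.cast_zero, ha, hT] at this
  rw [← mul_assoc, this, mul_assoc]

/-! ### The Verma identity for the Lie relations of type A₂. -/

section A2

variable {k R : Type*} [Field k] [Ring R] [Algebra k R]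

/-- Commutation relations between root vectors of the nilpotent Lie algebra of type `A₂`. -/
structure RelA2 (k : Type*) {R : Type*} [Field k] [Ring R] [Algebra k R] (x y a₁ : R) : Prop where
  xy : x * y = y * x + a₁
  xa₁ : x * a₁ = a₁ * x
  a₁y : a₁ * y = y * a₁

theorem exists_relA2 {x y : R} (hx : (fun u => x * u - u * x)^[2] y = 0)
    (hy : (fun u => y * u - u * y)^[2] x = 0) : ∃ a₁ : R, RelA2 k x y a₁ := by
  simp only [Function.iterate_succ, Function.iterate_zero, Function.comp, id] at hx hy
  refine ⟨x * y - y * x, by abel, sub_eq_zero.mp hx, ?_⟩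
  rw [← sub_eq_zero, ← hy]
  noncomm_ring

theorem RelA2.mul_left {x y a₁ : R} (h : RelA2 k x y a₁) (t : R) :
    x * (y * t) = (y * x + a₁) * t ∧
    x * (a₁ * t) = (a₁ * x) * t ∧
    a₁ * (y * t) = (y * a₁) * t := by
  simp only [← mul_assoc, h.xy, h.xa₁, h.a₁y, and_self]

theorem RelA2.zpow_x {X Y : Rˣ} {a₁ : R} (h : RelA2 k (X : R) Y a₁) {n : ℤ} (T : k)
    (hT : (n : k) = T) (t : R) :
    ((X ^ n : Rˣ) : R) * (↑Y * t) = (T • (a₁ * ↑X⁻¹) + ↑Y) * (↑(X ^ n) * t) ∧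
    ((X ^ n : Rˣ) : R) * (a₁ * t) = (a₁) * (↑(X ^ n) * t) := by
  refine ⟨?_, ?_⟩ <;>
  revert T t <;> refine units_zpow_mul_mul_eq_of_add X ?_ (fun T t => ?_) <;>
  (try simp only [mul_add (R := R), add_mul (R := R), smul_mul_assoc, mul_smul_comm, mul_assoc,
    smul_add, smul_smul, Units.mul_inv_cancel_left, Units.inv_mul_cancel_left, h.mul_left]) <;>
  match_scalars <;> ring

theorem RelA2.zpow_y {X Y : Rˣ} {a₁ : R} (h : RelA2 k (X : R) Y a₁) {n : ℤ} (T : k)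
    (hT : (n : k) = T) (t : R) :
    ((Y ^ n : Rˣ) : R) * (↑X * t) = (-T • (↑Y⁻¹ * a₁) + ↑X) * (↑(Y ^ n) * t) ∧
    ((Y ^ n : Rˣ) : R) * (a₁ * t) = (a₁) * (↑(Y ^ n) * t) := by
  refine ⟨?_, ?_⟩ <;>
  revert T t <;> refine units_zpow_mul_mul_eq_of_add Y ?_ (fun T t => ?_) <;>
  (try simp only [mul_add (R := R), add_mul (R := R), smul_mul_assoc, mul_smul_comm, mul_assoc,
    smul_add, smul_smul, Units.mul_inv_cancel_left, Units.inv_mul_cancel_left, h.mul_left]) <;>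
  match_scalars <;> ring

def coeffA2 (m : k) (x y a₁ : R) : R :=
  y * x +
  -m • a₁

theorem RelA2.coeff_spec {X Y : Rˣ} {a₁ : R} (h : RelA2 k (X : R) Y a₁) {n : ℤ}
    {m : k} (hn : (n : k) = m) (t : R) :
    ((Y ^ n : Rˣ) : R) * (Y * (X * t)) =
      coeffA2 m (X : R) Y a₁ * (↑(Y ^ n) * t) := by
  simp only [mul_add (R := R), add_mul (R := R), smul_mul_assoc, mul_smul_comm, mul_assoc,
    smul_add, smul_smul, coeffA2, zpow_mul_self_mul, Units.mul_inv_cancel_left,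
      Units.inv_mul_cancel_left, h.mul_left, h.zpow_y _ hn]
  match_scalars <;> (try simp only [intPoly]) <;> ring

theorem RelA2.coeff_symm {X Y : Rˣ} {a₁ : R} (h : RelA2 k (X : R) Y a₁) {n : ℤ}
    {r s : k} (hn : (n : k) = r) (t : R) :
    ((X ^ n : Rˣ) : R) * (coeffA2 (r + s) (X : R) Y a₁ * t) =
      coeffA2 s (X : R) Y a₁ * (↑(X ^ n) * t) := by
  simp only [mul_add (R := R), add_mul (R := R), smul_mul_assoc, mul_smul_comm, mul_assoc,
    smul_add, smul_smul, coeffA2, zpow_mul_self_mul, Units.mul_inv_cancel_left,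
      Units.inv_mul_cancel_left, h.mul_left, h.zpow_x _ hn]
  match_scalars <;> (try simp only [intPoly]) <;> ring

theorem RelA2.verma {X Y : Rˣ} {a₁ : R} (h : RelA2 k (X : R) Y a₁) (r s : ℤ) :
    X ^ r * Y ^ (r + s) * X ^ s = Y ^ s * X ^ (r + s) * Y ^ r := by
  refine units_eq_of_succ_eq_mul
    (f := fun s => X ^ r * Y ^ (r + s) * X ^ s) (g := fun s => Y ^ s * X ^ (r + s) * Y ^ r)
    (fun s => coeffA2 (s : k) (X : R) Y a₁) (fun s => ?_) (fun s => ?_) ?_ s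
  all_goals
    have hX : ∀ n : ℤ, X ^ (n + 1) = X * X ^ n := fun n => by rw [add_comm, zpow_one_add]
  · simp only [← add_assoc, zpow_add_one _ (r + s), hX s, Units.val_mul, mul_assoc]
    rw [h.coeff_spec (Int.cast_add r s), h.coeff_symm rfl]
  · simp only [← add_assoc, zpow_add_one Y s, hX (r + s), Units.val_mul, mul_assoc]
    rw [h.coeff_spec rfl]
  · simp

end A2

/-! ### The Verma identity for the Lie relations of type B₂. -/

section B2

variable {k R : Type*} [Field k] [Ring R] [Algebra k R]

/-- Commutation relations between root vectors of the nilpotent Lie algebra of type `B₂`, with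
`x` the long and `y` the short simple root vector. -/
structure RelB2 (k : Type*) {R : Type*} [Field k] [Ring R] [Algebra k R]
    (x y a₁ a₂ : R) : Prop where
  xy : x * y = y * x + a₁
  xa₁ : x * a₁ = a₁ * x
  xa₂ : x * a₂ = a₂ * x
  a₁y : a₁ * y = y * a₁ + (2 : k) • a₂
  a₁a₂ : a₁ * a₂ = a₂ * a₁
  a₂y : a₂ * y = y * a₂

/-- Same overlaps as in the deformed case. Characteristic zero permits the division by 2 that
normalizes a₂. -/
theorem exists_relB2 [CharZero k] {x y : R} (hx : (fun u => x * u - u * x)^[2] y = 0)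
    (hy : (fun u => y * u - u * y)^[3] x = 0) : ∃ a₁ a₂ : R, RelB2 k x y a₁ a₂ := by
  simp only [Function.iterate_succ, Function.iterate_zero, Function.comp, id] at hx hy
  obtain ⟨a₁, w1⟩ : ∃ a₁ : R, a₁ = x * y - y * x := ⟨_, rfl⟩
  obtain ⟨a₂, w2⟩ : ∃ a₂ : R, (2 : k) • a₂ = a₁ * y - y * a₁ :=
    ⟨_, smul_inv_smul_eq two_ne_zero _⟩
  have xy : x * y = y * x + a₁ := by rw [w1]; abel
  have a₁y : a₁ * y = y * a₁ + (2 : k) • a₂ := by rw [w2]; abel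
  have xa₁ : x * a₁ = a₁ * x := by rw [w1]; exact sub_eq_zero.mp hx
  have a₂y : a₂ * y = y * a₂ := by
    refine smul_left_cancel_of_ne_zero (two_ne_zero (α := k)) ?_
    rw [← smul_mul_assoc, ← mul_smul_comm, w2, w1, ← sub_eq_zero, ← neg_eq_zero, ← hy]
    noncomm_ring
  have xa₂ : x * a₂ = a₂ * x := by
    have e := mul_assoc x a₁ y
    rw [a₁y, xa₁] at e
    simp only [mul_add, add_mul, mul_smul_comm, smul_mul_assoc, mul_assoc, xy, a₁y, xa₁,
      mul_mul_eq_of_mul_eq xy, mul_mul_eq_of_mul_eq a₁y] at e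
    refine smul_left_cancel_of_ne_zero (two_ne_zero (α := k)) ?_
    linear_combination (norm := skip) -e
    match_scalars <;> ring
  have a₁a₂ : a₁ * a₂ = a₂ * a₁ := by
    have e := mul_assoc x a₂ y
    rw [a₂y, xa₂] at e
    simp only [mul_add, add_mul, mul_smul_comm, smul_mul_assoc, mul_assoc, xy, a₂y, xa₂,
      mul_mul_eq_of_mul_eq xy, mul_mul_eq_of_mul_eq a₂y] at e
    exact (add_left_cancel e).symm
  exact ⟨a₁, a₂, xy, xa₁, xa₂, a₁y, a₁a₂, a₂y⟩

theorem RelB2.mul_left {x y a₁ a₂ : R} (h : RelB2 k x y a₁ a₂) (t : R) :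
    x * (y * t) = (y * x + a₁) * t ∧
    x * (a₁ * t) = (a₁ * x) * t ∧
    x * (a₂ * t) = (a₂ * x) * t ∧
    a₁ * (y * t) = (y * a₁ + (2 : k) • a₂) * t ∧
    a₁ * (a₂ * t) = (a₂ * a₁) * t ∧
    a₂ * (y * t) = (y * a₂) * t := by
  simp only [← mul_assoc, h.xy, h.xa₁, h.xa₂, h.a₁y, h.a₁a₂, h.a₂y, and_self]

theorem RelB2.inv_x {X Y : Rˣ} {a₁ a₂ : R} (h : RelB2 k (X : R) Y a₁ a₂) (t : R) :
    ↑X⁻¹ * (↑Y * t) = (-1 : k) • (a₁ * (↑X⁻¹ * (↑X⁻¹ * t))) + ↑Y * (↑X⁻¹ * t) ∧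
    ↑X⁻¹ * (a₁ * t) = a₁ * (↑X⁻¹ * t) ∧
    ↑X⁻¹ * (a₂ * t) = a₂ * (↑X⁻¹ * t) := by
  refine ⟨?_, ?_, ?_⟩ <;> apply X.isUnit.mul_left_cancel <;> rw [Units.mul_inv_cancel_left] <;>
  simp only [mul_add (R := R), add_mul (R := R), smul_mul_assoc, mul_smul_comm, mul_assoc,
    smul_add, smul_smul, Units.mul_inv_cancel_left, Units.inv_mul_cancel_left, h.mul_left] <;>
  match_scalars <;> ring

theorem RelB2.zpow_x {X Y : Rˣ} {a₁ a₂ : R} (h : RelB2 k (X : R) Y a₁ a₂) {n : ℤ} (T : k)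
    (hT : (n : k) = T) (t : R) :
    ((X ^ n : Rˣ) : R) * (↑Y * t) = (T • (a₁ * ↑X⁻¹) + ↑Y) * (↑(X ^ n) * t) ∧
    ((X ^ n : Rˣ) : R) * (a₁ * t) = (a₁) * (↑(X ^ n) * t) ∧
    ((X ^ n : Rˣ) : R) * (a₂ * t) = (a₂) * (↑(X ^ n) * t) := by
  refine ⟨?_, ?_, ?_⟩ <;>
  revert T t <;> refine units_zpow_mul_mul_eq_of_add X ?_ (fun T t => ?_) <;>
  (try simp only [mul_add (R := R), add_mul (R := R), smul_mul_assoc, mul_smul_comm, mul_assoc,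
    smul_add, smul_smul, Units.mul_inv_cancel_left, Units.inv_mul_cancel_left, h.mul_left]) <;>
  match_scalars <;> ring

theorem RelB2.zpow_y {X Y : Rˣ} {a₁ a₂ : R} (h : RelB2 k (X : R) Y a₁ a₂) {n : ℤ} (T : k)
    (hT : (n : k) = T) (t : R) :
    ((Y ^ n : Rˣ) : R) * (↑X * t) = ((T + T ^ 2) • (↑Y⁻¹ * (↑Y⁻¹ * a₂)) + -T • (↑Y⁻¹ * a₁) +
      ↑X) * (↑(Y ^ n) * t) ∧
    ((Y ^ n : Rˣ) : R) * (a₁ * t) = ((-2 * T) • (↑Y⁻¹ * a₂) + a₁) * (↑(Y ^ n) * t) ∧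
    ((Y ^ n : Rˣ) : R) * (a₂ * t) = (a₂) * (↑(Y ^ n) * t) := by
  refine ⟨?_, ?_, ?_⟩ <;>
  revert T t <;> refine units_zpow_mul_mul_eq_of_add Y ?_ (fun T t => ?_) <;>
  (try simp only [mul_add (R := R), add_mul (R := R), smul_mul_assoc, mul_smul_comm, mul_assoc,
    smul_add, smul_smul, Units.mul_inv_cancel_left, Units.inv_mul_cancel_left, h.mul_left]) <;>
  match_scalars <;> ring

def coeffB2_1 (p : k) (x y a₁ : R) : R :=
  y * x +
  (1 +
  p) • a₁

def coeffB2_2 (m p : k) (x y a₁ a₂ : R) : R :=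
  y * (y * x) +
  (1 +
  p - m) • (y * a₁) +
  (-m - 2 * m * p +
  m ^ 2) • a₂

theorem RelB2.coeff1_spec {X Y : Rˣ} {a₁ a₂ : R} (h : RelB2 k (X : R) Y a₁ a₂) {n : ℤ}
    {p : k} (hn : (n : k) = p) (t : R) :
    ((X ^ n : Rˣ) : R) * (X * (Y * t)) =
      coeffB2_1 p (X : R) Y a₁ * (↑(X ^ n) * t) := by
  simp only [mul_add (R := R), add_mul (R := R), smul_mul_assoc, mul_smul_comm, mul_assoc,
    smul_add, smul_smul, coeffB2_1, zpow_mul_self_mul, Units.mul_inv_cancel_left,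
      Units.inv_mul_cancel_left, h.mul_left, h.inv_x, h.zpow_x _ hn]
  match_scalars <;> (try simp only [intPoly]) <;> ring

theorem RelB2.coeff2_spec {X Y : Rˣ} {a₁ a₂ : R} (h : RelB2 k (X : R) Y a₁ a₂) {n : ℤ}
    {m p : k} (hn : (n : k) = m) (t : R) :
    ((Y ^ n : Rˣ) : R) * (Y * (coeffB2_1 p (X : R) Y a₁ * t)) =
      coeffB2_2 m p (X : R) Y a₁ a₂ * (↑(Y ^ n) * t) := by
  simp only [mul_add (R := R), add_mul (R := R), smul_mul_assoc, mul_smul_comm, mul_assoc,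
    smul_add, smul_smul, coeffB2_1, coeffB2_2, zpow_mul_self_mul, Units.mul_inv_cancel_left,
      Units.inv_mul_cancel_left, h.mul_left, h.zpow_y _ hn]
  match_scalars <;> (try simp only [intPoly]) <;> ring

theorem RelB2.coeff2_symm {X Y : Rˣ} {a₁ a₂ : R} (h : RelB2 k (X : R) Y a₁ a₂) {n : ℤ}
    {r s : k} (hn : (n : k) = r) (t : R) :
    ((X ^ n : Rˣ) : R) * (coeffB2_2 (2 * r + s) (r + s) (X : R) Y a₁ a₂ * t) =
      coeffB2_2 s (r + s) (X : R) Y a₁ a₂ * (↑(X ^ n) * t) := by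
  simp only [mul_add (R := R), add_mul (R := R), smul_mul_assoc, mul_smul_comm, mul_assoc,
    smul_add, smul_smul, coeffB2_2, zpow_mul_self_mul, Units.mul_inv_cancel_left,
      Units.inv_mul_cancel_left, h.mul_left, h.inv_x, h.zpow_x _ hn]
  match_scalars <;> (try simp only [intPoly]) <;> ring

theorem RelB2.verma {X Y : Rˣ} {a₁ a₂ : R} (h : RelB2 k (X : R) Y a₁ a₂) (r s : ℤ) :
    X ^ r * Y ^ (2 * r + s) * X ^ (r + s) * Y ^ s =
      Y ^ s * X ^ (r + s) * Y ^ (2 * r + s) * X ^ r := by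
  refine units_eq_of_succ_eq_mul
    (f := fun s => X ^ r * Y ^ (2 * r + s) * X ^ (r + s) * Y ^ s)
    (g := fun s => Y ^ s * X ^ (r + s) * Y ^ (2 * r + s) * X ^ r)
    (fun s => coeffB2_2 (s : k) (r + s) (X : R) Y a₁ a₂) (fun s => ?_) (fun s => ?_) ?_ s
  all_goals
    have e1 : ((r + s : ℤ) : k) = r + s := Int.cast_add r s
    have e2 : ((2 * r + s : ℤ) : k) = 2 * r + s := by push_cast; rfl
    have hY : ∀ n : ℤ, Y ^ (n + 1) = Y * Y ^ n := fun n => by rw [add_comm, zpow_one_add]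
  · simp only [← add_assoc, zpow_add_one _ (r + s), zpow_add_one _ (2 * r + s), hY s,
      Units.val_mul, mul_assoc]
    rw [h.coeff1_spec e1, h.coeff2_spec e2, h.coeff2_symm rfl]
  · simp only [← add_assoc, zpow_add_one Y s, zpow_add_one _ (r + s), hY (2 * r + s),
      Units.val_mul, mul_assoc]
    rw [h.coeff1_spec e1, h.coeff2_spec rfl]
  · simp [mul_assoc]

end B2

/-! ### The Verma identity for the Lie relations of type G₂. -/

section G2

variable {k R : Type*} [Field k] [Ring R] [Algebra k R]

/-- Commutation relations between root vectors of the nilpotent Lie algebra of type `G₂`, with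
`x` the long and `y` the short simple root vector. -/
structure RelG2 (k : Type*) {R : Type*} [Field k] [Ring R] [Algebra k R]
    (x y a₁ a₂ a₃ b : R) : Prop where
  xy : x * y = y * x + a₁
  xa₁ : x * a₁ = a₁ * x
  xa₂ : x * a₂ = a₂ * x
  xa₃ : x * a₃ = a₃ * x + (-1 : k) • b
  xb : x * b = b * x
  a₁y : a₁ * y = y * a₁ + (2 : k) • a₂
  a₁a₂ : a₁ * a₂ = a₂ * a₁ + (3 : k) • b
  a₁a₃ : a₁ * a₃ = a₃ * a₁
  a₁b : a₁ * b = b * a₁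
  a₂y : a₂ * y = y * a₂ + (3 : k) • a₃
  a₂a₃ : a₂ * a₃ = a₃ * a₂
  a₂b : a₂ * b = b * a₂
  a₃y : a₃ * y = y * a₃
  ba₃ : b * a₃ = a₃ * b
  yb : b * y = y * b

/-- The root vectors are normalized by dividing commutators by 2 and 3. The Serre relations give the
extreme rules, and associativity of triple products gives all the others. -/
theorem exists_relG2 [CharZero k] {x y : R} (hx : (fun u => x * u - u * x)^[2] y = 0)
    (hy : (fun u => y * u - u * y)^[4] x = 0) : ∃ a₁ a₂ a₃ b : R, RelG2 k x y a₁ a₂ a₃ b := by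
  simp only [Function.iterate_succ, Function.iterate_zero, Function.comp, id] at hx hy
  have h2 : (2 : k) ≠ 0 := two_ne_zero
  have h3 : (3 : k) ≠ 0 := three_ne_zero
  obtain ⟨a₁, w1⟩ : ∃ a₁ : R, a₁ = x * y - y * x := ⟨_, rfl⟩
  obtain ⟨a₂, w2⟩ : ∃ a₂ : R, (2 : k) • a₂ = a₁ * y - y * a₁ := ⟨_, smul_inv_smul_eq h2 _⟩
  obtain ⟨a₃, w3⟩ : ∃ a₃ : R, (3 : k) • a₃ = a₂ * y - y * a₂ := ⟨_, smul_inv_smul_eq h3 _⟩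
  obtain ⟨b, w4⟩ : ∃ b : R, (3 : k) • b = a₁ * a₂ - a₂ * a₁ := ⟨_, smul_inv_smul_eq h3 _⟩
  have xy : x * y = y * x + a₁ := by rw [w1]; abel
  have a₁y : a₁ * y = y * a₁ + (2 : k) • a₂ := by rw [w2]; abel
  have a₂y : a₂ * y = y * a₂ + (3 : k) • a₃ := by rw [w3]; abel
  have a₁a₂ : a₁ * a₂ = a₂ * a₁ + (3 : k) • b := by rw [w4]; abel
  have xa₁ : x * a₁ = a₁ * x := by rw [w1]; exact sub_eq_zero.mp hx
  have a₃y : a₃ * y = y * a₃ := by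
    have e3 : ((2 : k) * 3) • a₃ = (2 : k) • a₂ * y - y * (2 : k) • a₂ := by
      rw [mul_smul, w3, smul_sub, smul_mul_assoc, mul_smul_comm]
    refine smul_left_cancel_of_ne_zero (mul_ne_zero h2 h3) ?_
    rw [← smul_mul_assoc, ← mul_smul_comm, e3, w2, w1, ← sub_eq_zero, ← hy]
    noncomm_ring
  have xa₂ : x * a₂ = a₂ * x := by
    have e := mul_assoc x a₁ y
    rw [a₁y, xa₁] at e
    simp only [mul_add, add_mul, mul_sub, sub_mul, smul_mul_assoc, mul_smul_comm, mul_assoc,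
      smul_add, smul_smul, xy, a₁y, xa₁, mul_mul_eq_of_mul_eq xy, mul_mul_eq_of_mul_eq a₁y,
        mul_mul_eq_of_mul_eq xa₁] at e
    refine smul_left_cancel_of_ne_zero h2 ?_
    linear_combination (norm := skip) -e
    match_scalars <;> ring
  have xa₃ : x * a₃ = a₃ * x - b := by
    have e := mul_assoc x a₂ y
    rw [a₂y, xa₂] at e
    simp only [mul_add, add_mul, mul_sub, sub_mul, smul_mul_assoc, mul_smul_comm, mul_assoc,
      smul_add, smul_smul, xy, a₁y, a₂y, xa₂, a₁a₂, mul_mul_eq_of_mul_eq xy,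
        mul_mul_eq_of_mul_eq a₁y, mul_mul_eq_of_mul_eq a₂y, mul_mul_eq_of_mul_eq xa₂,
          mul_mul_eq_of_mul_eq a₁a₂] at e
    refine smul_left_cancel_of_ne_zero h3 ?_
    linear_combination (norm := skip) -e
    match_scalars <;> ring
  -- As in the deformed case, this relation in the unknowns a₁a₃ and by is solved together with the
  -- overlap x a₃ y.
  have e1 := mul_assoc a₁ a₂ y
  rw [a₂y, a₁a₂] at e1
  simp only [mul_add, add_mul, smul_mul_assoc, mul_smul_comm, mul_assoc, smul_add, smul_smul,
    a₁y, a₂y, a₁a₂, mul_mul_eq_of_mul_eq a₁y, mul_mul_eq_of_mul_eq a₂y] at e1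
  have a₁a₃ : a₁ * a₃ = a₃ * a₁ := by
    have e := mul_assoc x a₃ y
    rw [a₃y, xa₃] at e
    simp only [mul_add, add_mul, mul_sub, sub_mul, smul_mul_assoc, mul_smul_comm, mul_assoc,
      smul_add, smul_smul, xy, a₃y, xa₃, mul_mul_eq_of_mul_eq xy, mul_mul_eq_of_mul_eq a₃y,
        mul_mul_eq_of_mul_eq xa₃] at e
    refine smul_left_cancel_of_ne_zero (mul_ne_zero h2 h3) ?_
    linear_combination (norm := skip) -e1 - (3 : k) • e
    match_scalars <;> ring
  have yb : b * y = y * b := by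
    refine smul_left_cancel_of_ne_zero h3 ?_
    rw [a₁a₃] at e1
    linear_combination (norm := skip) e1
    match_scalars <;> ring
  have xb : x * b = b * x := by
    have e := mul_assoc x a₁ a₂
    rw [a₁a₂, xa₁] at e
    simp only [mul_add, add_mul, mul_sub, sub_mul, smul_mul_assoc, mul_smul_comm, mul_assoc,
      smul_add, smul_smul, xa₁, xa₂, a₁a₂, mul_mul_eq_of_mul_eq xa₁, mul_mul_eq_of_mul_eq xa₂,
        mul_mul_eq_of_mul_eq a₁a₂] at e
    refine smul_left_cancel_of_ne_zero h3 ?_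
    linear_combination (norm := skip) -e
    match_scalars <;> ring
  have a₁b : a₁ * b = b * a₁ := by
    have e := mul_assoc x a₁ a₃
    rw [a₁a₃, xa₁] at e
    simp only [mul_add, add_mul, mul_sub, sub_mul, smul_mul_assoc, mul_smul_comm, mul_assoc,
      smul_add, smul_smul, xa₁, xa₃, a₁a₃, mul_mul_eq_of_mul_eq xa₁, mul_mul_eq_of_mul_eq xa₃,
        mul_mul_eq_of_mul_eq a₁a₃] at e
    refine smul_left_cancel_of_ne_zero (one_ne_zero (α := k)) ?_
    linear_combination (norm := skip) -e
    match_scalars <;> ring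
  have a₂a₃ : a₂ * a₃ = a₃ * a₂ := by
    have e := mul_assoc a₁ a₃ y
    rw [a₃y, a₁a₃] at e
    simp only [mul_add, add_mul, mul_sub, sub_mul, smul_mul_assoc, mul_smul_comm, mul_assoc,
      smul_add, smul_smul, a₁y, a₃y, a₁a₃, mul_mul_eq_of_mul_eq a₁y, mul_mul_eq_of_mul_eq a₃y,
        mul_mul_eq_of_mul_eq a₁a₃] at e
    refine smul_left_cancel_of_ne_zero h2 ?_
    linear_combination (norm := skip) -e
    match_scalars <;> ring
  have a₂b : a₂ * b = b * a₂ := by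
    have e := mul_assoc a₁ b y
    rw [yb, a₁b] at e
    simp only [mul_add, add_mul, mul_sub, sub_mul, smul_mul_assoc, mul_smul_comm, mul_assoc,
      smul_add, smul_smul, a₁y, yb, a₁b, mul_mul_eq_of_mul_eq a₁y, mul_mul_eq_of_mul_eq yb,
        mul_mul_eq_of_mul_eq a₁b] at e
    refine smul_left_cancel_of_ne_zero h2 ?_
    linear_combination (norm := skip) -e
    match_scalars <;> ring
  have ba₃ : b * a₃ = a₃ * b := by
    have e := mul_assoc a₂ b y
    rw [yb, a₂b] at e
    simp only [mul_add, add_mul, mul_sub, sub_mul, smul_mul_assoc, mul_smul_comm, mul_assoc,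
      smul_add, smul_smul, a₂y, yb, a₂b, mul_mul_eq_of_mul_eq a₂y, mul_mul_eq_of_mul_eq yb,
        mul_mul_eq_of_mul_eq a₂b] at e
    refine smul_left_cancel_of_ne_zero h3 ?_
    linear_combination (norm := skip) e
    match_scalars <;> ring
  exact ⟨a₁, a₂, a₃, b, xy, xa₁, xa₂, by rw [xa₃, neg_smul, one_smul, sub_eq_add_neg], xb, a₁y,
    a₁a₂, a₁a₃, a₁b, a₂y, a₂a₃, a₂b, a₃y, ba₃, yb⟩

theorem RelG2.mul_left {x y a₁ a₂ a₃ b : R} (h : RelG2 k x y a₁ a₂ a₃ b) (t : R) :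
    x * (y * t) = (y * x + a₁) * t ∧
    x * (a₁ * t) = (a₁ * x) * t ∧
    x * (a₂ * t) = (a₂ * x) * t ∧
    x * (a₃ * t) = (a₃ * x + (-1 : k) • b) * t ∧
    x * (b * t) = (b * x) * t ∧
    a₁ * (y * t) = (y * a₁ + (2 : k) • a₂) * t ∧
    a₁ * (a₂ * t) = (a₂ * a₁ + (3 : k) • b) * t ∧
    a₁ * (a₃ * t) = (a₃ * a₁) * t ∧
    a₁ * (b * t) = (b * a₁) * t ∧
    a₂ * (y * t) = (y * a₂ + (3 : k) • a₃) * t ∧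
    a₂ * (a₃ * t) = (a₃ * a₂) * t ∧
    a₂ * (b * t) = (b * a₂) * t ∧
    a₃ * (y * t) = (y * a₃) * t ∧
    b * (a₃ * t) = (a₃ * b) * t ∧
    b * (y * t) = (y * b) * t := by
  simp only [← mul_assoc, h.xy, h.xa₁, h.xa₂, h.xa₃, h.xb, h.a₁y, h.a₁a₂, h.a₁a₃, h.a₁b, h.a₂y,
    h.a₂a₃, h.a₂b, h.a₃y, h.ba₃, h.yb, and_self]

theorem RelG2.inv_y {X Y : Rˣ} {a₁ a₂ a₃ b : R} (h : RelG2 k (X : R) Y a₁ a₂ a₃ b) (t : R) :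
    ↑X * (↑Y⁻¹ * t) = (-6 : k) • (↑Y⁻¹ * (↑Y⁻¹ * (↑Y⁻¹ * (↑Y⁻¹ * (a₃ * t))))) + (2 :
      k) • (↑Y⁻¹ * (↑Y⁻¹ * (↑Y⁻¹ * (a₂ * t)))) + (-1 : k) • (↑Y⁻¹ * (↑Y⁻¹ * (a₁ * t))) +
      ↑Y⁻¹ * (↑X * t) ∧
    a₁ * (↑Y⁻¹ * t) = (6 : k) • (↑Y⁻¹ * (↑Y⁻¹ * (↑Y⁻¹ * (a₃ * t)))) + (-2 :
      k) • (↑Y⁻¹ * (↑Y⁻¹ * (a₂ * t))) + ↑Y⁻¹ * (a₁ * t) ∧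
    a₂ * (↑Y⁻¹ * t) = (-3 : k) • (↑Y⁻¹ * (↑Y⁻¹ * (a₃ * t))) + ↑Y⁻¹ * (a₂ * t) ∧
    a₃ * (↑Y⁻¹ * t) = ↑Y⁻¹ * (a₃ * t) ∧
    b * (↑Y⁻¹ * t) = ↑Y⁻¹ * (b * t) := by
  obtain ⟨t, rfl⟩ : ∃ s, t = Y * s := ⟨↑Y⁻¹ * t, by simp⟩
  refine ⟨?_, ?_, ?_, ?_, ?_⟩ <;>
  simp only [mul_add (R := R), add_mul (R := R), smul_mul_assoc, mul_smul_comm, mul_assoc,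
    smul_add, smul_smul, Units.mul_inv_cancel_left, Units.inv_mul_cancel_left, h.mul_left] <;>
  match_scalars <;> ring

theorem RelG2.inv_x {X Y : Rˣ} {a₁ a₂ a₃ b : R} (h : RelG2 k (X : R) Y a₁ a₂ a₃ b) (t : R) :
    ↑X⁻¹ * (↑Y * t) = (-1 : k) • (a₁ * (↑X⁻¹ * (↑X⁻¹ * t))) + ↑Y * (↑X⁻¹ * t) ∧
    ↑X⁻¹ * (a₁ * t) = a₁ * (↑X⁻¹ * t) ∧
    ↑X⁻¹ * (a₂ * t) = a₂ * (↑X⁻¹ * t) ∧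
    ↑X⁻¹ * (a₃ * t) = b * (↑X⁻¹ * (↑X⁻¹ * t)) + a₃ * (↑X⁻¹ * t) ∧
    ↑X⁻¹ * (b * t) = b * (↑X⁻¹ * t) := by
  refine ⟨?_, ?_, ?_, ?_, ?_⟩ <;> apply X.isUnit.mul_left_cancel <;>
  rw [Units.mul_inv_cancel_left] <;>
  simp only [mul_add (R := R), add_mul (R := R), smul_mul_assoc, mul_smul_comm, mul_assoc,
    smul_add, smul_smul, Units.mul_inv_cancel_left, Units.inv_mul_cancel_left, h.mul_left] <;>
  match_scalars <;> ring

theorem RelG2.zpow_x {X Y : Rˣ} {a₁ a₂ a₃ b : R} (h : RelG2 k (X : R) Y a₁ a₂ a₃ b) {n : ℤ} (T : k)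
    (hT : (n : k) = T) (t : R) :
    ((X ^ n : Rˣ) : R) * (↑Y * t) = (T • (a₁ * ↑X⁻¹) + ↑Y) * (↑(X ^ n) * t) ∧
    ((X ^ n : Rˣ) : R) * (a₁ * t) = (a₁) * (↑(X ^ n) * t) ∧
    ((X ^ n : Rˣ) : R) * (a₂ * t) = (a₂) * (↑(X ^ n) * t) ∧
    ((X ^ n : Rˣ) : R) * (a₃ * t) = (-T • (b * ↑X⁻¹) + a₃) * (↑(X ^ n) * t) ∧
    ((X ^ n : Rˣ) : R) * (b * t) = (b) * (↑(X ^ n) * t) := by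
  refine ⟨?_, ?_, ?_, ?_, ?_⟩ <;>
  revert T t <;> refine units_zpow_mul_mul_eq_of_add X ?_ (fun T t => ?_) <;>
  (try simp only [mul_add (R := R), add_mul (R := R), smul_mul_assoc, mul_smul_comm, mul_assoc,
    smul_add, smul_smul, Units.mul_inv_cancel_left, Units.inv_mul_cancel_left, h.mul_left]) <;>
  match_scalars <;> ring

theorem RelG2.zpow_y {X Y : Rˣ} {a₁ a₂ a₃ b : R} (h : RelG2 k (X : R) Y a₁ a₂ a₃ b) {n : ℤ} (T : k)
    (hT : (n : k) = T) (t : R) :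
    ((Y ^ n : Rˣ) : R) * (↑X * t) = ((-2 * T - 3 * T ^ 2 - T ^ 3) • (↑Y⁻¹ * (↑Y⁻¹ * (↑Y⁻¹ * a₃))) +
      (T + T ^ 2) • (↑Y⁻¹ * (↑Y⁻¹ * a₂)) + -T • (↑Y⁻¹ * a₁) + ↑X) * (↑(Y ^ n) * t) ∧
    ((Y ^ n : Rˣ) : R) * (a₁ * t) = ((3 * T + 3 * T ^ 2) • (↑Y⁻¹ * (↑Y⁻¹ * a₃)) +
      (-2 * T) • (↑Y⁻¹ * a₂) + a₁) * (↑(Y ^ n) * t) ∧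
    ((Y ^ n : Rˣ) : R) * (a₂ * t) = ((-3 * T) • (↑Y⁻¹ * a₃) + a₂) * (↑(Y ^ n) * t) ∧
    ((Y ^ n : Rˣ) : R) * (a₃ * t) = (a₃) * (↑(Y ^ n) * t) ∧
    ((Y ^ n : Rˣ) : R) * (b * t) = (b) * (↑(Y ^ n) * t) := by
  refine ⟨?_, ?_, ?_, ?_, ?_⟩ <;>
  revert T t <;> refine units_zpow_mul_mul_eq_of_add Y ?_ (fun T t => ?_) <;>
  (try simp only [mul_add (R := R), add_mul (R := R), smul_mul_assoc, mul_smul_comm, mul_assoc,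
    smul_add, smul_smul, Units.mul_inv_cancel_left, Units.inv_mul_cancel_left, h.mul_left,
      h.inv_y]) <;>
  match_scalars <;> ring

def coeffG2_1 (p : k) (x y a₁ : R) : R :=
  y * x +
  (1 +
  p) • a₁

def coeffG2_2 (m p : k) (x y a₁ a₂ a₃ : R) : R :=
  y * (y * (y * x)) +
  (1 - m) • (y * (y * a₁)) +
  (intPoly m p [(-1, 0, 1), (-1, 0, 2), (-1, 1, 0), (1, 2, 0)]) • (y * a₂) +
  (intPoly m p [(1, 0, 1), (3, 0, 2), (2, 0, 3), (1, 1, 0), (3, 1, 1), (3, 1, 2), (-1, 3,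
    0)]) • a₃

def coeffG2_3 (m p : k) (x y a₁ a₂ a₃ b : R) : R :=
  y * (y * (y * (x * x))) +
  (4 +
  2 * m) • (y * (y * (a₁ * x))) +
  (2 +
  3 * m +
  m ^ 2) • (y * (a₁ * a₁)) +
  (intPoly m p [(6, 0, 0), (-1, 0, 1), (-1, 0, 2), (5, 1, 0), (1, 2, 0)]) • (y * (a₂ * x)) +
  (intPoly m p [(2, 0, 0), (-1, 0, 1), (-1, 0, 2), (5, 1, 0), (-1, 1, 1), (-1, 1, 2), (4, 2, 0),
    (1, 3, 0)]) • (a₂ * a₁) +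
  (intPoly m p [(6, 0, 0), (1, 0, 1), (3, 0, 2), (2, 0, 3), (7, 1, 0), (3, 1, 1), (3, 1, 2), (-1,
    3, 0)]) • (a₃ * x) +
  (intPoly m p [(-4, 0, 1), (-6, 0, 2), (-2, 0, 3), (2, 1, 0), (-7, 1, 1), (-9, 1, 2), (-2, 1,
    3), (5, 2, 0), (-3, 2, 1), (-3, 2, 2), (4, 3, 0), (1, 4, 0)]) • b

def coeffG2_4 (m p : k) (x y a₁ a₂ a₃ b : R) : R :=
  y * (y * (y * (y * (x * x)))) +
  (4 +
  2 * p - 2 * m) • (y * (y * (y * (a₁ * x)))) +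
  (intPoly m p [(2, 0, 0), (3, 0, 1), (1, 0, 2), (-3, 1, 0), (-2, 1, 1), (1, 2,
    0)]) • (y * (y * (a₁ * a₁))) +
  (intPoly m p [(6, 0, 0), (5, 0, 1), (1, 0, 2), (-7, 1, 0), (-4, 1, 1), (1, 2,
    0)]) • (y * (y * (a₂ * x))) +
  (intPoly m p [(2, 0, 0), (5, 0, 1), (4, 0, 2), (1, 0, 3), (-7, 1, 0), (-12, 1, 1), (-5, 1, 2),
    (6, 2, 0), (5, 2, 1), (-1, 3, 0)]) • (y * (a₂ * a₁)) +
  (intPoly m p [(6, 0, 0), (11, 0, 1), (6, 0, 2), (1, 0, 3), (-13, 1, 0), (-6, 1, 1), (3, 1, 2),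
    (6, 2, 0), (3, 2, 1), (1, 3, 0)]) • (y * (a₃ * x)) +
  (intPoly m p [(-1, 1, 1), (-3, 1, 2), (-2, 1, 3), (2, 2, 0), (7, 2, 1), (5, 2, 2), (-2, 3, 0),
    (-2, 3, 1)]) • (a₂ * a₂) +
  (intPoly m p [(2, 0, 1), (5, 0, 2), (4, 0, 3), (1, 0, 4), (-4, 1, 0), (-13, 1, 1), (-9, 1, 2),
    (6, 2, 0), (3, 2, 1), (-3, 2, 2), (-2, 3, 0), (-2, 3, 1)]) • (a₃ * a₁) +
  (intPoly m p [(-6, 1, 0), (-19, 1, 1), (-15, 1, 2), (-2, 1, 3), (5, 2, 0), (3, 2, 1), (-3, 2,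
    2), (1, 4, 0)]) • (y * b)

theorem RelG2.coeff1_spec {X Y : Rˣ} {a₁ a₂ a₃ b : R} (h : RelG2 k (X : R) Y a₁ a₂ a₃ b) {n : ℤ}
    {p : k} (hn : (n : k) = p) (t : R) :
    ((X ^ n : Rˣ) : R) * (X * (Y * t)) =
      coeffG2_1 p (X : R) Y a₁ * (↑(X ^ n) * t) := by
  simp only [mul_add (R := R), add_mul (R := R), smul_mul_assoc, mul_smul_comm, mul_assoc,
    smul_add, smul_smul, coeffG2_1, zpow_mul_self_mul, Units.mul_inv_cancel_left,
      Units.inv_mul_cancel_left, h.mul_left, h.inv_x, h.zpow_x _ hn]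
  match_scalars <;> (try simp only [intPoly]) <;> ring

theorem RelG2.coeff2_spec {X Y : Rˣ} {a₁ a₂ a₃ b : R} (h : RelG2 k (X : R) Y a₁ a₂ a₃ b) {n : ℤ}
    {m p : k} (hn : (n : k) = m + p) (t : R) :
    ((Y ^ n : Rˣ) : R) * (Y * (Y * (coeffG2_1 p (X : R) Y a₁ * t))) =
      coeffG2_2 m p (X : R) Y a₁ a₂ a₃ * (↑(Y ^ n) * t) := by
  simp only [mul_add (R := R), add_mul (R := R), smul_mul_assoc, mul_smul_comm, mul_assoc,
    smul_add, smul_smul, coeffG2_1, coeffG2_2, zpow_mul_self_mul, Units.mul_inv_cancel_left,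
      Units.inv_mul_cancel_left, h.mul_left, h.inv_y, h.zpow_y _ hn]
  match_scalars <;> (try simp only [intPoly]) <;> ring

theorem RelG2.coeff3_spec {X Y : Rˣ} {a₁ a₂ a₃ b : R} (h : RelG2 k (X : R) Y a₁ a₂ a₃ b) {n : ℤ}
    {m p : k} (hn : (n : k) = m) (t : R) :
    ((X ^ n : Rˣ) : R) * (X * (coeffG2_2 m p (X : R) Y a₁ a₂ a₃ * t)) =
      coeffG2_3 m p (X : R) Y a₁ a₂ a₃ b * (↑(X ^ n) * t) := by
  simp only [mul_add (R := R), add_mul (R := R), smul_mul_assoc, mul_smul_comm, mul_assoc,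
    smul_add, smul_smul, coeffG2_2, coeffG2_3, zpow_mul_self_mul, Units.mul_inv_cancel_left,
      Units.inv_mul_cancel_left, h.mul_left, h.inv_x, h.zpow_x _ hn]
  match_scalars <;> (try simp only [intPoly]) <;> ring

theorem RelG2.coeff4_spec {X Y : Rˣ} {a₁ a₂ a₃ b : R} (h : RelG2 k (X : R) Y a₁ a₂ a₃ b) {n : ℤ}
    {m p : k} (hn : (n : k) = 2 * m - p) (t : R) :
    ((Y ^ n : Rˣ) : R) * (Y * (coeffG2_3 m p (X : R) Y a₁ a₂ a₃ b * t)) =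
      coeffG2_4 m p (X : R) Y a₁ a₂ a₃ b * (↑(Y ^ n) * t) := by
  simp only [mul_add (R := R), add_mul (R := R), smul_mul_assoc, mul_smul_comm, mul_assoc,
    smul_add, smul_smul, coeffG2_3, coeffG2_4, zpow_mul_self_mul, Units.mul_inv_cancel_left,
      Units.inv_mul_cancel_left, h.mul_left, h.inv_y, h.zpow_y _ hn]
  match_scalars <;> (try simp only [intPoly]) <;> ring

/-- The two words produce multipliers with m and p exchanged; conjugation by X^r undoes the
exchange. -/
theorem RelG2.coeff4_symm {X Y : Rˣ} {a₁ a₂ a₃ b : R} (h : RelG2 k (X : R) Y a₁ a₂ a₃ b) {n : ℤ}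
    {r s : k} (hn : (n : k) = r) (t : R) :
    ((X ^ n : Rˣ) : R) * (coeffG2_4 (2 * r + s) (r + s) (X : R) Y a₁ a₂ a₃ b * t) =
      coeffG2_4 (r + s) (2 * r + s) (X : R) Y a₁ a₂ a₃ b * (↑(X ^ n) * t) := by
  simp only [mul_add (R := R), add_mul (R := R), smul_mul_assoc, mul_smul_comm, mul_assoc,
    smul_add, smul_smul, coeffG2_4, zpow_mul_self_mul, Units.mul_inv_cancel_left,
      Units.inv_mul_cancel_left, h.mul_left, h.inv_x, h.zpow_x _ hn]
  match_scalars <;> (try simp only [intPoly]) <;> ring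

theorem RelG2.verma {X Y : Rˣ} {a₁ a₂ a₃ b : R} (h : RelG2 k (X : R) Y a₁ a₂ a₃ b) (r s : ℤ) :
    X ^ r * Y ^ (3 * r + s) * X ^ (2 * r + s) * Y ^ (3 * r + 2 * s) * X ^ (r + s) * Y ^ s =
      Y ^ s * X ^ (r + s) * Y ^ (3 * r + 2 * s) * X ^ (2 * r + s) * Y ^ (3 * r + s) * X ^ r := by
  refine units_eq_of_succ_eq_mul
    (f := fun s => X ^ r * Y ^ (3 * r + s) * X ^ (2 * r + s) * Y ^ (3 * r + 2 * s) * X ^ (r + s) *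
      Y ^ s)
    (g := fun s => Y ^ s * X ^ (r + s) * Y ^ (3 * r + 2 * s) * X ^ (2 * r + s) * Y ^ (3 * r + s) *
      X ^ r)
    (fun s => coeffG2_4 (r + s : k) (2 * r + s) (X : R) Y a₁ a₂ a₃ b)
    (fun s => ?_) (fun s => ?_) ?_ s
  all_goals
    have e1 : ((r + s : ℤ) : k) = r + s := Int.cast_add r s
    have e2 : ((2 * r + s : ℤ) : k) = 2 * r + s := by push_cast; rfl
    have e3 : ((3 * r + 2 * s : ℤ) : k) = (2 * r + s) + (r + s) := by push_cast; ring
    -- The two intermediate exponents 2r + s and r + s serve as m and p; this and the neighbouring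
    -- equations express the exponents of Y through them, in either order of roles.
    have e4 : ((3 * r + s : ℤ) : k) = 2 * (2 * r + s) - (r + s) := by push_cast; ring
    have e5 : (s : k) = 2 * (r + s) - (2 * r + s) := by ring
    have hY : ∀ n : ℤ, Y ^ (n + 1) = Y * Y ^ n := fun n => by rw [add_comm, zpow_one_add]
    have f1 : 3 * r + 2 * (s + 1) = 3 * r + 2 * s + 1 + 1 := by ring
  · simp only [f1, ← add_assoc, zpow_add_one _ (3 * r + s), zpow_add_one _ (2 * r + s),
      zpow_add_one _ (3 * r + 2 * s + 1), zpow_add_one _ (3 * r + 2 * s), zpow_add_one _ (r + s),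
      hY s, Units.val_mul, mul_assoc]
    rw [h.coeff1_spec e1, h.coeff2_spec e3, h.coeff3_spec e2, h.coeff4_spec e4, h.coeff4_symm rfl]
  · simp only [f1, ← add_assoc, hY (3 * r + s), zpow_add_one _ (2 * r + s),
      zpow_add_one _ (3 * r + 2 * s + 1), zpow_add_one _ (3 * r + 2 * s), zpow_add_one _ (r + s),
      zpow_add_one Y s, Units.val_mul, mul_assoc]
    rw [h.coeff1_spec e2, h.coeff2_spec (e3.trans (add_comm _ _)), h.coeff3_spec e1,
      h.coeff4_spec e5]
  · simp [mul_assoc]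

end G2

/-! ### `q`-numbers and the two `q`-Pascal rules for integer upper index. -/

section QBinomials

variable {k : Type*} [Field k]

theorem qNum_add {t : k} (ht : t ≠ 0) (m n : ℤ) :
    qNum t (m + n) = t ^ n * qNum t m + t ^ (-m) * qNum t n := by
  have h1 : t ^ m ≠ 0 := zpow_ne_zero _ ht
  have h2 : t ^ n ≠ 0 := zpow_ne_zero _ ht
  simp only [qNum, neg_add, zpow_add₀ ht, zpow_neg]
  rw [mul_div_assoc', mul_div_assoc', ← add_div]
  congr 1
  field_simp
  ring

theorem qFact_succ (t : k) (n : ℕ) : qFact t (n + 1) = qFact t n * qNum t ((n : ℤ) + 1) :=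
  Finset.prod_range_succ _ _

@[simp] theorem qFact_zero (t : k) : qFact t 0 = 1 := rfl

@[simp] theorem qBinom_zero_right (t : k) (n : ℤ) : qBinom t n 0 = 1 := by simp [qBinom]

theorem qBinom_natCast_of_lt (t : k) {n r : ℕ} (h : n < r) : qBinom t n r = 0 := by
  rw [qBinom, Finset.prod_eq_zero (Finset.mem_range.mpr h), zero_div]
  simp [qNum]

/-- Both terms share the product [n]⋯[n-r+1]; what remains is `qNum_add` for n + 1 = (n - r) + (r +
1). -/
theorem qBinom_pascal {t : k} (ht : t ≠ 0) (hF : ∀ n, qFact t n ≠ 0) (n : ℤ) (r : ℕ) :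
    qBinom t (n + 1) (r + 1) =
      t ^ ((r : ℤ) + 1) * qBinom t n (r + 1) + t ^ (-(n - r)) * qBinom t n r := by
  have h := qNum_add ht (n - r) (r + 1)
  rw [show n - r + ((r : ℤ) + 1) = n + 1 by ring] at h
  have h1 := hF r
  have h2 : qNum t ((r : ℤ) + 1) ≠ 0 := fun h0 => hF (r + 1) (by rw [qFact_succ, h0, mul_zero])
  simp only [qBinom, qFact_succ]
  rw [Finset.prod_range_succ', Finset.prod_range_succ]
  simp only [Nat.cast_succ, Nat.cast_zero, sub_zero, add_sub_add_right_eq_sub]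
  rw [h]
  field_simp

theorem qNum_inv (t : k) (n : ℤ) : qNum t⁻¹ n = qNum t n := by
  simp only [qNum, inv_zpow', neg_neg, inv_inv]
  rw [← neg_sub (t ^ n), ← neg_sub t, neg_div_neg_eq]

theorem qBinom_inv (t : k) (n : ℤ) (r : ℕ) : qBinom t⁻¹ n r = qBinom t n r := by
  simp only [qBinom, qFact, qNum_inv]

/-- `q`-numbers are invariant under t ↦ t⁻¹, so the first Pascal rule at t⁻¹ is the second one at t.
-/
theorem qBinom_pascal' {t : k} (ht : t ≠ 0) (hF : ∀ n, qFact t n ≠ 0) (n : ℤ) (r : ℕ) :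
    qBinom t (n + 1) (r + 1) =
      t ^ (-((r : ℤ) + 1)) * qBinom t n (r + 1) + t ^ (n - r) * qBinom t n r := by
  have hF' : ∀ n, qFact t⁻¹ n ≠ 0 := fun n => by simpa only [qFact, qNum_inv] using hF n
  have h := qBinom_pascal (inv_ne_zero ht) hF' n r
  simpa only [qBinom_inv, inv_zpow', neg_neg] using h

theorem qBinom_natCast_mul {t : k} (hF : ∀ n, qFact t n ≠ 0) {n r : ℕ} (h : r ≤ n) :
    qBinom t n r = qFact t n * ((qFact t (n - r))⁻¹ * (qFact t r)⁻¹) := by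
  have key : (∏ s ∈ Finset.range r, qNum t ((n : ℤ) - s)) * qFact t (n - r) = qFact t n := by
    induction r with
    | zero => simp
    | succ r ih =>
      rw [← ih (by omega), Finset.prod_range_succ, show n - r = n - (r + 1) + 1 by omega,
        qFact_succ, show (n : ℤ) - r = ((n - (r + 1) : ℕ) : ℤ) + 1 by omega]
      ring
  rw [qBinom, ← key]
  have h1 := hF (n - r)
  have h2 := hF r
  field_simp

end QBinomials

/-! ### Iterated adjoints and conjugation by powers of a unit. -/

section Adjoint

variable {k R : Type*} [Field k] [Ring R] [Algebra k R]

/-- A `q`-binomial theorem for the commuting operators of left and right multiplication by x; the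
induction step is the second Pascal rule. -/
theorem qAd_eq_sum {t : k} (ht : t ≠ 0) (hF : ∀ n, qFact t n ≠ 0) (a : ℤ) (x y : R) (r : ℕ) :
    qAd t a x y r = ∑ s ∈ Finset.range (r + 1),
      ((-1) ^ s * t ^ ((s : ℤ) * (a + r - 1)) * qBinom t r s) • (x ^ (r - s) * y * x ^ s) := by
  induction r with
  | zero => simp [qAd]
  | succ r ih =>
    rw [qAd, ih, Finset.mul_sum, Finset.sum_mul, Finset.smul_sum]
    have e1 : ∀ s ∈ Finset.range (r + 1), x * (((-1) ^ s * t ^ ((s : ℤ) * (a + r - 1)) *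
        qBinom t r s) • (x ^ (r - s) * y * x ^ s)) = ((-1) ^ s * t ^ ((s : ℤ) * (a + r - 1)) *
        qBinom t r s) • (x ^ (r + 1 - s) * y * x ^ s) := by
      intro s hs
      rw [mul_smul_comm, ← mul_assoc, ← mul_assoc, ← pow_succ',
        show r - s + 1 = r + 1 - s by have := Finset.mem_range.mp hs; omega]
    have e2 : ∀ s ∈ Finset.range (r + 1), t ^ (a + 2 * (r : ℤ)) •
        ((((-1) ^ s * t ^ ((s : ℤ) * (a + r - 1)) * qBinom t r s) • (x ^
            (r - s) * y * x ^ s)) * x) =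
        -((-1) ^ (s + 1) * t ^ ((s : ℤ) * (a + r - 1) + (a + 2 * r)) * qBinom t r s) •
          (x ^ (r + 1 - (s + 1)) * y * x ^ (s + 1)) := by
      intro s hs
      rw [smul_mul_assoc, smul_smul, mul_assoc _ _ x, ← pow_succ, Nat.add_sub_add_right,
        zpow_add₀ ht ((s : ℤ) * (a + r - 1))]
      congr 1
      ring
    rw [Finset.sum_congr rfl e1, Finset.sum_congr rfl e2]
    simp only [neg_smul, Finset.sum_neg_distrib, sub_neg_eq_add]
    rw [Finset.sum_range_succ' _ (r + 1), Finset.sum_range_succ' _ r, add_right_comm,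
      ← sub_eq_zero]
    -- The added top term vanishes, having lower index r + 1 > r; it makes the two ranges agree so
    -- that the sums merge termwise.
    have e3 : ∑ s ∈ Finset.range r, ((-1) ^ (s + 1) * t ^ (((s + 1 : ℕ) : ℤ) * (a + r - 1)) *
        qBinom t r (s + 1)) • (x ^ (r + 1 - (s + 1)) * y * x ^ (s + 1)) =
        ∑ s ∈ Finset.range (r + 1), ((-1) ^ (s + 1) * t ^ (((s + 1 : ℕ) : ℤ) * (a + r - 1)) *
        qBinom t r (s + 1)) • (x ^ (r + 1 - (s + 1)) * y * x ^ (s + 1)) := by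
      rw [Finset.sum_range_succ, qBinom_natCast_of_lt t (Nat.lt_succ_self r)]
      simp
    rw [e3, ← Finset.sum_add_distrib]
    simp only [Nat.cast_zero, zero_mul, qBinom_zero_right]
    rw [add_sub_add_right_eq_sub, ← Finset.sum_sub_distrib]
    refine Finset.sum_eq_zero fun s _ => ?_
    rw [← add_smul, ← sub_smul, Nat.cast_succ r, qBinom_pascal' ht hF]
    convert zero_smul k _
    have h1 : t ^ (((s + 1 : ℕ) : ℤ) * (a + ((r : ℤ) + 1) - 1)) =
        t ^ (((s + 1 : ℕ) : ℤ) * (a + r - 1)) * t ^ ((s : ℤ) + 1) := by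
      rw [← zpow_add₀ ht]; congr 1; push_cast; ring
    have h2 : t ^ ((s : ℤ) * (a + r - 1) + (a + 2 * r)) =
        t ^ (((s + 1 : ℕ) : ℤ) * (a + r - 1)) * t ^ ((s : ℤ) + 1) * t ^ ((r : ℤ) - s) := by
      rw [← zpow_add₀ ht, ← zpow_add₀ ht]; congr 1; push_cast; ring
    have h3 : t ^ ((s : ℤ) + 1) ≠ 0 := zpow_ne_zero _ ht
    rw [h1, h2, zpow_neg]
    field_simp
    ring

/-- At order N = 1 - a the exponent s(a + N - 1) is zero, so the expansion of the iterated adjoint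
is [N]! times the Serre sum. -/
theorem qAd_eq_zero {t : QD.Cq} (ht : t ≠ 0) (hF : ∀ n, qFact t n ≠ 0) {R : Type*} [Ring R]
    [Algebra QD.Cq R] {a : ℤ} {N : ℕ} (hN : (N : ℤ) = 1 - a) {x y : R}
    (h : QD.serreSum t N x y = 0) : qAd t a x y N = 0 := by
  rw [qAd_eq_sum ht hF, ← smul_zero (qFact t N), ← h, QD.serreSum, Finset.smul_sum]
  refine Finset.sum_congr rfl fun s hs => ?_
  rw [smul_smul, hN, show a + (1 - a) - 1 = 0 by ring, mul_zero, zpow_zero, ← hN,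
    qBinom_natCast_mul hF (Nat.lt_succ_iff.mp (Finset.mem_range.mp hs))]
  congr 1
  ring

/-- Conjugation of a `q`-adjoint nilpotent element by the powers of a unit. -/
theorem units_zpow_mul_eq_sum_qAd {t : k} (ht : t ≠ 0) (hF : ∀ n, qFact t n ≠ 0) (a : ℤ) (X : Rˣ)
    (y : R) {N : ℕ} (hN : qAd t a (X : R) y N = 0) (n : ℤ) :
    ((X ^ n : Rˣ) : R) * y = (∑ r ∈ Finset.range N, (t ^ (((r : ℤ) + a) * (n - r)) *
      qBinom t n r) • (qAd t a (X : R) y r * ((X ^ (-(r : ℤ)) : Rˣ) : R))) *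
        ((X ^ n : Rˣ) : R) := by
  obtain rfl | ⟨N, rfl⟩ : N = 0 ∨ ∃ M, N = M + 1 := by cases N <;> simp
  · have : y = 0 := hN
    simp [this]
  -- The sum is the candidate for conjugation by X^n. At n = 0 only the term r = 0 survives, and the
  -- one-step rule is a recursion in the coefficients.
  have key := units_zpow_mul_eq X (fun n => ∑ r ∈ Finset.range (N + 1),
    (t ^ (((r : ℤ) + a) * (n - r)) * qBinom t n r) •
      (qAd t a (X : R) y r * ((X ^ (-(r : ℤ)) : Rˣ) : R))) (fun n => ?_) n
  · have h0 : ∑ r ∈ Finset.range (N + 1), (t ^ (((r : ℤ) + a) * (0 - r)) * qBinom t 0 r) •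
        (qAd t a (X : R) y r * ((X ^ (-(r : ℤ)) : Rˣ) : R)) = y := by
      rw [Finset.sum_eq_single_of_mem 0 (by simp)]
      · simp [qAd]
      · intro r _ hr
        have := qBinom_natCast_of_lt t (Nat.pos_of_ne_zero hr)
        rw [Nat.cast_zero] at this
        rw [this, mul_zero, zero_smul]
    rwa [h0] at key
  · set g : ℕ → R := fun r => qAd t a (X : R) y r * ((X ^ (1 - (r : ℤ)) : Rˣ) : R) with hg
    have e1 : ∀ r : ℕ, (X : R) * (qAd t a (X : R) y r * ((X ^ (-(r : ℤ)) : Rˣ) : R)) =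
        g (r + 1) + t ^ (a + 2 * (r : ℤ)) • g r := by
      intro r
      have : (X : R) * qAd t a (X : R) y r = qAd t a (X : R) y (r + 1) +
          t ^ (a + 2 * (r : ℤ)) • (qAd t a (X : R) y r * X) := by rw [qAd, sub_add_cancel]
      rw [← mul_assoc, this, add_mul, smul_mul_assoc, mul_assoc, ← Units.val_mul, ← zpow_one_add]
      simp only [hg, Nat.cast_succ]
      rw [show 1 - ((r : ℤ) + 1) = -r by ring, sub_eq_add_neg]
    have e2 : ∀ r : ℕ, qAd t a (X : R) y r * ((X ^ (-(r : ℤ)) : Rˣ) : R) * X = g r := by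
      intro r
      rw [mul_assoc, ← Units.val_mul, ← zpow_add_one, neg_add_eq_sub]
    have hgN : g (N + 1) = 0 := by simp only [hg, hN, zero_mul]
    simp only [Finset.mul_sum, Finset.sum_mul, smul_mul_assoc, mul_smul_comm, e1, e2, smul_add,
      Finset.sum_add_distrib, smul_smul]
    -- X sends the r-th term to a combination of `g (r + 1)` and `g r`. The Serre relation kills `g
    -- (N + 1)`, and comparing the coefficients of `g (r + 1)` leaves the first Pascal rule.
    rw [Finset.sum_range_succ, hgN, smul_zero, add_zero, Finset.sum_range_succ',
      Finset.sum_range_succ' (fun r => (t ^ (((r : ℤ) + a) * (n + 1 - r)) * qBinom t (n +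
        1) r) • g r), ← add_assoc, ← Finset.sum_add_distrib]
    congr 1
    · refine Finset.sum_congr rfl fun r _ => ?_
      rw [← add_smul, qBinom_pascal ht hF, Nat.cast_succ]
      congr 1
      have h1 : t ^ (((r : ℤ) + 1 + a) * (n + 1 - (r + 1))) =
          t ^ (((r : ℤ) + 1 + a) * (n - (r + 1))) * t ^ ((r : ℤ) + 1 + a) := by
        rw [← zpow_add₀ ht]; congr 1; ring
      have h2 : t ^ (((r : ℤ) + 1 + a) * (n + 1 - (r + 1))) * t ^ (-(n - r)) =
          t ^ (((r : ℤ) + a) * (n - r)) := by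
        rw [← zpow_add₀ ht]; congr 1; ring
      have h3 : t ^ (a + 2 * ((r : ℤ) + 1)) = t ^ ((r : ℤ) + 1 + a) * t ^ ((r : ℤ) + 1) := by
        rw [← zpow_add₀ ht]; congr 1; ring
      rw [h3, mul_add, ← mul_assoc _ (t ^ (-(n - (r : ℤ)))), h2, h1]
      ring
    · simp only [Nat.cast_zero, qBinom_zero_right, mul_one, mul_zero, add_zero, zero_add, sub_zero]
      rw [← zpow_add₀ ht]
      congr 2
      ring

/-- Conjugation of an adjoint nilpotent element by the powers of a unit. -/
theorem units_zpow_mul_eq_sum_ad {R : Type*} [Ring R] (X : Rˣ) (y : R) {N : ℕ}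
    (hN : (fun x : R => X * x - x * X)^[N] y = 0) (n : ℤ) :
    ((X ^ n : Rˣ) : R) * y = (∑ r ∈ Finset.range N, ((Ring.choose n r : ℤ) : R) *
      (fun x : R => X * x - x * X)^[r] y * ((X ^ (-(r : ℤ)) : Rˣ) : R)) * ((X ^ n : Rˣ) : R) := by
  set A : ℕ → R := fun r => (fun x : R => X * x - x * X)^[r] y with hA
  have hA1 : ∀ r, (X : R) * A r = A (r + 1) + A r * X := fun r => by
    simp only [hA, Function.iterate_succ_apply', sub_add_cancel]
  obtain rfl | ⟨N, rfl⟩ : N = 0 ∨ ∃ M, N = M + 1 := by cases N <;> simp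
  · have : y = 0 := hN
    simp [this]
  have key := units_zpow_mul_eq X (fun n => ∑ r ∈ Finset.range (N + 1),
    ((Ring.choose n r : ℤ) : R) * A r * ((X ^ (-(r : ℤ)) : Rˣ) : R)) (fun n => ?_) n
  · have h0 : ∑ r ∈ Finset.range (N + 1), ((Ring.choose (0 : ℤ) r : ℤ) : R) * A r *
        ((X ^ (-(r : ℤ)) : Rˣ) : R) = y := by
      rw [Finset.sum_eq_single_of_mem 0 (by simp)]
      · simp [hA]
      · intro r _ hr
        rw [Ring.choose_zero_pos ℤ (Nat.pos_of_ne_zero hr)]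
        simp
    rwa [h0] at key
  · set g : ℕ → R := fun r => A r * ((X ^ (1 - (r : ℤ)) : Rˣ) : R) with hg
    have e1 : ∀ (r : ℕ) (m : ℤ), (X : R) * ((m : R) * A r * ((X ^ (-(r : ℤ)) : Rˣ) : R)) =
        m * g (r + 1) + m * g r := by
      intro r m
      rw [mul_assoc, ← mul_assoc, ← Int.cast_comm, mul_assoc, ← mul_assoc (X : R), hA1, add_mul,
        mul_assoc (A r), ← Units.val_mul, ← zpow_one_add, mul_add]
      simp only [hg, Nat.cast_succ]
      rw [show 1 - ((r : ℤ) + 1) = -r by ring, sub_eq_add_neg]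
    have e2 : ∀ (r : ℕ) (m : ℤ), (m : R) * A r * ((X ^ (-(r : ℤ)) : Rˣ) : R) * X = m * g r := by
      intro r m
      rw [mul_assoc, mul_assoc, ← Units.val_mul, ← zpow_add_one, neg_add_eq_sub]
    have hgN : g (N + 1) = 0 := by
      have : A (N + 1) = 0 := hN
      simp only [hg, this, zero_mul]
    simp only [Finset.mul_sum, Finset.sum_mul, e1, e2, Finset.sum_add_distrib]
    -- Same bookkeeping as in the deformed case; the comparison is now the ordinary Pascal rule for
    -- integer upper index.
    rw [Finset.sum_range_succ, hgN, mul_zero, add_zero, Finset.sum_range_succ',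
      Finset.sum_range_succ' (fun r => ((Ring.choose (n + 1) r : ℤ) : R) * g r),
      ← add_assoc, ← Finset.sum_add_distrib]
    congr 1
    · refine Finset.sum_congr rfl fun r _ => ?_
      rw [Ring.choose_succ_succ, Int.cast_add, add_mul]
    · simp

end Adjoint

variable {I Qv : Type*} [AddCommGroup Qv]

/-! ### Simple reflections on P and on the coroot side. -/

section Reflections

namespace CartanDatum

variable (D : CartanDatum I Qv)

theorem reflP_apply_apply (i : I) (l : Module.Dual ℤ Qv) (b : Qv) :
    D.reflP i l b = l b - l (D.coroot i) * D.root i b := rfl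

theorem reflP_symm (i : I) : (D.reflP i).symm = D.reflP i := rfl

/-- The two reflections are adjoint under the pairing. This converts every substitution λ ↦ s_i(λ)
in a family into s_i acting on β. -/
theorem reflP_apply_eq_reflQ (i : I) (l : Module.Dual ℤ Qv) (b : Qv) :
    D.reflP i l b = l (D.reflQ i b) := by
  rw [reflP_apply_apply, reflQ, map_sub, map_smul, smul_eq_mul, mul_comm]

theorem reflP_reflP (i : I) (l : Module.Dual ℤ Qv) : D.reflP i (D.reflP i l) = l :=
  (D.reflP i).left_inv l

theorem reflQ_coroot_self (i : I) : D.reflQ i (D.coroot i) = -D.coroot i := by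
  rw [reflQ, D.pairing, D.a_diag, two_smul]
  abel

theorem reflQ_coroot (i j : I) : D.reflQ i (D.coroot j) = D.coroot j - D.a j i • D.coroot i := by
  rw [reflQ, D.pairing]

theorem reflQ_add (i : I) (b c : Qv) : D.reflQ i (b + c) = D.reflQ i b + D.reflQ i c := by
  simp only [reflQ, map_add, add_smul]
  abel

theorem reflQ_nsmul (i : I) (n : ℕ) (b : Qv) : D.reflQ i (n • b) = n • D.reflQ i b := by
  simp only [reflQ, map_nsmul, smul_sub, smul_assoc]

end CartanDatum

end Reflections

/-! ### Weyl group relations for 𝐬_i as consequences of the Verma identities. -/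

section Twist

variable {k R : Type*} [CommRing k] [Ring R] [Algebra k R]

theorem incl_apply (x : Fam Qv R) :
    (incl x : DiffAlg Qv R) = SkewMonoidAlgebra.single 1 x := rfl

theorem tilde_incl (w : Module.Dual ℤ Qv ≃+ Module.Dual ℤ Qv) (x : Fam Qv R) :
    tilde k R w (incl x) = incl (famMap k R w x) := by
  refine (tildeHom_single k R w 1 x).trans ?_
  rw [toAdd_one, map_zero, ofAdd_zero, incl_apply]

theorem tilde_tau (w : Module.Dual ℤ Qv ≃+ Module.Dual ℤ Qv) (m : Module.Dual ℤ Qv) :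
    tilde k R w (tau R m) = tau R (w m) := by
  refine (tildeHom_single k R w _ 1).trans ?_
  rw [map_one, toAdd_ofAdd]
  rfl

theorem tilde_mul_tilde {v w e : Module.Dual ℤ Qv ≃+ Module.Dual ℤ Qv} (h : ∀ l, v (w l) = e l) :
    tilde k R v * tilde k R w = tilde k R e := by
  refine AlgEquiv.ext fun x => ?_
  change tildeHom k R v (tildeHom k R w x) = tildeHom k R e x
  induction x using SkewMonoidAlgebra.induction_on with
  | zero => simp
  | single m a =>
    rw [tildeHom_single, tildeHom_single, tildeHom_single, toAdd_ofAdd, h]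
    congr 1
    funext l
    change a (w.symm (v.symm l)) = a (e.symm l)
    congr 1
    apply e.injective
    rw [← h]
    simp
  | add x y hx hy => rw [map_add, map_add, map_add, hx, hy]

theorem innerAut_mul {X : Type*} [Ring X] [Algebra k X] (a b : Xˣ) :
    innerAut k (a * b) = innerAut k a * innerAut k b := by
  ext x
  change ((a * b : Xˣ) : X) * x * ((a * b)⁻¹ : Xˣ) = a * (b * x * (b⁻¹ : Xˣ)) * (a⁻¹ : Xˣ)
  simp only [Units.val_mul, mul_inv_rev, mul_assoc]

theorem innerAut_one {X : Type*} [Ring X] [Algebra k X] :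
    innerAut k (1 : Xˣ) = 1 := by
  ext x
  change ((1 : Xˣ) : X) * x * ((1 : Xˣ)⁻¹ : Xˣ) = x
  simp

theorem tau_mul_incl (m : Module.Dual ℤ Qv) (x : Fam Qv R) :
    (tau R m * incl x : DiffAlg Qv R) = incl (Fam.of fun l => x (l + m)) * tau R m := by
  rw [incl_apply, incl_apply, tau, SkewMonoidAlgebra.single_mul_single,
    SkewMonoidAlgebra.single_mul_single, mul_one, one_mul, one_mul, smul_one, mul_one]
  rfl

variable (D : CartanDatum I Qv) (u : I → Rˣ)

theorem fpow_mul_fpow (i : I) (b c : Qv) : fpow u i b * fpow u i c = fpow u i (b + c) := by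
  refine Units.ext (funext fun l => ?_)
  change ((u i ^ l b : Rˣ) : R) * ((u i ^ l c : Rˣ) : R) = ((u i ^ l (b + c) : Rˣ) : R)
  rw [map_add, zpow_add, Units.val_mul]

theorem fpow_zero (i : I) : (fpow u i 0 : (Fam Qv R)ˣ) = 1 := by
  refine Units.ext (funext fun l => ?_)
  change ((u i ^ l 0 : Rˣ) : R) = 1
  simp

theorem fpow_inv (i : I) (b : Qv) : (fpow u i b)⁻¹ = fpow u i (-b) :=
  inv_eq_of_mul_eq_one_right (by rw [fpow_mul_fpow, add_neg_cancel, fpow_zero])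

theorem famMap_fpow (i j : I) (b : Qv) :
    famMap k R (D.reflP j) (fpow u i b : Fam Qv R) = fpow u i (D.reflQ j b) := by
  funext l
  change ((u i ^ (D.reflP j l) b : Rˣ) : R) = ((u i ^ l (D.reflQ j b) : Rˣ) : R)
  rw [D.reflP_apply_eq_reflQ]

/-- `Ad(f_i^β)` on `D(R^P)`. -/
noncomputable def adPow (k : Type*) [CommRing k] [Algebra k R] (i : I) (b : Qv) :
    DiffAlg Qv R ≃ₐ[k] DiffAlg Qv R :=
  innerAut k (Units.map (incl : Fam Qv R →+* DiffAlg Qv R) (fpow u i b))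

theorem birat_eq_mul (i : I) :
    birat k D u i = adPow u k i (D.coroot i) * tilde k R (D.reflP i) := rfl

/-- s̃_j carries the family f_i^β to f_i^{s_j(β)}, hence conjugates the corresponding inner
automorphisms into one another. It is the rule for collecting all substitutions at the right of a
word. -/
theorem tilde_mul_adPow (i j : I) (b : Qv) :
    tilde k R (D.reflP j) * adPow u k i b = adPow u k i (D.reflQ j b) * tilde k R (D.reflP j) := by
  refine AlgEquiv.ext fun x => ?_
  change tilde k R (D.reflP j) (incl (fpow u i b : Fam Qv R) * x *
    incl (((fpow u i b)⁻¹ : (Fam Qv R)ˣ) : Fam Qv R)) =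
    incl (fpow u i (D.reflQ j b) : Fam Qv R) * tilde k R (D.reflP j) x *
      incl (((fpow u i (D.reflQ j b))⁻¹ : (Fam Qv R)ˣ) : Fam Qv R)
  rw [map_mul, map_mul, tilde_incl, tilde_incl, fpow_inv, fpow_inv, famMap_fpow, famMap_fpow]
  congr 4
  simp only [CartanDatum.reflQ, map_neg, neg_smul]
  abel

variable {u} in
-- a ↦ Ad(a) is a group homomorphism, so an identity between products of fractional powers passes to
-- their inner automorphisms.
theorem adPow_congr {b c : List (I × Qv)}
    (h : (b.map fun p => fpow u p.1 p.2).prod = (c.map fun p => fpow u p.1 p.2).prod) :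
    (b.map fun p => adPow u k p.1 p.2).prod = (c.map fun p => adPow u k p.1 p.2).prod := by
  let φ : (Fam Qv R)ˣ →* (DiffAlg Qv R ≃ₐ[k] DiffAlg Qv R) :=
    { toFun := fun a => innerAut k (Units.map (incl : Fam Qv R →+* DiffAlg Qv R) a)
      map_one' := by rw [map_one, innerAut_one]
      map_mul' := fun a b => by rw [map_mul, innerAut_mul] }
  have := congrArg φ h
  rwa [map_list_prod, map_list_prod, List.map_map, List.map_map] at this

/-- Since s_i(α_i^∨) = -α_i^∨, collecting gives Ad(f_i^{α_i^∨}) Ad(f_i^{-α_i^∨}) s̃_i², which is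
trivial. -/
theorem birat_mul_self (i : I) : birat k D u i * birat k D u i = 1 := by
  rw [birat_eq_mul, mul_assoc, ← mul_assoc (tilde k R _), tilde_mul_adPow, D.reflQ_coroot_self,
    mul_assoc, tilde_mul_tilde (e := AddEquiv.refl _) (fun l => D.reflP_reflP i l), ← mul_assoc]
  have h1 := adPow_congr (k := k) (u := u) (b := [(i, D.coroot i), (i, -D.coroot i)]) (c := [])
    (by simp [fpow_mul_fpow, fpow_zero])
  simp only [List.map_cons, List.map_nil, List.prod_cons, List.prod_nil, mul_one] at h1
  rw [h1, one_mul]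
  refine AlgEquiv.ext fun x => ?_
  change tildeHom k R _ x = x
  induction x using SkewMonoidAlgebra.induction_on with
  | zero => simp
  | single m a => rw [tildeHom_single]; rfl
  | add x y hx hy => rw [map_add, hx, hy]

variable {D u}

theorem mul_left_eq_of_eq {G : Type*} [Semigroup G] {a b : G} (h : a = b) (c : G) :
    a * c = b * c := by rw [h]

theorem birat_commute (h : VermaIdentities D u) {i j : I} (hij : (D.a i j, D.a j i) = (0, 0)) :
    birat k D u i * birat k D u j = birat k D u j * birat k D u i := by
  obtain ⟨h1, h2⟩ := Prod.mk.inj hij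
  have e1 : D.reflQ j (D.coroot i) = D.coroot i := by
    simp only [D.reflQ_add, D.reflQ_nsmul, D.reflQ_coroot_self, D.reflQ_coroot, h1, h2]
    module
  have e2 : D.reflQ i (D.coroot j) = D.coroot j := by
    simp only [D.reflQ_add, D.reflQ_nsmul, D.reflQ_coroot_self, D.reflQ_coroot, h1, h2]
    module
  have hv := adPow_congr (k := k) (u := u)
    (b := [(i, D.coroot i), (j, D.coroot j)])
    (c := [(j, D.coroot j), (i, D.coroot i)])
    (by simpa [mul_assoc] using h.verma2 i j (D.coroot i) (D.coroot j) hij)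
  have ht : tilde k R (D.reflP i) * tilde k R (D.reflP j) =
      tilde k R (D.reflP j) * tilde k R (D.reflP i) := by
    try simp only [mul_assoc]
    rw [tilde_mul_tilde (e := (D.reflP j).trans (D.reflP i)) (fun _ => rfl),
      tilde_mul_tilde (e := (D.reflP j).trans (D.reflP i))]
    intro l
    ext x
    simp only [AddEquiv.trans_apply, D.reflP_apply_apply, D.pairing, D.a_diag, h1, h2]
    ring
  simp only [List.map_cons, List.map_nil, List.prod_cons, List.prod_nil, mul_one] at hv
  try simp only [mul_assoc] at hv ht
  have hA := fun i b l (z : DiffAlg Qv R ≃ₐ[k] DiffAlg Qv R) =>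
    mul_left_eq_of_eq (tilde_mul_adPow (k := k) D u i l b) z
  have hB := mul_left_eq_of_eq hv
  simp only [mul_assoc] at hA hB
  simp only [pow_succ, pow_zero, one_mul, birat_eq_mul, mul_assoc, tilde_mul_adPow, hA, e1, e2, ht]
  rw [← ht]
  exact hB _

/-- The exponents collected on the left are α_i^∨, s_i(α_j^∨) = α_i^∨ + α_j^∨ and s_i s_j(α_i^∨) =
α_j^∨: the left-hand word of the Verma identity. The other side gives the right-hand word. Types B₂
and G₂ follow the same pattern with four and six coroots. -/
theorem birat_braid3 (h : VermaIdentities D u) {i j : I} (hij : (D.a i j, D.a j i) = (-1, -1)) :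
    birat k D u i * birat k D u j * birat k D u i =
      birat k D u j * birat k D u i * birat k D u j := by
  obtain ⟨h1, h2⟩ := Prod.mk.inj hij
  have e1 : D.reflQ j (D.coroot i) = D.coroot i + D.coroot j := by
    simp only [D.reflQ_add, D.reflQ_nsmul, D.reflQ_coroot_self, D.reflQ_coroot, h1, h2]
    module
  have e2 : D.reflQ i (D.coroot j) = D.coroot i + D.coroot j := by
    simp only [D.reflQ_add, D.reflQ_nsmul, D.reflQ_coroot_self, D.reflQ_coroot, h1, h2]
    module
  have e3 : D.reflQ i (D.coroot i + D.coroot j) = D.coroot j := by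
    simp only [D.reflQ_add, D.reflQ_nsmul, D.reflQ_coroot_self, D.reflQ_coroot, h1, h2]
    module
  have e4 : D.reflQ j (D.coroot i + D.coroot j) = D.coroot i := by
    simp only [D.reflQ_add, D.reflQ_nsmul, D.reflQ_coroot_self, D.reflQ_coroot, h1, h2]
    module
  have hv := adPow_congr (k := k) (u := u)
    (b := [(i, D.coroot i), (j, D.coroot i + D.coroot j), (i, D.coroot j)])
    (c := [(j, D.coroot j), (i, D.coroot i + D.coroot j), (j, D.coroot i)])
    (by simpa [mul_assoc] using h.verma3 i j (D.coroot i) (D.coroot j) hij)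
  have ht : tilde k R (D.reflP i) * tilde k R (D.reflP j) * tilde k R (D.reflP i) =
      tilde k R (D.reflP j) * tilde k R (D.reflP i) * tilde k R (D.reflP j) := by
    try simp only [mul_assoc]
    rw [tilde_mul_tilde (e := (D.reflP i).trans (D.reflP j)) (fun _ => rfl),
      tilde_mul_tilde (e := ((D.reflP i).trans (D.reflP j)).trans (D.reflP i)) (fun _ => rfl),
      tilde_mul_tilde (e := (D.reflP j).trans (D.reflP i)) (fun _ => rfl),
      tilde_mul_tilde (e := ((D.reflP i).trans (D.reflP j)).trans (D.reflP i))]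
    intro l
    ext x
    simp only [AddEquiv.trans_apply, D.reflP_apply_apply, D.pairing, D.a_diag, h1, h2]
    ring
  simp only [List.map_cons, List.map_nil, List.prod_cons, List.prod_nil, mul_one] at hv
  try simp only [mul_assoc] at hv ht
  have hA := fun i b l (z : DiffAlg Qv R ≃ₐ[k] DiffAlg Qv R) =>
    mul_left_eq_of_eq (tilde_mul_adPow (k := k) D u i l b) z
  have hB := mul_left_eq_of_eq hv
  simp only [mul_assoc] at hA hB
  simp only [pow_succ, pow_zero, one_mul, birat_eq_mul, mul_assoc, tilde_mul_adPow, hA, e1, e2,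
    e3, e4, ht]
  rw [← ht]
  exact hB _

theorem birat_braid4 (h : VermaIdentities D u) {i j : I} (hij : (D.a i j, D.a j i) = (-1, -2)) :
    (birat k D u i * birat k D u j) ^ 2 = (birat k D u j * birat k D u i) ^ 2 := by
  obtain ⟨h1, h2⟩ := Prod.mk.inj hij
  have e1 : D.reflQ j (D.coroot i) = D.coroot i + D.coroot j := by
    simp only [D.reflQ_add, D.reflQ_nsmul, D.reflQ_coroot_self, D.reflQ_coroot, h1, h2]
    module
  have e2 : D.reflQ i (D.coroot j) = 2 • D.coroot i + D.coroot j := by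
    simp only [D.reflQ_add, D.reflQ_nsmul, D.reflQ_coroot_self, D.reflQ_coroot, h1, h2]
    module
  have e3 : D.reflQ i (D.coroot i + D.coroot j) = D.coroot i + D.coroot j := by
    simp only [D.reflQ_add, D.reflQ_nsmul, D.reflQ_coroot_self, D.reflQ_coroot, h1, h2]
    module
  have e4 : D.reflQ j (D.coroot i + D.coroot j) = D.coroot i := by
    simp only [D.reflQ_add, D.reflQ_nsmul, D.reflQ_coroot_self, D.reflQ_coroot, h1, h2]
    module
  have e5 : D.reflQ i (2 • D.coroot i + D.coroot j) = D.coroot j := by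
    simp only [D.reflQ_add, D.reflQ_nsmul, D.reflQ_coroot_self, D.reflQ_coroot, h1, h2]
    module
  have e6 : D.reflQ j (2 • D.coroot i + D.coroot j) = 2 • D.coroot i + D.coroot j := by
    simp only [D.reflQ_add, D.reflQ_nsmul, D.reflQ_coroot_self, D.reflQ_coroot, h1, h2]
    module
  have hv := adPow_congr (k := k) (u := u)
    (b := [(i, D.coroot i), (j, 2 • D.coroot i + D.coroot j), (i, D.coroot i + D.coroot j), (j,
      D.coroot j)])
    (c := [(j, D.coroot j), (i, D.coroot i + D.coroot j), (j, 2 • D.coroot i + D.coroot j), (i,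
      D.coroot i)])
    (by simpa [mul_assoc] using h.verma4 i j (D.coroot i) (D.coroot j) hij)
  -- The substitutions form an action of the automorphisms of P, so this is the braid relation for
  -- reflections of P, checked by evaluating at an arbitrary vector.
  have ht : tilde k R (D.reflP i) * tilde k R (D.reflP j) * tilde k R (D.reflP i) * tilde k R
      (D.reflP j) =
      tilde k R (D.reflP j) * tilde k R (D.reflP i) * tilde k R (D.reflP j) * tilde k R
          (D.reflP i) := by
    try simp only [mul_assoc]
    rw [tilde_mul_tilde (e := (D.reflP j).trans (D.reflP i)) (fun _ => rfl),
      tilde_mul_tilde (e := ((D.reflP j).trans (D.reflP i)).trans (D.reflP j)) (fun _ => rfl),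
      tilde_mul_tilde (e := (((D.reflP j).trans (D.reflP i)).trans (D.reflP j)).trans
          (D.reflP i)) (fun _ => rfl), tilde_mul_tilde (e := (D.reflP i).trans (D.reflP j))
              (fun _ => rfl),
      tilde_mul_tilde (e := ((D.reflP i).trans (D.reflP j)).trans (D.reflP i)) (fun _ => rfl),
      tilde_mul_tilde (e := (((D.reflP j).trans (D.reflP i)).trans (D.reflP j)).trans (D.reflP i))]
    intro l
    ext x
    simp only [AddEquiv.trans_apply, D.reflP_apply_apply, D.pairing, D.a_diag, h1, h2]
    ring
  simp only [List.map_cons, List.map_nil, List.prod_cons, List.prod_nil, mul_one] at hv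
  try simp only [mul_assoc] at hv ht
  have hA := fun i b l (z : DiffAlg Qv R ≃ₐ[k] DiffAlg Qv R) =>
    mul_left_eq_of_eq (tilde_mul_adPow (k := k) D u i l b) z
  have hB := mul_left_eq_of_eq hv
  simp only [mul_assoc] at hA hB
  simp only [pow_succ, pow_zero, one_mul, birat_eq_mul, mul_assoc, tilde_mul_adPow, hA, e1, e2,
    e3, e4, e5, e6, ht]
  rw [← ht]
  exact hB _

theorem birat_braid6 (h : VermaIdentities D u) {i j : I} (hij : (D.a i j, D.a j i) = (-1, -3)) :
    (birat k D u i * birat k D u j) ^ 3 = (birat k D u j * birat k D u i) ^ 3 := by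
  obtain ⟨h1, h2⟩ := Prod.mk.inj hij
  have e1 : D.reflQ j (D.coroot i) = D.coroot i + D.coroot j := by
    simp only [D.reflQ_add, D.reflQ_nsmul, D.reflQ_coroot_self, D.reflQ_coroot, h1, h2]
    module
  have e2 : D.reflQ i (D.coroot j) = 3 • D.coroot i + D.coroot j := by
    simp only [D.reflQ_add, D.reflQ_nsmul, D.reflQ_coroot_self, D.reflQ_coroot, h1, h2]
    module
  have e3 : D.reflQ i (D.coroot i + D.coroot j) = 2 • D.coroot i + D.coroot j := by
    simp only [D.reflQ_add, D.reflQ_nsmul, D.reflQ_coroot_self, D.reflQ_coroot, h1, h2]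
    module
  have e4 : D.reflQ j (D.coroot i + D.coroot j) = D.coroot i := by
    simp only [D.reflQ_add, D.reflQ_nsmul, D.reflQ_coroot_self, D.reflQ_coroot, h1, h2]
    module
  have e5 : D.reflQ i (2 • D.coroot i + D.coroot j) = D.coroot i + D.coroot j := by
    simp only [D.reflQ_add, D.reflQ_nsmul, D.reflQ_coroot_self, D.reflQ_coroot, h1, h2]
    module
  have e6 : D.reflQ j (2 • D.coroot i + D.coroot j) = 2 • D.coroot i + D.coroot j := by
    simp only [D.reflQ_add, D.reflQ_nsmul, D.reflQ_coroot_self, D.reflQ_coroot, h1, h2]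
    module
  have e7 : D.reflQ i (3 • D.coroot i + D.coroot j) = D.coroot j := by
    simp only [D.reflQ_add, D.reflQ_nsmul, D.reflQ_coroot_self, D.reflQ_coroot, h1, h2]
    module
  have e8 : D.reflQ j (3 • D.coroot i + D.coroot j) = 3 • D.coroot i + 2 • D.coroot j := by
    simp only [D.reflQ_add, D.reflQ_nsmul, D.reflQ_coroot_self, D.reflQ_coroot, h1, h2]
    module
  have e9 : D.reflQ i (3 • D.coroot i + 2 • D.coroot j) = 3 • D.coroot i + 2 • D.coroot j := by
    simp only [D.reflQ_add, D.reflQ_nsmul, D.reflQ_coroot_self, D.reflQ_coroot, h1, h2]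
    module
  have e10 : D.reflQ j (3 • D.coroot i + 2 • D.coroot j) = 3 • D.coroot i + D.coroot j := by
    simp only [D.reflQ_add, D.reflQ_nsmul, D.reflQ_coroot_self, D.reflQ_coroot, h1, h2]
    module
  -- The six exponents are the positive coroots of the rank two system in their convex order; the
  -- opposite word lists them backwards.
  have hv := adPow_congr (k := k) (u := u)
    (b := [(i, D.coroot i), (j, 3 • D.coroot i + D.coroot j), (i, 2 • D.coroot i + D.coroot j),
      (j, 3 • D.coroot i + 2 • D.coroot j), (i, D.coroot i + D.coroot j), (j, D.coroot j)])
    (c := [(j, D.coroot j), (i, D.coroot i + D.coroot j), (j, 3 • D.coroot i + 2 • D.coroot j),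
      (i, 2 • D.coroot i + D.coroot j), (j, 3 • D.coroot i + D.coroot j), (i, D.coroot i)])
    (by simpa [mul_assoc] using h.verma6 i j (D.coroot i) (D.coroot j) hij)
  have ht : tilde k R (D.reflP i) * tilde k R (D.reflP j) * tilde k R (D.reflP i) * tilde k R
      (D.reflP j) * tilde k R (D.reflP i) * tilde k R (D.reflP j) =
      tilde k R (D.reflP j) * tilde k R (D.reflP i) * tilde k R (D.reflP j) * tilde k R
          (D.reflP i) * tilde k R (D.reflP j) * tilde k R (D.reflP i) := by
    try simp only [mul_assoc]
    rw [tilde_mul_tilde (e := (D.reflP j).trans (D.reflP i)) (fun _ => rfl),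
      tilde_mul_tilde (e := ((D.reflP j).trans (D.reflP i)).trans (D.reflP j)) (fun _ => rfl),
      tilde_mul_tilde (e := (((D.reflP j).trans (D.reflP i)).trans (D.reflP j)).trans
          (D.reflP i)) (fun _ => rfl), tilde_mul_tilde (e := ((((D.reflP j).trans
              (D.reflP i)).trans (D.reflP j)).trans (D.reflP i)).trans (D.reflP j)) (fun _ => rfl),
      tilde_mul_tilde (e := (((((D.reflP j).trans (D.reflP i)).trans (D.reflP j)).trans
          (D.reflP i)).trans (D.reflP j)).trans (D.reflP i)) (fun _ => rfl),
            tilde_mul_tilde (e := (D.reflP i).trans (D.reflP j)) (fun _ => rfl),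
      tilde_mul_tilde (e := ((D.reflP i).trans (D.reflP j)).trans (D.reflP i)) (fun _ => rfl),
      tilde_mul_tilde (e := (((D.reflP i).trans (D.reflP j)).trans (D.reflP i)).trans
          (D.reflP j)) (fun _ => rfl), tilde_mul_tilde (e := ((((D.reflP i).trans
              (D.reflP j)).trans (D.reflP i)).trans (D.reflP j)).trans (D.reflP i)) (fun _ => rfl),
      tilde_mul_tilde (e := (((((D.reflP j).trans (D.reflP i)).trans (D.reflP j)).trans
          (D.reflP i)).trans (D.reflP j)).trans (D.reflP i))]
    intro l
    ext x
    simp only [AddEquiv.trans_apply, D.reflP_apply_apply, D.pairing, D.a_diag, h1, h2]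
    ring
  simp only [List.map_cons, List.map_nil, List.prod_cons, List.prod_nil, mul_one] at hv
  try simp only [mul_assoc] at hv ht
  have hA := fun i b l (z : DiffAlg Qv R ≃ₐ[k] DiffAlg Qv R) =>
    mul_left_eq_of_eq (tilde_mul_adPow (k := k) D u i l b) z
  have hB := mul_left_eq_of_eq hv
  simp only [mul_assoc] at hA hB
  simp only [pow_succ, pow_zero, one_mul, birat_eq_mul, mul_assoc, tilde_mul_adPow, hA, e1, e2,
    e3, e4, e5, e6, e7, e8, e9, e10, ht]
  rw [← ht]
  exact hB _

end Twist

/-! ### Values of 𝐬_i and its restriction to the difference operator algebras. -/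

section Action

variable {k R : Type*} [CommRing k] [Ring R] [Algebra k R]
variable (D : CartanDatum I Qv) (u : I → Rˣ)

theorem birat_incl (i : I) (x : Fam Qv R) :
    birat k D u i (incl x) = incl ((fpow u i (D.coroot i) : Fam Qv R) * famMap k R (D.reflP i) x *
      (fpow u i (-D.coroot i) : Fam Qv R)) := by
  rw [map_mul, map_mul, ← tilde_incl, ← fpow_inv]
  rfl

theorem birat_incl_of (i : I) (x : Module.Dual ℤ Qv → R) :
    birat k D u i (incl (Fam.of x)) = incl (Fam.of fun l =>
      ((u i ^ l (D.coroot i) : Rˣ) : R) * x (D.reflP i l) * ((u i ^ (-l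
          (D.coroot i)) : Rˣ) : R)) := by
  rw [birat_incl]
  congr 1
  funext l
  change ((u i ^ l (D.coroot i) : Rˣ) : R) * x (D.reflP i l) *
    ((u i ^ l (-D.coroot i) : Rˣ) : R) = _
  rw [map_neg]
  rfl

/-- Moving f_i^{-α_i^∨} left through τ^{s_i(μ)} shifts λ by s_i(μ), and ⟨α_i^∨, s_i(μ)⟩ = -⟨α_i^∨,
μ⟩. The dependence on λ cancels, leaving a constant family. -/
theorem birat_tau (i : I) (m : Module.Dual ℤ Qv) :
    birat k D u i (tau R m) =
      incl (Fam.const Qv ((u i ^ (m (D.coroot i)) : Rˣ) : R)) * tau R (D.reflP i m) := by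
  have h : birat k D u i (tau R m) = incl (fpow u i (D.coroot i) : Fam Qv R) *
      tilde k R (D.reflP i) (tau R m) * incl (((fpow u i (D.coroot i))⁻¹ :
        (Fam Qv R)ˣ) : Fam Qv R) :=
    rfl
  rw [h, tilde_tau, fpow_inv, mul_assoc, tau_mul_incl, ← mul_assoc, ← map_mul]
  congr 2
  funext l
  change ((u i ^ l (D.coroot i) : Rˣ) : R) *
    ((u i ^ (l + D.reflP i m) (-D.coroot i) : Rˣ) : R) = ((u i ^ (m (D.coroot i)) : Rˣ) : R)
  rw [← Units.val_mul, ← zpow_add, LinearMap.add_apply, D.reflP_apply_eq_reflQ]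
  congr 2
  simp only [CartanDatum.reflQ, map_neg, map_sub, map_smul, D.pairing, D.a_diag, smul_eq_mul]
  ring

theorem tauFormulas : TauFormulas k D u where
  tau := birat_tau D u
  self i := by
    refine (birat_incl_of D u i fun _ => (u i : R)).trans ?_
    congr 1
    funext l
    change ((u i ^ l (D.coroot i) : Rˣ) : R) * (u i : R) * ((u i ^ (-l
        (D.coroot i)) : Rˣ) : R) = u i
    rw [← Units.val_mul, ← zpow_add_one, ← Units.val_mul, ← zpow_add]
    simp

variable {D u}

theorem famMap_mem_fracAlg {B : Set (Fam Qv R)} {i : I}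
    (hB : ∀ x ∈ B, famMap k R (D.reflP i) x ∈ B) {x : Fam Qv R} (hx : x ∈ fracAlg k u B) :
    famMap k R (D.reflP i) x ∈ fracAlg k u B := by
  have h : fracAlg k u B ≤ (fracAlg k u B).comap (famMap k R (D.reflP i)) := by
    refine Algebra.adjoin_le ?_
    rintro y (hy | ⟨j, b, rfl⟩)
    · exact Algebra.subset_adjoin (Or.inl (hB y hy))
    · exact Algebra.subset_adjoin (Or.inr ⟨j, _, famMap_fpow (k := k) D u j i b⟩)
  exact h hx

theorem fpow_mem_fracAlg (B : Set (Fam Qv R)) (i : I) (b : Qv) :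
    (fpow u i b : Fam Qv R) ∈ fracAlg k u B :=
  Algebra.subset_adjoin (Or.inr ⟨i, b, rfl⟩)

/-- It suffices to treat generators. Families are substituted and then conjugated by elements of the
algebra; for τ^μ the factor f_i^{⟨α_i^∨, μ⟩} must lie in it, which is why `hc` asks for constant
integer powers. -/
theorem birat_mem_diffSubalg {B : Set (Fam Qv R)} {i : I}
    (hB : ∀ x ∈ B, famMap k R (D.reflP i) x ∈ B)
    (hc : ∀ n : ℤ, Fam.const Qv ((u i ^ n : Rˣ) : R) ∈ B) {x : DiffAlg Qv R}
    (hx : x ∈ diffSubalg (fracAlg k u B)) :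
    birat k D u i x ∈ diffSubalg (fracAlg k u B) := by
  have h : diffSubalg (fracAlg k u B) ≤
      (diffSubalg (fracAlg k u B)).comap (birat k D u i : DiffAlg Qv R →ₐ[k] DiffAlg Qv R) := by
    refine Algebra.adjoin_le ?_
    rintro y (⟨y, hy, rfl⟩ | ⟨m, rfl⟩)
    · refine Algebra.subset_adjoin (Or.inl ⟨_, ?_, (birat_incl D u i y).symm⟩)
      exact mul_mem (mul_mem (fpow_mem_fracAlg _ _ _) (famMap_mem_fracAlg hB hy))
        (fpow_mem_fracAlg _ _ _)
    · change birat k D u i (tau R m) ∈ diffSubalg (fracAlg k u B)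
      rw [birat_tau]
      exact mul_mem (Algebra.subset_adjoin
        (Or.inl ⟨_, Algebra.subset_adjoin (Or.inl (hc _)), rfl⟩))
        (Algebra.subset_adjoin (Or.inr ⟨_, rfl⟩))
  exact h hx

/-- The universal property of the presentation: the restricted automorphisms kill every relator, and
a homomorphism is determined on generators. -/
theorem existsUnique_weylGroup_action {E : Type*} [Ring E] [Algebra k E] (X : Subalgebra k E)
    (b : I → E ≃ₐ[k] E) (hmap : ∀ i, X.map (b i : E →ₐ[k] E) = X) (sq : ∀ i, b i * b i = 1)
    (comm : ∀ i j, (D.a i j, D.a j i) = (0, 0) → b i * b j = b j * b i)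
    (braid3 : ∀ i j, (D.a i j, D.a j i) = (-1, -1) → b i * b j * b i = b j * b i * b j)
    (braid4 : ∀ i j, (D.a i j, D.a j i) = (-1, -2) → (b i * b j) ^ 2 = (b j * b i) ^ 2)
    (braid6 : ∀ i j, (D.a i j, D.a j i) = (-1, -3) → (b i * b j) ^ 3 = (b j * b i) ^ 3) :
    ∃! r : D.WeylGroup →* (X ≃ₐ[k] X), ∀ (i : I) (x : X), (r (D.simple i) x : E) = b i x := by
  let g : I → (X ≃ₐ[k] X) := fun i =>
    ((b i).subalgebraMap X).trans (Subalgebra.equivOfEq _ _ (hmap i))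
  have hg : ∀ i (x : X), (g i x : E) = b i x := fun i x => rfl
  have hrel : ∀ r ∈ {r : FreeGroup I | D.WeylRelator r}, FreeGroup.lift g r = 1 := by
    rintro r (i | ⟨i, j, hij⟩ | ⟨i, j, hij⟩ | ⟨i, j, hij⟩ | ⟨i, j, hij⟩)
    · rw [map_pow, FreeGroup.lift_apply_of, pow_two]
      exact AlgEquiv.ext fun x => Subtype.ext (DFunLike.congr_fun (sq i) (x : E))
    · rw [map_mul, map_inv, mul_inv_eq_one]
      simp only [map_mul, FreeGroup.lift_apply_of]
      exact AlgEquiv.ext fun x => Subtype.ext (DFunLike.congr_fun (comm i j hij) (x : E))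
    · rw [map_mul, map_inv, mul_inv_eq_one]
      simp only [map_mul, FreeGroup.lift_apply_of]
      exact AlgEquiv.ext fun x => Subtype.ext (DFunLike.congr_fun (braid3 i j hij) (x : E))
    · rw [map_mul, map_inv, mul_inv_eq_one]
      simp only [map_mul, map_pow, FreeGroup.lift_apply_of]
      exact AlgEquiv.ext fun x => Subtype.ext (DFunLike.congr_fun (braid4 i j hij) (x : E))
    · rw [map_mul, map_inv, mul_inv_eq_one]
      simp only [map_mul, map_pow, FreeGroup.lift_apply_of]
      exact AlgEquiv.ext fun x => Subtype.ext (DFunLike.congr_fun (braid6 i j hij) (x : E))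
  refine ⟨PresentedGroup.toGroup hrel, fun i x => ?_, fun r hr => ?_⟩
  · rw [CartanDatum.simple, PresentedGroup.toGroup.of]
    exact hg i x
  · refine PresentedGroup.ext fun i => ?_
    rw [PresentedGroup.toGroup.of]
    exact AlgEquiv.ext fun x => Subtype.ext (hr i x)

theorem isWeylAction {B : Set (Fam Qv R)} (hv : VermaIdentities D u)
    (hB : ∀ i, ∀ x ∈ B, famMap k R (D.reflP i) x ∈ B)
    (hc : ∀ i, ∀ n : ℤ, Fam.const Qv ((u i ^ n : Rˣ) : R) ∈ B) :
    IsWeylAction k D u (diffSubalg (fracAlg k u B)) := by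
  have hmap : ∀ i, (diffSubalg (fracAlg k u B)).map
      (birat k D u i : DiffAlg Qv R →ₐ[k] DiffAlg Qv R) = diffSubalg (fracAlg k u B) := by
    intro i
    -- An involution mapping the subalgebra into itself maps it onto itself.
    refine le_antisymm ?_ fun x hx => ⟨_, birat_mem_diffSubalg (hB i) (hc i) hx,
      DFunLike.congr_fun (birat_mul_self (k := k) D u i) x⟩
    rintro _ ⟨x, hx, rfl⟩
    exact birat_mem_diffSubalg (hB i) (hc i) hx
  exact
    { map_eq := hmap
      sq := fun i x _ => DFunLike.congr_fun (birat_mul_self (k := k) D u i) x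
      comm := fun i j hij x _ => DFunLike.congr_fun (birat_commute (k := k) hv hij) x
      braid3 := fun i j hij x _ => DFunLike.congr_fun (birat_braid3 (k := k) hv hij) x
      braid4 := fun i j hij x _ => DFunLike.congr_fun (birat_braid4 (k := k) hv hij) x
      braid6 := fun i j hij x _ => DFunLike.congr_fun (birat_braid6 (k := k) hv hij) x
      action := existsUnique_weylGroup_action _ _ hmap (birat_mul_self D u)
        (fun _ _ => birat_commute hv) (fun _ _ => birat_braid3 hv) (fun _ _ => birat_braid4 hv)
        (fun _ _ => birat_braid6 hv) }

end Action

/-! ### Substitution in parameter variables, before and after localization. -/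

section Parameters

variable {k : Type*} [CommRing k] {M : Type*} [AddCommMonoid M]
variable {ev : Module.Dual ℤ Qv → Multiplicative M →* k}

theorem subst_single (R : Type*) [Ring R] [Algebra k R] (l : Module.Dual ℤ Qv) (m : M) (r : R) :
    subst ev R l (AddMonoidAlgebra.single m r) =
      r * algebraMap k R (ev l (Multiplicative.ofAdd m)) :=
  AddMonoidAlgebra.liftNC_single _ _ _ _

/-- An involution of the parameter algebra over `k` extends to any coefficient algebra. -/
theorem exists_involution_of_subst (θ : AddMonoidAlgebra k M →ₐ[k] AddMonoidAlgebra k M)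
    (hθ : ∀ x, θ (θ x) = x) {w : Module.Dual ℤ Qv → Module.Dual ℤ Qv}
    (hw : ∀ l m, subst ev k l (θ (AddMonoidAlgebra.single m 1)) = ev (w l) (Multiplicative.ofAdd m))
    (R : Type*) [Ring R] [Algebra k R] :
    ∃ σ : AddMonoidAlgebra R M →+* AddMonoidAlgebra R M, (∀ x, σ (σ x) = x) ∧
      ∀ l x, subst ev R l (σ x) = subst ev R (w l) x := by
  let ι : AddMonoidAlgebra k M →ₐ[k] AddMonoidAlgebra R M :=
    AddMonoidAlgebra.mapAlgHom M (Algebra.ofId k R)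
  have hι : ∀ m c, ι (AddMonoidAlgebra.single m c) = AddMonoidAlgebra.single m (algebraMap k R c) :=
    fun m c => AddMonoidAlgebra.mapAlgHom_single _ _ _
  -- Parameters are central even though R is noncommutative; this is what allows θ to be combined
  -- with the identity on coefficients into a ring homomorphism.
  have hcomm : ∀ (r : R) x, Commute (AddMonoidAlgebra.single (0 : M) r) (ι x) := by
    intro r x
    induction x using AddMonoidAlgebra.induction_linear with
    | zero => simp
    | add x y hx hy => rw [map_add]; exact hx.add_right hy
    | single m c =>
      rw [hι, Commute, SemiconjBy, AddMonoidAlgebra.single_mul_single,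
        AddMonoidAlgebra.single_mul_single, zero_add, add_zero, Algebra.commutes]
  let σ : AddMonoidAlgebra R M →+* AddMonoidAlgebra R M :=
    AddMonoidAlgebra.liftNCRingHom AddMonoidAlgebra.singleZeroRingHom
      ((((ι.comp θ : AddMonoidAlgebra k M →ₐ[k] AddMonoidAlgebra R M) :
        AddMonoidAlgebra k M →+* AddMonoidAlgebra R M) :
        AddMonoidAlgebra k M →* AddMonoidAlgebra R M).comp (AddMonoidAlgebra.of k M))
      (fun r m => hcomm r _)
  have hσ : ∀ m r, σ (AddMonoidAlgebra.single m r) =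
      AddMonoidAlgebra.single 0 r * ι (θ (AddMonoidAlgebra.single m 1)) :=
    fun m r => AddMonoidAlgebra.liftNC_single _ _ _ _
  have hσι : ∀ x, σ (ι x) = ι (θ x) := by
    intro x
    induction x using AddMonoidAlgebra.induction_linear with
    | zero => simp
    | add x y hx hy => rw [map_add, map_add, hx, hy, map_add, map_add]
    | single m c =>
      have h : AddMonoidAlgebra.single m c = c •
          (AddMonoidAlgebra.single m 1 : AddMonoidAlgebra k M) := by
        simp
      rw [hι, hσ, h, map_smul, map_smul, Algebra.smul_def]
      rfl
  have hσ0 : ∀ r, σ (AddMonoidAlgebra.single 0 r) = AddMonoidAlgebra.single 0 r := by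
    intro r
    rw [hσ, ← AddMonoidAlgebra.one_def, map_one, map_one, mul_one]
  have hsι : ∀ l x, subst ev R l (ι x) = algebraMap k R (subst ev k l x) := by
    intro l x
    induction x using AddMonoidAlgebra.induction_linear with
    | zero => simp
    | add x y hx hy => rw [map_add, map_add, hx, hy, map_add, map_add]
    | single m c => rw [hι, subst_single, subst_single, map_mul]; rfl
  refine ⟨σ, fun x => ?_, fun l x => ?_⟩
  · induction x using AddMonoidAlgebra.induction_linear with
    | zero => simp
    | add x y hx hy => rw [map_add, map_add, hx, hy]
    | single m c =>
      rw [hσ, map_mul, hσ0, hσι, hθ, hι, AddMonoidAlgebra.single_mul_single, zero_add, map_one,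
        mul_one]
  · induction x using AddMonoidAlgebra.induction_linear with
    | zero => simp
    | add x y hx hy => rw [map_add, map_add, hx, hy, map_add]
    | single m c =>
      rw [hσ, map_mul, hsι, hw, subst_single, subst_single, ofAdd_zero, map_one, map_one, mul_one]

theorem const_mem_paramImage {R : Type*} [Ring R] [Algebra k R] (r : R) :
    Fam.const Qv r ∈ paramImage ev R := by
  refine ⟨AddMonoidAlgebra.single 0 r, funext fun l => ?_⟩
  change subst ev R l _ = r
  rw [subst_single, ofAdd_zero, map_one, map_one, mul_one]

/-- Replacing a parameter element a by σ(a) realizes the substitution in λ on the family of its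
values. -/
theorem famMap_mem_paramImage {R : Type*} [Ring R] [Algebra k R]
    {w : Module.Dual ℤ Qv ≃+ Module.Dual ℤ Qv}
    {σ : AddMonoidAlgebra R M →+* AddMonoidAlgebra R M}
    (hσ : ∀ l x, subst ev R l (σ x) = subst ev R (w.symm l) x) {x : Fam Qv R}
    (hx : x ∈ paramImage ev R) : famMap k R w x ∈ paramImage ev R := by
  obtain ⟨a, rfl⟩ := hx
  exact ⟨σ a, funext fun l => hσ l a⟩

variable [UniqueSums M] {A : Type*} [Ring A] [Algebra k A] [LeftOreDomain A]

theorem toFrac_ne_zero {B : Type*} [Ring B] [LeftOreDomain B] {a : B} (ha : a ≠ 0) :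
    (toFrac a : SkewFrac B) ≠ 0 :=
  (map_ne_zero_iff toFrac toFrac_injective).mpr ha

theorem const_mem_paramLocImage (a : A) {s : A} (hs : s ≠ 0) :
    Fam.const Qv ((toFrac a : SkewFrac A) * (toFrac s)⁻¹) ∈ paramLocImage ev A := by
  have h0 : ∀ l b, subst ev A l (AddMonoidAlgebra.single 0 b) = b := fun l b => by
    rw [subst_single, ofAdd_zero, map_one, map_one, mul_one]
  refine ⟨toFrac (AddMonoidAlgebra.single 0 a) * (toFrac (AddMonoidAlgebra.single 0 s))⁻¹,
    fun l => ⟨_, _, ?_, rfl, ?_⟩⟩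
  · rwa [h0]
  · rw [h0, h0]; rfl

theorem const_fracUnit_zpow_mem_paramLocImage (f : I → A) (hf : ∀ i, f i ≠ 0) (i : I) (n : ℤ) :
    Fam.const Qv (((fracUnit f hf i ^ n : (SkewFrac A)ˣ)) : SkewFrac A) ∈ paramLocImage ev A := by
  obtain ⟨n, rfl | rfl⟩ := n.eq_nat_or_neg
  · have h := const_mem_paramLocImage (Qv := Qv) (ev := ev) (f i ^ n) (one_ne_zero (α := A))
    rw [map_one, inv_one, mul_one, map_pow] at h
    exact h
  · have h := const_mem_paramLocImage (Qv := Qv) (ev := ev) 1 (pow_ne_zero n (hf i))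
    rw [map_one, one_mul, map_pow] at h
    rw [Units.val_zpow_eq_zpow_val, zpow_neg, zpow_natCast]
    exact h

/-- An injective endomorphism of a left Ore domain extends to its skew field of fractions. -/
theorem exists_extension_toFrac {B : Type*} [Ring B] [LeftOreDomain B] (σ : B →+* B)
    (hσ : Function.Injective σ) :
    ∃ τ : SkewFrac B →+* SkewFrac B, ∀ b, τ (toFrac b) = toFrac (σ b) := by
  let fS : nonZeroDivisors B →* (SkewFrac B)ˣ :=
    { toFun := fun s => Units.mk0 (toFrac (σ s)) (toFrac_ne_zero
        ((map_ne_zero_iff σ hσ).mpr (nonZeroDivisors.ne_zero s.2)))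
      map_one' := Units.ext (by rw [Units.val_mk0, Submonoid.coe_one, map_one, map_one]; rfl)
      map_mul' := fun a b => Units.ext (by
        rw [Units.val_mk0, Submonoid.coe_mul, map_mul, map_mul]; rfl) }
  exact ⟨OreLocalization.universalHom ((toFrac : B →+* SkewFrac B).comp σ) fS (fun _ => rfl),
    fun b => OreLocalization.universalHom_commutes ((toFrac : B →+* SkewFrac B).comp σ) fS
      (fun _ => rfl)⟩

/-- The extension of σ to fractions sends a representation a s⁻¹ valid at w⁻¹(λ) to σ(a) σ(s)⁻¹
valid at λ: the denominator stays nonzero because φ_λ(σ(s)) = φ_{w⁻¹(λ)}(s). -/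
theorem famMap_mem_paramLocImage {w : Module.Dual ℤ Qv ≃+ Module.Dual ℤ Qv}
    {σ : AddMonoidAlgebra A M →+* AddMonoidAlgebra A M} (hinv : ∀ x, σ (σ x) = x)
    (hσ : ∀ l x, subst ev A l (σ x) = subst ev A (w.symm l) x) {x : Fam Qv (SkewFrac A)}
    (hx : x ∈ paramLocImage ev A) : famMap k (SkewFrac A) w x ∈ paramLocImage ev A := by
  obtain ⟨z, hz⟩ := hx
  obtain ⟨τ, hτ⟩ := exists_extension_toFrac σ (Function.LeftInverse.injective hinv)
  refine ⟨τ z, fun l => ?_⟩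
  obtain ⟨a, s, hs, h1, h2⟩ := hz (w.symm l)
  refine ⟨σ a, σ s, by rwa [hσ], ?_, ?_⟩
  · rw [h1, map_mul, map_inv₀, hτ, hτ]
  · rw [hσ, hσ]
    exact h2

end Parameters

/-! ### The involution of the parameter algebra induced by a simple reflection. -/

section Involutions

theorem CartanDatum.reflQ_reflQ (D : CartanDatum I Qv) (i : I) (b : Qv) :
    D.reflQ i (D.reflQ i b) = b := by
  simp only [CartanDatum.reflQ, map_sub, map_smul, D.pairing, D.a_diag, smul_eq_mul]
  module

/-- s_i acts linearly on the span of the basis variables and extends to polynomials; compatibility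
with evaluation is the adjointness of the two reflections. -/
theorem KM.exists_involution [Module.Free ℤ Qv] (D : CartanDatum I Qv) (i : I) (R : Type*) [Ring R]
    [Algebra ℂ R] :
    ∃ σ : AddMonoidAlgebra R (Module.Free.ChooseBasisIndex ℤ Qv →₀ ℕ) →+*
        AddMonoidAlgebra R (Module.Free.ChooseBasisIndex ℤ Qv →₀ ℕ), (∀ x, σ (σ x) = x) ∧
      ∀ l x, subst (KM.ev Qv) R l (σ x) = subst (KM.ev Qv) R (D.reflP i l) x := by
  let B := Module.Free.chooseBasis ℤ Qv
  -- `V` places β in the polynomial ring as a linear form, so s_i can be described without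
  -- coordinates.
  let V : Qv →ₗ[ℤ] MvPolynomial (Module.Free.ChooseBasisIndex ℤ Qv) ℂ :=
    B.constr ℤ MvPolynomial.X
  have hV : ∀ a, V (B a) = MvPolynomial.X a := fun a => B.constr_basis ℤ _ a
  let s : Qv →ₗ[ℤ] Qv := LinearMap.id - (D.root i).smulRight (D.coroot i)
  have hs : ∀ b, s b = D.reflQ i b := fun b => rfl
  let θ : MvPolynomial (Module.Free.ChooseBasisIndex ℤ Qv) ℂ →ₐ[ℂ]
      MvPolynomial (Module.Free.ChooseBasisIndex ℤ Qv) ℂ :=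
    MvPolynomial.aeval fun a => V (D.reflQ i (B a))
  have hθX : ∀ a, θ (MvPolynomial.X a) = V (D.reflQ i (B a)) := fun a => MvPolynomial.aeval_X _ a
  have hθV : ∀ b, θ (V b) = V (D.reflQ i b) := by
    have h : (θ.toLinearMap.restrictScalars ℤ) ∘ₗ V = V ∘ₗ s := by
      refine B.ext fun a => ?_
      change θ (V (B a)) = V (D.reflQ i (B a))
      rw [hV, hθX]
    exact fun b => LinearMap.congr_fun h b
  have hθθ : ∀ x, θ (θ x) = x := by
    have h : θ.comp θ = AlgHom.id ℂ _ := by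
      refine MvPolynomial.algHom_ext fun a => ?_
      change θ (θ (MvPolynomial.X a)) = MvPolynomial.X a
      rw [hθX, hθV, D.reflQ_reflQ, hV]
    exact fun x => DFunLike.congr_fun h x
  have hsub : ∀ l : Module.Dual ℤ Qv, ∃ φ : MvPolynomial
      (Module.Free.ChooseBasisIndex ℤ Qv) ℂ →ₐ[ℂ] ℂ, (∀ x, φ x = subst (KM.ev Qv) ℂ l x) ∧ ∀ b,
        φ (V b) = ((l b : ℤ) : ℂ) := by
    intro l
    let φ : MvPolynomial (Module.Free.ChooseBasisIndex ℤ Qv) ℂ →ₐ[ℂ] ℂ := subst (KM.ev Qv) ℂ l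
    have h : (φ.toLinearMap.restrictScalars ℤ) ∘ₗ V = (Algebra.linearMap ℤ ℂ) ∘ₗ l := by
      refine B.ext fun a => ?_
      change φ (V (B a)) = algebraMap ℤ ℂ (l (B a))
      rw [hV]
      refine (subst_single (ev := KM.ev Qv) ℂ l (Finsupp.single a 1) 1).trans ?_
      rw [one_mul]
      exact (Finsupp.prod_single_index (h := fun a n => ((l (B a) : ℤ) : ℂ) ^ n)
        (pow_zero _)).trans (pow_one _)
    exact ⟨φ, fun x => rfl, fun b => LinearMap.congr_fun h b⟩
  refine exists_involution_of_subst (ev := KM.ev Qv) θ hθθ (w := D.reflP i) (fun l m => ?_) R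
  obtain ⟨φ, hφ, hφV⟩ := hsub l
  obtain ⟨ψ, hψ, hψV⟩ := hsub (D.reflP i l)
  have h : φ.comp θ = ψ := by
    refine MvPolynomial.algHom_ext fun a => ?_
    change φ (θ (MvPolynomial.X a)) = ψ (MvPolynomial.X a)
    rw [hθX, hφV, ← hV, hψV, D.reflP_apply_eq_reflQ]
  rw [← hφ]
  refine (DFunLike.congr_fun h _).trans ?_
  rw [hψ, subst_single, one_mul]
  rfl

/-- Functoriality of the group algebra for the additive involution s_i. -/
theorem QD.exists_involution (D : CartanDatum I Qv) (i : I) (R : Type*) [Ring R]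
    [Algebra QD.Cq R] :
    ∃ σ : AddMonoidAlgebra R Qv →+* AddMonoidAlgebra R Qv, (∀ x, σ (σ x) = x) ∧
      ∀ l x, subst (QD.ev Qv) R l (σ x) = subst (QD.ev Qv) R (D.reflP i l) x := by
  let s : Qv →+ Qv := (LinearMap.id - (D.root i).smulRight (D.coroot i) : Qv →ₗ[ℤ] Qv)
  have hs : ∀ b, s b = D.reflQ i b := fun b => rfl
  refine exists_involution_of_subst (ev := QD.ev Qv)
      (AddMonoidAlgebra.mapDomainAlgHom QD.Cq QD.Cq s)
    (fun x => ?_) (w := D.reflP i) (fun l m => ?_) R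
  · induction x using AddMonoidAlgebra.induction_linear with
    | zero => simp
    | add x y hx hy => rw [map_add, map_add, hx, hy]
    | single m c => simp [hs, D.reflQ_reflQ]
  · simp only [AddMonoidAlgebra.mapDomainAlgHom_apply, AddMonoidAlgebra.mapDomain_single]
    rw [subst_single, one_mul, hs]
    change QD.q ^ (l (D.reflQ i m)) = QD.q ^ (D.reflP i l m)
    rw [D.reflP_apply_eq_reflQ]

theorem KM.famMap_mem_paramImage [Module.Free ℤ Qv] (D : CartanDatum I Qv) (i : I)
    {R : Type*} [Ring R] [Algebra ℂ R] {x : Fam Qv R} (hx : x ∈ paramImage (KM.ev Qv) R) :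
    famMap ℂ R (D.reflP i) x ∈ paramImage (KM.ev Qv) R := by
  obtain ⟨σ, _, hσ⟩ := KM.exists_involution D i R
  have hσ' : ∀ l x, subst (KM.ev Qv) R l (σ x) =
      subst (KM.ev Qv) R ((D.reflP i).symm l) x := by rwa [D.reflP_symm]
  exact QBW.famMap_mem_paramImage hσ' hx

theorem KM.famMap_mem_paramLocImage [Module.Free ℤ Qv] (D : CartanDatum I Qv) (i : I)
    {A : Type*} [Ring A] [Algebra ℂ A] [LeftOreDomain A] {x : Fam Qv (SkewFrac A)}
    (hx : x ∈ paramLocImage (KM.ev Qv) A) :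
    famMap ℂ (SkewFrac A) (D.reflP i) x ∈ paramLocImage (KM.ev Qv) A := by
  obtain ⟨σ, hinv, hσ⟩ := KM.exists_involution D i A
  have hσ' : ∀ l x, subst (KM.ev Qv) A l (σ x) =
      subst (KM.ev Qv) A ((D.reflP i).symm l) x := by rwa [D.reflP_symm]
  exact QBW.famMap_mem_paramLocImage hinv hσ' hx

theorem QD.famMap_mem_paramImage (D : CartanDatum I Qv) (i : I)
    {R : Type*} [Ring R] [Algebra QD.Cq R] {x : Fam Qv R} (hx : x ∈ paramImage (QD.ev Qv) R) :
    famMap QD.Cq R (D.reflP i) x ∈ paramImage (QD.ev Qv) R := by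
  obtain ⟨σ, _, hσ⟩ := QD.exists_involution D i R
  have hσ' : ∀ l x, subst (QD.ev Qv) R l (σ x) =
      subst (QD.ev Qv) R ((D.reflP i).symm l) x := by rwa [D.reflP_symm]
  exact QBW.famMap_mem_paramImage hσ' hx

theorem QD.famMap_mem_paramLocImage [UniqueSums Qv] (D : CartanDatum I Qv) (i : I)
    {A : Type*} [Ring A] [Algebra QD.Cq A] [LeftOreDomain A] {x : Fam Qv (SkewFrac A)}
    (hx : x ∈ paramLocImage (QD.ev Qv) A) :
    famMap QD.Cq (SkewFrac A) (D.reflP i) x ∈ paramLocImage (QD.ev Qv) A := by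
  obtain ⟨σ, hinv, hσ⟩ := QD.exists_involution D i A
  have hσ' : ∀ l x, subst (QD.ev Qv) A l (σ x) =
      subst (QD.ev Qv) A ((D.reflP i).symm l) x := by rwa [D.reflP_symm]
  exact QBW.famMap_mem_paramLocImage hinv hσ' hx

end Involutions

/-! ### Verma identities for fractional powers, from the rank two identities. -/

section Verma

variable {R : Type*} [Ring R]

theorem CartanDatum.ne_of_nonpos (D : CartanDatum I Qv) {i j : I} (h : D.a i j ≤ 0) : i ≠ j := by
  rintro rfl
  rw [D.a_diag] at h
  omega

theorem units_commute_zpow {X Y : Rˣ} (h : (X : R) * Y = Y * X) (r s : ℤ) :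
    X ^ r * Y ^ s = Y ^ s * X ^ r :=
  ((show Commute X Y from Units.ext h).zpow_zpow r s).eq

/-- Products in R^P are taken pointwise; at λ the exponents are r = ⟨β, λ⟩ and s = ⟨γ, λ⟩. -/
theorem vermaIdentities_of_zpow {D : CartanDatum I Qv} {u : I → Rˣ}
    (h2 : ∀ i j, (D.a i j, D.a j i) = (0, 0) → ∀ r s : ℤ, u i ^ r * u j ^ s = u j ^ s * u i ^ r)
    (h3 : ∀ i j, (D.a i j, D.a j i) = (-1, -1) → ∀ r s : ℤ,
      u i ^ r * u j ^ (r + s) * u i ^ s = u j ^ s * u i ^ (r + s) * u j ^ r)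
    (h4 : ∀ i j, (D.a i j, D.a j i) = (-1, -2) → ∀ r s : ℤ,
      u i ^ r * u j ^ (2 * r + s) * u i ^ (r + s) * u j ^ s =
        u j ^ s * u i ^ (r + s) * u j ^ (2 * r + s) * u i ^ r)
    (h6 : ∀ i j, (D.a i j, D.a j i) = (-1, -3) → ∀ r s : ℤ,
      u i ^ r * u j ^ (3 * r + s) * u i ^ (2 * r + s) * u j ^ (3 * r + 2 * s) * u i ^ (r + s) *
          u j ^ s =
        u j ^ s * u i ^ (r + s) * u j ^ (3 * r + 2 * s) * u i ^ (2 * r + s) * u j ^ (3 * r + s) *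
          u i ^ r) : VermaIdentities D u where
  verma2 i j b c hij := by
    refine Units.ext (funext fun l => ?_)
    exact congrArg Units.val (h2 i j hij (l b) (l c))
  verma3 i j b c hij := by
    refine Units.ext (funext fun l => ?_)
    have h := congrArg Units.val (h3 i j hij (l b) (l c))
    simp only [← map_add] at h
    exact h
  verma4 i j b c hij := by
    refine Units.ext (funext fun l => ?_)
    have h := congrArg Units.val (h4 i j hij (l b) (l c))
    have e : 2 * l b + l c = l (2 • b + c) := by rw [map_add, map_nsmul, nsmul_eq_mul]; rfl
    simp only [e, ← map_add] at h
    exact h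
  verma6 i j b c hij := by
    refine Units.ext (funext fun l => ?_)
    have h := congrArg Units.val (h6 i j hij (l b) (l c))
    have e : 2 * l b + l c = l (2 • b + c) := by rw [map_add, map_nsmul, nsmul_eq_mul]; rfl
    have e' : 3 * l b + l c = l (3 • b + c) := by rw [map_add, map_nsmul, nsmul_eq_mul]; rfl
    have e'' : 3 * l b + 2 * l c = l (3 • b + 2 • c) := by
      rw [map_add, map_nsmul, map_nsmul, nsmul_eq_mul, nsmul_eq_mul]; rfl
    simp only [e, e', e'', ← map_add] at h
    exact h

theorem KM.vermaIdentities [Algebra ℂ R] {D : CartanDatum I Qv} {u : I → Rˣ}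
    (hs : ∀ i j, i ≠ j →
      (fun x : R => u i * x - x * u i)^[(1 - D.a i j).toNat] (u j : R) = 0) :
    VermaIdentities D u := by
  refine vermaIdentities_of_zpow (fun i j hij => ?_) (fun i j hij => ?_) (fun i j hij => ?_)
    (fun i j hij => ?_)
  all_goals
    obtain ⟨h1, h2⟩ := Prod.mk.inj hij
    have hne : i ≠ j := D.ne_of_nonpos (by omega)
    have hx := hs i j hne
    have hy := hs j i hne.symm
    rw [h1] at hx
    rw [h2] at hy
  · exact units_commute_zpow (sub_eq_zero.mp hx)
  · obtain ⟨_, h⟩ := exists_relA2 (k := ℂ) hx hy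
    exact h.verma
  · obtain ⟨_, _, h⟩ := exists_relB2 (k := ℂ) hx hy
    exact h.verma
  · obtain ⟨_, _, _, _, h⟩ := exists_relG2 (k := ℂ) hx hy
    exact h.verma

theorem QD.qi_ne_zero (D : CartanDatum I Qv) (i : I) : QD.qi D i ≠ 0 :=
  pow_ne_zero _ QD.q_ne_zero

theorem QD.qi_pow_ne_one (D : CartanDatum I Qv) (i : I) {n : ℕ} (hn : 0 < n) :
    QD.qi D i ^ n ≠ 1 := by
  rw [QD.qi, ← pow_mul]
  exact QD.q_pow_ne_one _ (Nat.mul_pos (D.d_pos i) hn)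

theorem QD.qi_pow_sub_inv_pow_ne_zero (D : CartanDatum I Qv) (i : I) {n : ℕ} (hn : 0 < n) :
    QD.qi D i ^ n - (QD.qi D i)⁻¹ ^ n ≠ 0 := by
  intro h
  rw [sub_eq_zero, inv_pow, ← mul_eq_one_iff_eq_inv₀ (pow_ne_zero _ (QD.qi_ne_zero D i)),
    ← pow_add] at h
  exact QD.qi_pow_ne_one D i (by omega) h

/-- Put v = q_j. For entries (-1, -m) the symmetry d_i a_ij = d_j a_ji gives d_i = m d_j, hence q_i
= v^m: f_i is the long and f_j the short root vector when m > 1. -/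
theorem QD.vermaIdentities [Algebra QD.Cq R] {D : CartanDatum I Qv} {u : I → Rˣ}
    (hs : ∀ i j, i ≠ j →
      qAd (QD.qi D i) (D.a i j) (u i : R) (u j : R) (1 - D.a i j).toNat = 0) :
    VermaIdentities D u := by
  refine vermaIdentities_of_zpow (fun i j hij => ?_) (fun i j hij => ?_) (fun i j hij => ?_)
    (fun i j hij => ?_)
  all_goals
    obtain ⟨h1, h2⟩ := Prod.mk.inj hij
    have hne : i ≠ j := D.ne_of_nonpos (by omega)
    have hx := hs i j hne
    have hy := hs j i hne.symm
    have hd := D.symm i j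
    rw [h1] at hx hd
    rw [h2] at hy hd
    have hv := QD.qi_ne_zero D j
    have hp := fun n hn => QD.qi_pow_ne_one D j (n := n) hn
    have hm := fun n hn => QD.qi_pow_sub_inv_pow_ne_zero D j (n := n) hn
    have hm1 := hm 1 one_pos
    rw [pow_one, pow_one] at hm1
  · refine units_commute_zpow (sub_eq_zero.mp ?_)
    simpa [qAd] using hx
  · rw [show QD.qi D i = QD.qi D j by rw [QD.qi, QD.qi, show D.d i = D.d j by omega]] at hx
    obtain ⟨_, h⟩ := exists_qRelA2 hv hm1 hx hy
    exact h.verma hv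
  · rw [show QD.qi D i = QD.qi D j ^ 2 by
      rw [QD.qi, QD.qi, ← pow_mul, show D.d i = D.d j * 2 by omega]] at hx
    obtain ⟨_, _, h⟩ := exists_qRelB2 hv hm1 (hm 2 two_pos) hx hy
    exact h.verma hv
  · rw [show QD.qi D i = QD.qi D j ^ 3 by
      rw [QD.qi, QD.qi, ← pow_mul, show D.d i = D.d j * 3 by omega]] at hx
    -- v⁴ - v² + 1 divides v¹² - 1 with cofactor (v² + 1)(v⁶ - 1), and below v⁴ + 1 divides v⁸ - 1.
    -- Neither vanishes, since v is not a root of unity.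
    have h12 : QD.qi D j ^ 4 - QD.qi D j ^ 2 + 1 ≠ 0 := fun h => hp 12 (by norm_num) <| by
      linear_combination (QD.qi D j ^ 2 + 1) * (QD.qi D j ^ 6 - 1) * h
    have h8 : QD.qi D j ^ 4 + 1 ≠ 0 := fun h => hp 8 (by norm_num) <| by
      linear_combination (QD.qi D j ^ 4 - 1) * h
    obtain ⟨_, _, _, _, h⟩ := exists_qRelG2 hv hm1 (hm 2 two_pos) (hm 3 three_pos) h12 h8 hx hy
    exact h.verma hv

end Verma

/-! ### Explicit images of the parameter and dependent variables. -/

section Formulas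

variable {R : Type*} [Ring R]

theorem KM.formulas [Algebra ℂ R] {D : CartanDatum I Qv} {u : I → Rˣ}
    (hs : ∀ i j, i ≠ j →
      (fun x : R => u i * x - x * u i)^[(1 - D.a i j).toNat] (u j : R) = 0) :
    KM.Formulas D u where
  param i b := by
    rw [birat_incl_of]
    congr 2
    funext l
    rw [D.reflP_apply_eq_reflQ, ← Int.cast_comm, mul_assoc, ← Units.val_mul, ← zpow_add,
      add_neg_cancel, zpow_zero, Units.val_one, mul_one]
  dep i j hij := by
    refine (birat_incl_of D u i fun _ => (u j : R)).trans ?_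
    congr 2
    funext l
    have h := hs i j hij
    rw [show (1 - D.a i j).toNat = (-D.a i j).toNat + 1 by
      have := D.a_nonpos i j hij
      omega] at h
    rw [units_zpow_mul_eq_sum_ad (u i) (u j : R) h, mul_assoc, ← Units.val_mul, ← zpow_add,
      add_neg_cancel, zpow_zero, Units.val_one, mul_one]

theorem QD.formulas [Algebra QD.Cq R] {D : CartanDatum I Qv} {u : I → Rˣ}
    (hs : ∀ i j, i ≠ j →
      qAd (QD.qi D i) (D.a i j) (u i : R) (u j : R) (1 - D.a i j).toNat = 0) :
    QD.Formulas D u where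
  param i b := by
    rw [birat_incl_of]
    congr 2
    funext l
    rw [D.reflP_apply_eq_reflQ, ← Algebra.commutes, mul_assoc, ← Units.val_mul, ← zpow_add,
      add_neg_cancel, zpow_zero, Units.val_one, mul_one]
  dep i j hij := by
    refine (birat_incl_of D u i fun _ => (u j : R)).trans ?_
    congr 2
    funext l
    have h := hs i j hij
    rw [show (1 - D.a i j).toNat = (-D.a i j).toNat + 1 by
      have := D.a_nonpos i j hij
      omega] at h
    rw [units_zpow_mul_eq_sum_qAd (QD.qi_ne_zero D i) (QD.qFact_ne_zero D i) _ (u i) (u j : R) h,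
      mul_assoc, ← Units.val_mul, ← zpow_add, add_neg_cancel, zpow_zero, Units.val_one, mul_one]

end Formulas

/-! ### Transport of the Serre relations along homomorphisms out of A. -/

section Serre

attribute [local instance] LieRing.ofAssociativeRing

theorem ad_pow_apply_eq_iterate {k A : Type*} [CommRing k] [Ring A] [Algebra k A] (x y : A)
    (n : ℕ) :
    ((LieAlgebra.ad k A x) ^ n) y = (fun z => x * z - z * x)^[n] y := by
  induction n with
  | zero => rfl
  | succ n ih =>
    rw [pow_succ', Module.End.mul_apply, ih, Function.iterate_succ_apply']
    rfl

theorem KM.Residue.serre_iterate {D : CartanDatum I Qv} {A : Type*} [Ring A] [Algebra ℂ A]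
    (Q : KM.Residue D A) {i j : I} (hij : i ≠ j) {R : Type*} [Ring R] (g : A →+* R) :
    (fun z => g (Q.f i) * z - z * g (Q.f i))^[(1 - D.a i j).toNat] (g (Q.f j)) = 0 := by
  have h : Function.Semiconj g (fun z => Q.f i * z - z * Q.f i)
      (fun z => g (Q.f i) * z - z * g (Q.f i)) := fun z => by simp
  rw [← (h.iterate_right _).eq, ← ad_pow_apply_eq_iterate (k := ℂ), Q.serre i j hij, map_zero]

end Serre

theorem QD.Residue.qAd_eq_zero {D : CartanDatum I Qv} {A : Type*} [Ring A] [Algebra QD.Cq A]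
    (Q : QD.Residue D A) {i j : I} (hij : i ≠ j) {R : Type*} [Ring R] [Algebra QD.Cq R]
    (g : A →ₐ[QD.Cq] R) :
    qAd (QD.qi D i) (D.a i j) (g (Q.f i)) (g (Q.f j)) (1 - D.a i j).toNat = 0 := by
  refine QBW.qAd_eq_zero (QD.qi_ne_zero D i) (QD.qFact_ne_zero D i) ?_ ?_
  · have := D.a_nonpos i j hij
    omega
  · rw [← QD.map_serreSum, Q.serre i j hij, map_zero]

/-! ### Assembly over the localization at the f_i and over the skew field of fractions. -/

/-- The embedding into an Ore localization as an algebra homomorphism. -/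
noncomputable def numeratorAlgHom (k : Type*) {A : Type*} [CommRing k] [Ring A] [Algebra k A]
    (S : Submonoid A) [OreLocalization.OreSet S] : A →ₐ[k] OreLocalization S A :=
  { (OreLocalization.numeratorRingHom : A →+* OreLocalization S A) with commutes' := fun _ => rfl }

theorem KM.weylAction_localized (D : CartanDatum I Qv) [Module.Free ℤ Qv] {A : Type*} [Ring A]
    [Algebra ℂ A]
    [IsDomain A] (Q : KM.Residue D A) :
    VermaIdentities D Q.unit ∧ IsWeylAction ℂ D Q.unit Q.diffAlg ∧
      TauFormulas ℂ D Q.unit ∧ KM.Formulas D Q.unit := by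
  have hs : ∀ i j, i ≠ j → (fun x => (Q.unit i : Localized Q.f) * x - x * Q.unit i)^[
      (1 - D.a i j).toNat] (Q.unit j : Localized Q.f) = 0 := fun i j hij => Q.serre_iterate hij
    (OreLocalization.numeratorRingHom : A →+* Localized Q.f)
  have hv : VermaIdentities D Q.unit := KM.vermaIdentities hs
  refine ⟨hv, isWeylAction hv (fun i _ => KM.famMap_mem_paramImage D i)
    (fun i n => const_mem_paramImage _), tauFormulas D _, KM.formulas hs⟩

theorem KM.weylAction_skewFrac (D : CartanDatum I Qv) [Module.Free ℤ Qv] {A : Type*} [Ring A]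
    [Algebra ℂ A] [LeftOreDomain A] (Q : KM.Residue D A) (hf : ∀ i, Q.f i ≠ 0) :
    VermaIdentities D (Q.fracUnit hf) ∧ IsWeylAction ℂ D (Q.fracUnit hf) (Q.diffAlgP hf) ∧
      TauFormulas ℂ D (Q.fracUnit hf) ∧ KM.Formulas D (Q.fracUnit hf) := by
  have hs : ∀ i j, i ≠ j → (fun x => (Q.fracUnit hf i : SkewFrac A) * x - x * Q.fracUnit hf i)^[
      (1 - D.a i j).toNat] (Q.fracUnit hf j : SkewFrac A) = 0 := fun i j hij =>
    Q.serre_iterate hij (toFrac : A →+* SkewFrac A)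
  have hv : VermaIdentities D (Q.fracUnit hf) := KM.vermaIdentities hs
  have hc : ∀ i (n : ℤ), Fam.const Qv ((Q.fracUnit hf i ^ n : (SkewFrac A)ˣ) : SkewFrac A) ∈
      paramLocImage (KM.ev Qv) A := const_fracUnit_zpow_mem_paramLocImage Q.f hf
  refine ⟨hv, isWeylAction hv (fun i _ => KM.famMap_mem_paramLocImage D i) hc, tauFormulas D _,
    KM.formulas hs⟩

theorem QD.weylAction_localized (D : CartanDatum I Qv) [Module.Free ℤ Qv] {A : Type*} [Ring A]
    [Algebra QD.Cq A]
    [IsDomain A] (Q : QD.Residue D A) :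
    VermaIdentities D Q.unit ∧ IsWeylAction QD.Cq D Q.unit Q.diffAlg ∧
      TauFormulas QD.Cq D Q.unit ∧ QD.Formulas D Q.unit := by
  have hs : ∀ i j, i ≠ j → qAd (QD.qi D i) (D.a i j) (Q.unit i : Localized Q.f)
      (Q.unit j : Localized Q.f) (1 - D.a i j).toNat = 0 := fun i j hij => Q.qAd_eq_zero hij
    (numeratorAlgHom QD.Cq (Submonoid.closure (Set.range Q.f)))
  have hv : VermaIdentities D Q.unit := QD.vermaIdentities hs
  refine ⟨hv, isWeylAction hv (fun i _ => QD.famMap_mem_paramImage D i)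
    (fun i n => const_mem_paramImage _), tauFormulas D _, QD.formulas hs⟩

theorem QD.weylAction_skewFrac (D : CartanDatum I Qv) [Module.Free ℤ Qv] {A : Type*} [Ring A]
    [Algebra QD.Cq A] [LeftOreDomain A] (Q : QD.Residue D A) (hf : ∀ i, Q.f i ≠ 0) :
    VermaIdentities D (Q.fracUnit hf) ∧ IsWeylAction QD.Cq D (Q.fracUnit hf) (Q.diffAlgP hf) ∧
      TauFormulas QD.Cq D (Q.fracUnit hf) ∧ QD.Formulas D (Q.fracUnit hf) := by
  -- Makes the group algebra A[Qv] a left Ore domain, so that its skew field of fractions is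
  -- available.
  have : UniqueSums Qv := uniqueSums_of_free Qv
  have hs : ∀ i j, i ≠ j → qAd (QD.qi D i) (D.a i j) (Q.fracUnit hf i : SkewFrac A)
      (Q.fracUnit hf j : SkewFrac A) (1 - D.a i j).toNat = 0 := fun i j hij =>
    Q.qAd_eq_zero hij (numeratorAlgHom QD.Cq (nonZeroDivisors A))
  have hv : VermaIdentities D (Q.fracUnit hf) := QD.vermaIdentities hs
  have hc : ∀ i (n : ℤ), Fam.const Qv ((Q.fracUnit hf i ^ n : (SkewFrac A)ˣ) : SkewFrac A) ∈
      paramLocImage (QD.ev Qv) A := const_fracUnit_zpow_mem_paramLocImage Q.f hf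
  refine ⟨hv, isWeylAction hv (fun i _ => QD.famMap_mem_paramLocImage D i) hc, tauFormulas D _,
    QD.formulas hs⟩

end QBW

theorem theorem1 {I Qv : Type*} [AddCommGroup Qv] [Module.Free ℤ Qv] (D : QBW.CartanDatum I Qv) :
    (∀ (A : Type*) [Ring A] [Algebra ℂ A] [IsDomain A] (Q : QBW.KM.Residue D A),
      (∀ i, Q.f i ≠ 0) →
        QBW.VermaIdentities D Q.unit ∧
        QBW.IsWeylAction ℂ D Q.unit Q.diffAlg ∧
        QBW.TauFormulas ℂ D Q.unit ∧
        QBW.KM.Formulas D Q.unit) ∧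
    (∀ (A : Type*) [Ring A] [Algebra ℂ A] [QBW.OreDomain A] (Q : QBW.KM.Residue D A)
      (hf : ∀ i, Q.f i ≠ 0),
        QBW.VermaIdentities D (Q.fracUnit hf) ∧
        QBW.IsWeylAction ℂ D (Q.fracUnit hf) (Q.diffAlgP hf) ∧
        QBW.TauFormulas ℂ D (Q.fracUnit hf) ∧
        QBW.KM.Formulas D (Q.fracUnit hf)) ∧
    (∀ (A : Type*) [Ring A] [Algebra QBW.QD.Cq A] [IsDomain A] (Q : QBW.QD.Residue D A),
      (∀ i, Q.f i ≠ 0) →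
        QBW.VermaIdentities D Q.unit ∧
        QBW.IsWeylAction QBW.QD.Cq D Q.unit Q.diffAlg ∧
        QBW.TauFormulas QBW.QD.Cq D Q.unit ∧
        QBW.QD.Formulas D Q.unit) ∧
    (∀ (A : Type*) [Ring A] [Algebra QBW.QD.Cq A] [QBW.OreDomain A] (Q : QBW.QD.Residue D A)
      (hf : ∀ i, Q.f i ≠ 0),
        QBW.VermaIdentities D (Q.fracUnit hf) ∧
        QBW.IsWeylAction QBW.QD.Cq D (Q.fracUnit hf) (Q.diffAlgP hf) ∧
        QBW.TauFormulas QBW.QD.Cq D (Q.fracUnit hf) ∧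
        QBW.QD.Formulas D (Q.fracUnit hf)) := by
  exact ⟨fun A _ _ _ Q _ => QBW.KM.weylAction_localized D Q,
    fun A _ _ _ Q hf => QBW.KM.weylAction_skewFrac D Q hf,
    fun A _ _ _ Q _ => QBW.QD.weylAction_localized D Q,
    fun A _ _ _ Q hf => QBW.QD.weylAction_skewFrac D Q hf⟩
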